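/- **Theorem 5.1 (Forest Lasso guarantee).** *Data.* Let $Z=(X,O)$, where $X\in[0,1]^d$ has a density $f$ on $[0,1]^d$ with $0<c_0\le f\le c_1$ and $O$ takes values in an arbitrary measurable space; conditional expectations given $X=x$ are taken with respect to a fixed Markov kernel giving the conditional law of $O$ given $X=x$ for every $x$. Let $Z_1,\dots,Z_n$ be i.i.d. copies of $Z$. Fix a target $x\in[0,1]^d$ at which $f$ has modulus of continuity $\omega$: $|f(y)-f(x)|\le\omega(\|y-x\|)$ for all $y\in[0,1]^d$, where $\omega(t)\to0$ as $t\downarrow0$. *Forest.* Let $0<\rho\le 0.2$, $0<\pi\le1$, $r\ge1$, $s\le n$. For each $b=1,\dots,B$ independently, draw a uniformly random subsample $S_b$ of size $s$ without replacement, randomly partitioned into $S_b^1$ (of size $\lfloor s/2\rfloor$) and $S_b^2$, and an independent internal seed, and grow a tree of axis-aligned splits of the feature space. The tree is *honest*: it is a measurable function of the observations in $S_b^1$, the feature vectors (only) in $S_b^2$, and the seed. Whenever the features of the subsample lie in $[0,1]^d$ and no two of them share a coordinate value, then: for almost every seed each split leaves at least a fraction $\rho$ of the $S_b^2$-points of its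 node on each side, and each leaf contains between $r$ and $2r-1$ points of $S_b^2$; and, given the data and the splits at the ancestors of a node that is going to be split, that split is along coordinate $j$ with probability at least $\pi/d$ over the seed, for each $j=1,\dots,d$. With $L_b(x)$ the leaf containing $x$, put $$a_i=\frac1B\sum_{b=1}^B\frac{\mathbf 1[X_i\in L_b(x),\,Z_i\in S_b^2]}{|L_b(x)\cap S_b^2|},\qquad \alpha=\frac{\log(\rho^{-1})}{\pi\log((1-\rho)^{-1})}.$$ *Estimator.* Let $V\subseteq\mathbb R^{d_\nu}$ be convex, let $\ell(z;\nu)$ be measurable in $z$ and twice continuously differentiable in $\nu$ near each point of $V$, with $\ell(Z;\nu)$ and $\nabla_\nu\ell(Z;\nu)$ integrable given $X=x'$ for all $x'\in[0,1]^d$, $\nu\in V$. Let $\nu_0(x')\in\arg\min_{\nu\in V}\mathbb E[\ell(Z;\nu)\mid X=x']$ for every $x'\in[0,1]^d$, and let $$\hat\nu(x)\in\arg\min_{\nu\in V}\ \sum_{i=1}^n a_i\,\ell(Z_i;\nu)+\lambda\|\nu\|_1 .$$ *Assumptions.* 1. For every $x'\in[0,1]^d$ the support $S(x')$ of $\nu_0(x')$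 has at most $k$ elements. 2. $\nu_0$ is $L_\nu$-Lipschitz on $[0,1]^d$, and for every $\nu\in V$ the map $x'\mapsto\mathbb E[\nabla_\nu\ell(Z;\nu)\mid X=x']$ is $L$-Lipschitz on $[0,1]^d$, both with respect to $\ell_2$ norms. 3. There is a measurable symmetric-matrix-valued $\mathcal H(z)$ with $\nabla_{\nu\nu}\ell(z;\nu)\succeq\mathcal H(z)\succeq0$ for all $\nu\in V$ and all $z$ (with feature in $[0,1]^d$), and for every $x'\in[0,1]^d$ and every $v$ with $\|v_{S(x')^c}\|_1\le3\|v_{S(x')}\|_1$, $\ v^\top\mathbb E[\mathcal H(Z)\mid X=x']\,v\ge\gamma\|v\|_2^2$. 4. Boundedness: for all $z$ with feature in $[0,1]^d$, the entries of $\mathcal H(z)$ are at most $1$ in absolute value and $\|\nabla_\nu\ell(z;\nu_0(x))\|_\infty\le G$. *Conclusion.* There is a constant $C>0$ depending only on $d,\rho,\pi,r,c_0,c_1,\omega,L,L_\nu,G$ such that, for all choices of the remaining data (in particular $n,s,B,d_\nu,k,\gamma,\delta,\lambda$) with $0<\delta<1$, $2\delta\le d_\nu$, $B\ge C\,n/s$,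 $\gamma>32k\sqrt{s\ln(d_\nu/\delta)/n}$ and $$\lambda\ \ge\ C\left(s^{-1/(2\alpha d)}+\sqrt{\frac{s\ln(d_\nu/\delta)}{n}}\right),$$ with probability at least $1-\delta$ (the exceptional event has outer probability at most $\delta$) every such minimizer satisfies $$\|\hat\nu(x)-\nu_0(x)\|_1\ \le\ \frac{2\lambda k}{\gamma-32k\sqrt{s\ln(d_\nu/\delta)/n}} .$$ -/

import Mathlib

open MeasureTheory ProbabilityTheory Filter Topology

noncomputable section

namespace ForestLasso

/-- Feature vectors, with the Euclidean norm. -/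
abbrev Feat (d : ℕ) : Type := EuclideanSpace ℝ (Fin d)

/-- The feature domain `[0,1]^d`. -/
def cube (d : ℕ) : Set (Feat d) := {x | ∀ j, x j ∈ Set.Icc (0 : ℝ) 1}

/-- An observation `z = (x, o)`: the feature vector `x` and everything else (`o`). -/
abbrev Obs (d : ℕ) (O : Type*) : Type _ := Feat d × O

/-! ### Trees -/

/-- Finite binary trees of axis-aligned splits: `split j c l r` sends the points with
`x j ≤ c` to `l` and the points with `c < x j` to `r`. -/
inductive AxisTree (d : ℕ) : Type
  | leaf : AxisTree d
  | split (j : Fin d) (c : ℝ) (left right : AxisTree d) : AxisTree d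

namespace AxisTree

variable {d : ℕ}

open Classical in
/-- The leaf `L(x)` of the tree (a subset of the feature space) that contains `x`. -/
def leafCell : AxisTree d → Feat d → Set (Feat d)
  | leaf, _ => Set.univ
  | split j c l r, x =>
      if x j ≤ c then {y | y j ≤ c} ∩ l.leafCell x else {y | c < y j} ∩ r.leafCell x

/-- The split `(j, c)` made at the node with address `p` (`false` = left, `true` = right);
`none` if there is no node with this address or if that node is a leaf. -/
def nodeAt : AxisTree d → List Bool → Option (Fin d × ℝ)
  | leaf, _ => none
  | split j c _ _, [] => some (j, c)
  | split _ _ l _, false :: p => l.nodeAt p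
  | split _ _ _ r, true :: p => r.nodeAt p

open Classical in
/-- Structural regularity with respect to the points `(x i)_{i ∈ A}` that reach the root: each
split leaves at least a fraction `ρ` of the points of its node on each side, and each leaf
contains between `r` and `2 r - 1` points. -/
def IsRegular {ι : Type*} (ρ : ℝ) (r : ℕ) (x : ι → Feat d) : AxisTree d → Finset ι → Prop
  | leaf, A => r ≤ A.card ∧ A.card < 2 * r
  | split j c t₁ t₂, A =>
      ρ * A.card ≤ (A.filter fun i => x i j ≤ c).card ∧
      ρ * A.card ≤ (A.filter fun i => c < x i j).card ∧
      t₁.IsRegular ρ r x (A.filter fun i => x i j ≤ c) ∧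
      t₂.IsRegular ρ r x (A.filter fun i => c < x i j)

/-- `h` is the sequence of the splits made at the proper ancestors of the address `p`. -/
def AncestorSplits (t : AxisTree d) (p : List Bool) (h : Fin p.length → Fin d × ℝ) : Prop :=
  ∀ i : Fin p.length, t.nodeAt (p.take i) = some (h i)

end AxisTree

/-- A randomized honest tree learner for subsamples of size `s`. The subsample is partitioned into
`S¹` (`s / 2` points) and `S²` (the other `s - s / 2` points). The tree is grown from the
observations in `S¹`, the *feature vectors* of the points in `S²` (needed to keep the tree
balanced with respect to `S²`), and a random seed; the other components of the
observations in `S²` are not available to the learner. -/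
structure TreeLearner (d s : ℕ) (O Ξ : Type*) [MeasurableSpace O] [MeasurableSpace Ξ] where
  grow : (Fin (s / 2) → Obs d O) → (Fin (s - s / 2) → Feat d) → Ξ → AxisTree d
  measurable_grow : ∀ (p : List Bool) (j : Fin d) (U : Set ℝ), MeasurableSet U →
    MeasurableSet {a : (Fin (s / 2) → Obs d O) × (Fin (s - s / 2) → Feat d) × Ξ |
      ∃ c ∈ U, (grow a.1 a.2.1 a.2.2).nodeAt p = some (j, c)}

/-- All features lie in the cube and no two points share a value of a coordinate. This holds
almost surely when the features have a density on the cube. -/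
def GeneralPosition {d : ℕ} {ι : Type*} (x : ι → Feat d) : Prop :=
  (∀ i, x i ∈ cube d) ∧ ∀ j, Function.Injective fun i => x i j

variable {d s n B m : ℕ} {O Ξ : Type*} [MeasurableSpace O] [MeasurableSpace Ξ]

/-- Forest regularity for a learner with seed distribution `Q`: `ρ`-balanced and leaf sizes
between `r` and `2 r - 1` with respect to `S²`, and `π`-random-split: given the data and
the splits at the ancestors of a node that is going to be split, the probability (over the
internal randomness) that this split is along coordinate `j` is at least `π / d`, for every `j`.
The conditional probability is written out over the events `h ∈ A` about the ancestors. -/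
structure TreeLearner.IsForestRegular (T : TreeLearner d s O Ξ) (Q : Measure Ξ)
    (ρ π : ℝ) (r : ℕ) : Prop where
  regular : ∀ (D₁ : Fin (s / 2) → Obs d O) (x₂ : Fin (s - s / 2) → Feat d),
    GeneralPosition (Sum.elim (fun i => (D₁ i).1) x₂) →
    ∀ᵐ ξ ∂Q, (T.grow D₁ x₂ ξ).IsRegular ρ r x₂ Finset.univ
  random_split : ∀ (D₁ : Fin (s / 2) → Obs d O) (x₂ : Fin (s - s / 2) → Feat d),
    GeneralPosition (Sum.elim (fun i => (D₁ i).1) x₂) →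
    ∀ (p : List Bool) (j : Fin d) (A : Set (Fin p.length → Fin d × ℝ)), MeasurableSet A →
      ENNReal.ofReal (π / d) *
          Q {ξ | (∃ h ∈ A, (T.grow D₁ x₂ ξ).AncestorSplits p h) ∧
            ∃ (j' : Fin d) (c : ℝ), (T.grow D₁ x₂ ξ).nodeAt p = some (j', c)} ≤
        Q {ξ | (∃ h ∈ A, (T.grow D₁ x₂ ξ).AncestorSplits p h) ∧
            ∃ c : ℝ, (T.grow D₁ x₂ ξ).nodeAt p = some (j, c)}

/-- The exponent constant `α = log (ρ⁻¹) / (π log ((1 - ρ)⁻¹))`. -/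
def alpha (ρ π : ℝ) : ℝ := Real.log ρ⁻¹ / (π * Real.log (1 - ρ)⁻¹)

/-! ### Forest weights -/

/-- A subsample of `s` of the `n` indices without replacement, split into `S¹` (left summand) and
`S²` (right summand). -/
abbrev Subsample (n s : ℕ) : Type := (Fin (s / 2) ⊕ Fin (s - s / 2)) ↪ Fin n

instance : MeasurableSpace (Subsample n s) := ⊤

open Classical in
/-- Indices of the observations in `L(x) ∩ S²`, for the tree grown on the subsample `e` with
seed `ξ`. -/
def leafSample (T : TreeLearner d s O Ξ) (Z : Fin n → Obs d O) (e : Subsample n s) (ξ : Ξ)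
    (x : Feat d) : Finset (Fin n) :=
  Finset.univ.filter fun i =>
    (∃ a, e (Sum.inr a) = i) ∧
      (Z i).1 ∈ (T.grow (fun a => Z (e (Sum.inl a))) (fun a => (Z (e (Sum.inr a))).1) ξ).leafCell x

open Classical in
/-- The tree weight `a_{ib}`. -/
def treeWeight (T : TreeLearner d s O Ξ) (Z : Fin n → Obs d O) (e : Subsample n s) (ξ : Ξ)
    (x : Feat d) (i : Fin n) : ℝ :=
  if i ∈ leafSample T Z e ξ x then 1 / ((leafSample T Z e ξ x).card : ℝ) else 0

/-- The forest weight `a_i`, the average of the tree weights of the `B` trees. -/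
def forestWeight (T : TreeLearner d s O Ξ) (Z : Fin n → Obs d O) (w : Fin B → Subsample n s × Ξ)
    (x : Feat d) (i : Fin n) : ℝ :=
  (1 / (B : ℝ)) * ∑ b, treeWeight T Z (w b).1 (w b).2 x i

/-! ### The penalized estimator -/

/-- The `ℓ₁` norm. -/
def l1 (v : EuclideanSpace ℝ (Fin m)) : ℝ := ∑ j, |v j|

/-- `ν` is a minimizer over `V` of the forest-weighted `ℓ₁`-penalized empirical loss at `x`. -/
def IsForestLasso (T : TreeLearner d s O Ξ) (ℓ : Obs d O → EuclideanSpace ℝ (Fin m) → ℝ)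
    (V : Set (EuclideanSpace ℝ (Fin m))) (lam : ℝ) (x : Feat d)
    (Z : Fin n → Obs d O) (w : Fin B → Subsample n s × Ξ) (ν : EuclideanSpace ℝ (Fin m)) : Prop :=
  ν ∈ V ∧ IsMinOn (fun ν' => ∑ i, forestWeight T Z w x i * ℓ (Z i) ν' + lam * l1 ν') V ν

/-! ### The distribution of the data -/

/-- The distribution of the features, with density `f` on the cube. -/
def featureLaw (f : Feat d → ℝ) : Measure (Feat d) :=
  (volume.restrict (cube d)).withDensity fun x => ENNReal.ofReal (f x)

/-- The distribution of an observation, where `κ x` is the conditional distribution of the rest of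
the observation given the feature vector `x`. -/
def obsLaw (f : Feat d → ℝ) (κ : Kernel (Feat d) O) : Measure (Obs d O) := featureLaw f ⊗ₘ κ

/-- The joint distribution of `n` i.i.d. observations and, independently of them, for each of the
`B` trees an independent uniformly random subsample (with its random partition) and an independent
seed. -/
def forestLaw (n s B : ℕ) (f : Feat d → ℝ) (κ : Kernel (Feat d) O) (Q : Measure Ξ) :
    Measure ((Fin n → Obs d O) × (Fin B → Subsample n s × Ξ)) :=
  (Measure.pi fun _ => obsLaw f κ).prod
    (Measure.pi fun _ => (uniformOn (Set.univ : Set (Subsample n s))).prod Q)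

/-! ### Assumptions on the nuisance parameter and the loss -/

/-- The support of a vector. -/
def supp (v : EuclideanSpace ℝ (Fin m)) : Finset (Fin m) := Finset.univ.filter fun j => v j ≠ 0

/-- The cone `C(S; a)` of the vectors with `‖v_{Sᶜ}‖₁ ≤ a ‖v_S‖₁`. -/
def cone (S : Finset (Fin m)) (a : ℝ) : Set (EuclideanSpace ℝ (Fin m)) :=
  {v | ∑ j ∈ Sᶜ, |v j| ≤ a * ∑ j ∈ S, |v j|}

/-- The quadratic form `vᵀ M v`. -/
def quad (M : Matrix (Fin m) (Fin m) ℝ) (v : EuclideanSpace ℝ (Fin m)) : ℝ :=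
  ∑ a, ∑ b, v a * M a b * v b

/-- The assumptions on the loss `ℓ`, the parameter set `V`, the matrix `H z`, the nuisance
parameter `ν₀` and the conditional distributions `κ x`. -/
structure NuisanceAssumptions (κ : Kernel (Feat d) O) (V : Set (EuclideanSpace ℝ (Fin m)))
    (ℓ : Obs d O → EuclideanSpace ℝ (Fin m) → ℝ) (H : Obs d O → Matrix (Fin m) (Fin m) ℝ)
    (ν₀ : Feat d → EuclideanSpace ℝ (Fin m)) (k : ℕ) (γ L Lν : ℝ) : Prop where
  convex : Convex ℝ V
  measurable_loss : ∀ ν, Measurable fun z => ℓ z ν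
  smooth_loss : ∀ z, z.1 ∈ cube d → ∀ ν ∈ V, ContDiffAt ℝ 2 (ℓ z) ν
  integrable_loss : ∀ x ∈ cube d, ∀ ν ∈ V, Integrable (fun o => ℓ (x, o) ν) (κ x)
  integrable_gradient : ∀ x ∈ cube d, ∀ ν ∈ V,
    Integrable (fun o => gradient (ℓ (x, o)) ν) (κ x)
  /-- `ν₀ x` minimizes the local loss `E[ℓ(Z; ν) | X = x]` over `V`. -/
  minimizer : ∀ x ∈ cube d, ν₀ x ∈ V ∧ IsMinOn (fun ν => ∫ o, ℓ (x, o) ν ∂(κ x)) V (ν₀ x)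
  sparse : ∀ x ∈ cube d, (supp (ν₀ x)).card ≤ k
  lipschitz_nuisance : ∀ x ∈ cube d, ∀ x' ∈ cube d, ‖ν₀ x - ν₀ x'‖ ≤ Lν * ‖x - x'‖
  /-- `x ↦ E[∇ℓ(Z; ν) | X = x]` is `L`-Lipschitz. -/
  lipschitz_gradient : ∀ ν ∈ V, ∀ x ∈ cube d, ∀ x' ∈ cube d,
    ‖(∫ o, gradient (ℓ (x, o)) ν ∂(κ x)) - ∫ o, gradient (ℓ (x', o)) ν ∂(κ x')‖ ≤ L * ‖x - x'‖
  measurable_matrix : ∀ a b, Measurable fun z => H z a b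
  posSemidef_matrix : ∀ z, z.1 ∈ cube d → (H z).PosSemidef
  /-- The Hessian of the loss dominates `H z`. -/
  hessian : ∀ z, z.1 ∈ cube d → ∀ ν ∈ V, ∀ v,
    quad (H z) v ≤ fderiv ℝ (fderiv ℝ (ℓ z)) ν v v
  /-- The entries of `H z` are bounded by one. -/
  bounded_matrix : ∀ z, z.1 ∈ cube d → ∀ a b, |H z a b| ≤ 1
  /-- The conditional restricted eigenvalue condition. -/
  restricted_eigenvalue : ∀ x ∈ cube d, ∀ v ∈ cone (supp (ν₀ x)) 3,
    γ * ‖v‖ ^ 2 ≤ quad (Matrix.of fun a b => ∫ o, H (x, o) a b ∂(κ x)) v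

end ForestLasso

end

/-! The proof separates a deterministic Lasso argument from probabilistic control of three forest
averages.

Deterministic part (`lasso_error_bound`). Let `v` be the error of a minimizer and `A` the `ℓ₁` norm
of `v` on the support of `ν₀ x`. Optimality and the lower bound on the Hessian give a basic
inequality; optimality of `ν₀ x` lets the population gradient be subtracted from the linear term. If
the weighted centered gradients are at most `λ/20`, the curvature `Q = Σ aᵢ vᵀ H(Zᵢ) v` is at most
`λ (2A - (19/20) ‖v‖₁)`. For a lower bound, `H(Zᵢ)` is replaced by its conditional mean at `Xᵢ`, and
the restricted eigenvalue condition is used at `Xᵢ`, not at `x`. This is legitimate when `Xᵢ` is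
near `x`: there `ν₀ x` is small off the support of `ν₀ Xᵢ`, so `v` lies in the cone of that support
unless `‖v‖₁ ≤ 2λk`, a case already within the bound. By Markov, the far points carry weight at most
`1/20` once the weighted mean distance to `x` is small. A quadratic inequality finishes.

Probabilistic part. The required averages concern gradients, distances to `x` and entries of `H`.
Each is a mean over trees of a bounded function of one block of `s` observations and a seed. Given
the data the trees are i.i.d. with mean a complete U-statistic of order `s`, so Hoeffding's
averaging over disjoint blocks gives the sub-Gaussian variance proxy `M² (1/B + 1/⌊n/s⌋)`
(`integral_exp_forest_average_le`). By honesty (`integral_blockAvg`) the expectation can be computed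
with conditional means given the features: it is zero for the centered entries of `H`, and at most
`|L|` times the mean distance to `x` for the gradients.

Bias (`exists_shrinkage`). With high probability every box contains about as many sample points as
expected. A split that discards a `ρ`-fraction of the points of a large node then removes a definite
fraction of the side that is cut: `β = ρ c₀ / (2 c₁)` in general, and `3ρ/4` once the box is small
enough for the density to be nearly constant. A potential, the side of interest times powers of the
sides that are still long, turns this into a geometric decay of the expected side in the depth
(`lintegral_side_le`): at each node some coordinate, determined by the ancestors, shrinks the
potential by `1 - 3ρ/4`, and it is chosen with conditional probability at least `π/d`. Stopping
while a node still has of the order of `s^(1/8)` points loses a factor `7/8` in the depth; the slack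
in `log (1-ρ)⁻¹ ≤ 5ρ/4` pays for it. -/

namespace ForestLasso

/-! ### Convexity along segments and first-order conditions -/

section Deterministic

variable {E : Type*} [NormedAddCommGroup E] [NormedSpace ℝ E]

lemma hasDerivAt_line {g : E → ℝ} {ν v : E} {u : ℝ} (h : ContDiffAt ℝ 2 g (ν + u • v)) :
    HasDerivAt (fun u : ℝ => g (ν + u • v)) (fderiv ℝ g (ν + u • v) v) u := by
  have h1 : HasFDerivAt g (fderiv ℝ g (ν + u • v)) (ν + u • v) :=
    (h.differentiableAt (by norm_num)).hasFDerivAt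
  have h2 : HasDerivAt (fun u : ℝ => ν + u • v) v u := by
    simpa using ((hasDerivAt_id u).smul_const v).const_add ν
  exact h1.comp_hasDerivAt u h2

lemma hasDerivAt_line_fderiv {g : E → ℝ} {ν v : E} {u : ℝ} (h : ContDiffAt ℝ 2 g (ν + u • v)) :
    HasDerivAt (fun u : ℝ => fderiv ℝ g (ν + u • v) v)
      (fderiv ℝ (fderiv ℝ g) (ν + u • v) v v) u := by
  have h0 : ContDiffAt ℝ 1 (fderiv ℝ g) (ν + u • v) := h.fderiv_right (by norm_num)
  have h1 : HasFDerivAt (fderiv ℝ g) (fderiv ℝ (fderiv ℝ g) (ν + u • v)) (ν + u • v) :=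
    (h0.differentiableAt (by norm_num)).hasFDerivAt
  have h2 : HasDerivAt (fun u : ℝ => ν + u • v) v u := by
    simpa using ((hasDerivAt_id u).smul_const v).const_add ν
  have h3 := h1.comp_hasDerivAt u h2
  exact h3.clm_apply (hasDerivAt_const u v) |>.congr_deriv (by simp)

lemma segment_mem {V : Set E} (hV : Convex ℝ V) {ν ν' : E} (hν : ν ∈ V) (hν' : ν' ∈ V) {u : ℝ}
    (hu : u ∈ Set.Icc (0 : ℝ) 1) : ν + u • (ν' - ν) ∈ V :=
  hV.add_smul_sub_mem hν hν' hu

/-- Strong monotonicity of the gradient along a segment on which the Hessian is bounded below. -/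
lemma le_fderiv_sub_fderiv {V : Set E} (hV : Convex ℝ V) {g : E → ℝ} {ν ν' : E} (hν : ν ∈ V)
    (hν' : ν' ∈ V) {c : ℝ} (hg : ∀ y ∈ V, ContDiffAt ℝ 2 g y)
    (hc : ∀ y ∈ V, c ≤ fderiv ℝ (fderiv ℝ g) y (ν' - ν) (ν' - ν)) {u₁ u₂ : ℝ}
    (h0 : 0 ≤ u₁) (h12 : u₁ ≤ u₂) (h1 : u₂ ≤ 1) :
    c * (u₂ - u₁) ≤ fderiv ℝ g (ν + u₂ • (ν' - ν)) (ν' - ν) -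
      fderiv ℝ g (ν + u₁ • (ν' - ν)) (ν' - ν) := by
  have hd : ∀ u ∈ Set.Icc (0 : ℝ) 1, HasDerivAt
      (fun u : ℝ => fderiv ℝ g (ν + u • (ν' - ν)) (ν' - ν)) _ u :=
    fun u hu => hasDerivAt_line_fderiv (hg _ (segment_mem hV hν hν' hu))
  refine (convex_Icc (0 : ℝ) 1).mul_sub_le_image_sub_of_le_deriv
    (f := fun u : ℝ => fderiv ℝ g (ν + u • (ν' - ν)) (ν' - ν))
    (fun u hu => (hd u hu).continuousAt.continuousWithinAt) ?_ ?_ u₁ ⟨h0, h12.trans h1⟩ u₂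
    ⟨h0.trans h12, h1⟩ h12
  · exact fun u hu => (hd u (interior_subset hu)).differentiableAt.differentiableWithinAt
  · intro u hu
    rw [(hd u (interior_subset hu)).deriv]
    exact hc _ (segment_mem hV hν hν' (interior_subset hu))

/-- The difference quotients of a convex function along a segment. -/
lemma slope_bounds {V : Set E} (hV : Convex ℝ V) {g : E → ℝ} {ν ν' : E} (hν : ν ∈ V)
    (hν' : ν' ∈ V) (hg : ∀ y ∈ V, ContDiffAt ℝ 2 g y)
    (hc : ∀ y ∈ V, 0 ≤ fderiv ℝ (fderiv ℝ g) y (ν' - ν) (ν' - ν)) {u : ℝ}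
    (h0 : 0 < u) (h1 : u ≤ 1) :
    fderiv ℝ g ν (ν' - ν) ≤ (g (ν + u • (ν' - ν)) - g ν) / u ∧
      (g (ν + u • (ν' - ν)) - g ν) / u ≤ g ν' - g ν := by
  have hd : ∀ u ∈ Set.Icc (0 : ℝ) 1, HasDerivAt (fun u : ℝ => g (ν + u • (ν' - ν))) _ u :=
    fun u hu => hasDerivAt_line (hg _ (segment_mem hV hν hν' hu))
  have hcont : ContinuousOn (fun u : ℝ => g (ν + u • (ν' - ν))) (Set.Icc 0 1) :=
    fun u hu => (hd u hu).continuousAt.continuousWithinAt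
  have hmono : MonotoneOn (deriv fun u : ℝ => g (ν + u • (ν' - ν))) (interior (Set.Icc 0 1)) := by
    intro a ha b hb hab
    rw [(hd a (interior_subset ha)).deriv, (hd b (interior_subset hb)).deriv]
    have := le_fderiv_sub_fderiv hV hν hν' hg hc (interior_subset ha).1 hab (interior_subset hb).2
    linarith
  have hconv : ConvexOn ℝ (Set.Icc (0 : ℝ) 1) fun u : ℝ => g (ν + u • (ν' - ν)) :=
    hmono.convexOn_of_deriv (convex_Icc 0 1) hcont
      fun u hu => (hd u (interior_subset hu)).differentiableAt.differentiableWithinAt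
  constructor
  · have h := hconv.le_slope_of_hasDerivAt (x := 0) (y := u) (by simp) ⟨h0.le, h1⟩ h0
      (hd 0 (by simp))
    simpa [slope_def_field] using h
  · have h := hconv.2 (show (0 : ℝ) ∈ Set.Icc 0 1 by simp) (show (1 : ℝ) ∈ Set.Icc 0 1 by simp)
      (show 0 ≤ 1 - u by linarith) h0.le (by ring)
    simp only [smul_eq_mul, mul_zero, mul_one, zero_add, zero_smul, add_zero, one_smul,
      add_sub_cancel] at h
    rw [div_le_iff₀ h0]
    linarith

/-- The first-order condition at a minimizer of a penalized weighted loss. -/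
lemma penalized_minimizer_inequality {ι : Type*} (I : Finset ι) {V : Set E} (hV : Convex ℝ V)
    {g : ι → E → ℝ} {a q : ι → ℝ} (ha : ∀ i ∈ I, 0 ≤ a i) {pen : E → ℝ} {lam : ℝ} (hlam : 0 ≤ lam)
    {ν ν' : E} (hpen : ∀ u ∈ Set.Icc (0 : ℝ) 1,
      pen (ν + u • (ν' - ν)) ≤ (1 - u) * pen ν + u * pen ν')
    (hν : ν ∈ V) (hν' : ν' ∈ V) (hg : ∀ i ∈ I, ∀ y ∈ V, ContDiffAt ℝ 2 (g i) y)
    (hq : ∀ i ∈ I, ∀ y ∈ V, q i ≤ fderiv ℝ (fderiv ℝ (g i)) y (ν' - ν) (ν' - ν))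
    (hmin : IsMinOn (fun y => ∑ i ∈ I, a i * g i y + lam * pen y) V ν') :
    ∑ i ∈ I, a i * q i + ∑ i ∈ I, a i * fderiv ℝ (g i) ν (ν' - ν) ≤ lam * (pen ν - pen ν') := by
  -- The loss is differentiated at the endpoint `u = 1`, the minimizer, from the left. The penalty
  -- need not be differentiable there: its convexity along the segment suffices.
  have hder : HasDerivAt (fun u : ℝ => ∑ i ∈ I, a i * g i (ν + u • (ν' - ν)))
      (∑ i ∈ I, a i * fderiv ℝ (g i) (ν + (1 : ℝ) • (ν' - ν)) (ν' - ν)) 1 := by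
    refine HasDerivAt.fun_sum fun i hi => ?_
    exact (hasDerivAt_line (hg i hi _ (segment_mem hV hν hν' (by simp)))).const_mul _
  have hslope := (hasDerivAt_iff_tendsto_slope.1 hder).mono_left
    (nhdsWithin_mono (1 : ℝ) (s := Set.Iio 1) (fun y hy => ne_of_lt hy))
  have hle : ∑ i ∈ I, a i * fderiv ℝ (g i) (ν + (1 : ℝ) • (ν' - ν)) (ν' - ν) ≤
      lam * (pen ν - pen ν') := by
    refine le_of_tendsto hslope ?_
    filter_upwards [Ioo_mem_nhdsLT (zero_lt_one' ℝ)] with u hu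
    have hu' : u ∈ Set.Icc (0 : ℝ) 1 := ⟨hu.1.le, hu.2.le⟩
    have h1 := isMinOn_iff.1 hmin _ (segment_mem hV hν hν' hu')
    have h2 := mul_le_mul_of_nonneg_left (hpen u hu') hlam
    rw [slope_def_field, div_le_iff_of_neg (by linarith [hu.2])]
    simp only [one_smul, add_sub_cancel]
    nlinarith
  -- Moving the derivative of each loss from `u = 1` back to `u = 0` gains the curvature `q i`.
  refine le_trans ?_ hle
  rw [← Finset.sum_add_distrib]
  refine Finset.sum_le_sum fun i hi => ?_
  have := le_fderiv_sub_fderiv hV hν hν' (hg i hi) (hq i hi) le_rfl zero_le_one le_rfl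
  simp only [zero_smul, add_zero, one_smul, sub_zero, mul_one] at this ⊢
  nlinarith [mul_le_mul_of_nonneg_left this (ha i hi)]

end Deterministic

/-! ### The deterministic Lasso bound -/

section Lasso

variable {m : ℕ}

lemma l1_nonneg (v : EuclideanSpace ℝ (Fin m)) : 0 ≤ l1 v :=
  Finset.sum_nonneg fun _ _ => abs_nonneg _

lemma l1_segment (v w : EuclideanSpace ℝ (Fin m)) {u : ℝ} (hu : u ∈ Set.Icc (0 : ℝ) 1) :
    l1 (v + u • (w - v)) ≤ (1 - u) * l1 v + u * l1 w := by
  unfold l1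
  rw [Finset.mul_sum, Finset.mul_sum, ← Finset.sum_add_distrib]
  refine Finset.sum_le_sum fun j _ => ?_
  have h : (v + u • (w - v)) j = (1 - u) * v j + u * w j := by simp; ring
  rw [h]
  refine (abs_add_le _ _).trans ?_
  rw [abs_mul, abs_mul, abs_of_nonneg (by linarith [hu.2] : 0 ≤ 1 - u), abs_of_nonneg hu.1]

lemma l1_split (S : Finset (Fin m)) (v : EuclideanSpace ℝ (Fin m)) :
    l1 v = ∑ j ∈ S, |v j| + ∑ j ∈ Sᶜ, |v j| :=
  (Finset.sum_add_sum_compl S _).symm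

/-- Triangle inequality on `S` and on its complement. The set `S` is arbitrary, because this is
applied to the supports at the sample points as well as to the support of the target; the last term
pays for the mismatch. -/
lemma l1_sub_l1_le (S : Finset (Fin m)) (v w : EuclideanSpace ℝ (Fin m)) :
    l1 v - l1 w ≤ ∑ j ∈ S, |(w - v) j| - ∑ j ∈ Sᶜ, |(w - v) j| + 2 * ∑ j ∈ Sᶜ, |v j| := by
  rw [l1_split S v, l1_split S w]
  have h1 : ∑ j ∈ S, |v j| ≤ ∑ j ∈ S, |(w - v) j| + ∑ j ∈ S, |w j| := by
    rw [← Finset.sum_add_distrib]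
    refine Finset.sum_le_sum fun j _ => ?_
    have := abs_sub_abs_le_abs_sub (v j) (w j)
    rw [abs_sub_comm] at this
    simp only [PiLp.sub_apply]; linarith
  have h2 : ∑ j ∈ Sᶜ, |(w - v) j| ≤ ∑ j ∈ Sᶜ, |w j| + ∑ j ∈ Sᶜ, |v j| := by
    rw [← Finset.sum_add_distrib]
    exact Finset.sum_le_sum fun j _ => abs_sub _ _
  linarith

lemma sq_sum_abs_le (S : Finset (Fin m)) (v : EuclideanSpace ℝ (Fin m)) :
    (∑ j ∈ S, |v j|) ^ 2 ≤ S.card * ‖v‖ ^ 2 := by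
  refine (sq_sum_le_card_mul_sum_sq (s := S) (f := fun j => |v j|)).trans ?_
  rw [EuclideanSpace.norm_sq_eq]
  refine mul_le_mul_of_nonneg_left ?_ (by positivity)
  simp only [Real.norm_eq_abs]
  exact Finset.sum_le_sum_of_subset_of_nonneg (Finset.subset_univ _) fun _ _ _ => by positivity

lemma quad_sum {ι : Type*} (I : Finset ι) (a : ι → ℝ) (M : ι → Matrix (Fin m) (Fin m) ℝ)
    (v : EuclideanSpace ℝ (Fin m)) :
    ∑ i ∈ I, a i * quad (M i) v = ∑ b, ∑ c, v b * (∑ i ∈ I, a i * M i b c) * v c := by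
  simp only [quad, Finset.mul_sum, Finset.sum_mul]
  rw [Finset.sum_comm]
  refine Finset.sum_congr rfl fun b _ => ?_
  rw [Finset.sum_comm]
  refine Finset.sum_congr rfl fun c _ => Finset.sum_congr rfl fun i _ => ?_
  ring

lemma abs_sum_sum_le (v : EuclideanSpace ℝ (Fin m)) (A : Fin m → Fin m → ℝ) {e : ℝ}
    (hA : ∀ b c, |A b c| ≤ e) : |∑ b, ∑ c, v b * A b c * v c| ≤ e * l1 v ^ 2 := by
  have h : e * l1 v ^ 2 = ∑ b, ∑ c, |v b| * e * |v c| := by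
    rw [l1, sq, Finset.sum_mul_sum, Finset.mul_sum]
    refine Finset.sum_congr rfl fun b _ => ?_
    rw [Finset.mul_sum]
    exact Finset.sum_congr rfl fun c _ => by ring
  rw [h]
  refine (Finset.abs_sum_le_sum_abs _ _).trans (Finset.sum_le_sum fun b _ => ?_)
  refine (Finset.abs_sum_le_sum_abs _ _).trans (Finset.sum_le_sum fun c _ => ?_)
  rw [abs_mul, abs_mul]
  gcongr
  exact hA b c

/-- Multiplying by `γ` gives a quadratic inequality in `γ * A`. If `t * γ` exceeded `2 * lam * k`,
completing the square at `19/20 * (γ * A) = k * lam` would contradict it. -/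
lemma lasso_scalar_bound {γ lam A t Q k : ℝ} (hγ : 0 < γ) (hlam : 0 < lam) (hk : 1 ≤ k)
    (h1 : 19 / 20 * γ * A ^ 2 ≤ k * Q) (h2 : Q ≤ lam * (2 * A - 19 / 20 * t)) :
    t * γ ≤ 2 * lam * k := by
  have hk0 : 0 ≤ k := by linarith
  by_contra hcon
  push Not at hcon
  have h6 : 19 / 20 * γ * A ^ 2 ≤ k * (lam * (2 * A - 19 / 20 * t)) :=
    h1.trans (mul_le_mul_of_nonneg_left h2 hk0)
  have hkl : 0 < k * lam := by positivity
  have h7 : 19 / 20 * (γ * A) ^ 2 ≤ (k * lam) * (2 * (γ * A) - 19 / 20 * (t * γ)) := by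
    have := mul_le_mul_of_nonneg_left h6 hγ.le
    nlinarith
  have h8 : (k * lam) * (2 * (γ * A) - 19 / 20 * (t * γ)) ≤
      (k * lam) * (2 * (γ * A) - 19 / 20 * (2 * lam * k)) := by
    gcongr
  nlinarith [sq_nonneg (19 / 20 * (γ * A) - k * lam), mul_pos hkl hkl]

set_option maxHeartbeats 1000000 in
/-- Deterministic error bound for the weighted Lasso with approximately constant supports. -/
lemma lasso_error_bound {ι : Type*} (I : Finset ι) {V : Set (EuclideanSpace ℝ (Fin m))}
    (hV : Convex ℝ V) {g : ι → EuclideanSpace ℝ (Fin m) → ℝ} {a D : ι → ℝ}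
    {H M : ι → Matrix (Fin m) (Fin m) ℝ} {S : ι → Finset (Fin m)}
    {ν₀ gbar ν : EuclideanSpace ℝ (Fin m)} {k : ℕ} {γ ε lam thr : ℝ}
    (ha : ∀ i ∈ I, 0 ≤ a i) (hsum : ∑ i ∈ I, a i = 1) (hν₀ : ν₀ ∈ V) (hν : ν ∈ V)
    (hg : ∀ i ∈ I, ∀ y ∈ V, ContDiffAt ℝ 2 (g i) y)
    (hH : ∀ i ∈ I, ∀ y ∈ V, ∀ v, quad (H i) v ≤ fderiv ℝ (fderiv ℝ (g i)) y v v)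
    (hHpos : ∀ i ∈ I, ∀ v, 0 ≤ quad (H i) v)
    (hcard : (supp ν₀).card ≤ k) (hgbar : 0 ≤ inner ℝ gbar (ν - ν₀))
    (hgrad : ∀ j, |∑ i ∈ I, a i * (gradient (g i) ν₀ j - gbar j)| ≤ lam / 20)
    (hD0 : ∀ i ∈ I, 0 ≤ D i) (hthr : 0 < thr) (hD : ∑ i ∈ I, a i * D i ≤ thr / 20)
    (hMpos : ∀ i ∈ I, ∀ v, 0 ≤ quad (M i) v)
    (hRE : ∀ i ∈ I, ∀ v ∈ cone (S i) 3, γ * ‖v‖ ^ 2 ≤ quad (M i) v)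
    (hτ : ∀ i ∈ I, D i ≤ thr → ∑ j ∈ (S i)ᶜ, |ν₀ j| ≤ k * lam / 4)
    (he : (supp ν₀).Nonempty →
      γ ≤ 1 ∧ ∀ b c, |∑ i ∈ I, a i * (H i b c - M i b c)| ≤ 13 / 2 * ε)
    (hlam : 0 < lam) (hε : 0 ≤ ε) (hγ : 32 * k * ε < γ)
    (hmin : IsMinOn (fun y => ∑ i ∈ I, a i * g i y + lam * l1 y) V ν) :
    l1 (ν - ν₀) ≤ 2 * lam * k / (γ - 32 * k * ε) := by
  set v := ν - ν₀ with hv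
  have hγ' : 0 < γ - 32 * k * ε := by linarith
  have hbasic := penalized_minimizer_inequality I hV (q := fun i => quad (H i) v) ha hlam.le
    (fun u hu => l1_segment ν₀ ν hu) hν₀ hν hg (fun i hi y hy => hH i hi y hy v) hmin
  -- The weights sum to one, so `gbar` can be subtracted from every gradient at the cost of `⟪gbar,
  -- v⟫`, which is nonnegative and helps.
  have hlin : -(lam / 20 * l1 v) ≤ ∑ i ∈ I, a i * fderiv ℝ (g i) ν₀ v := by
    have h1 : ∀ i ∈ I, a i * fderiv ℝ (g i) ν₀ v =
        (∑ j, a i * (gradient (g i) ν₀ j - gbar j) * v j) + a i * inner ℝ gbar v := by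
      intro i hi
      have hdi : DifferentiableAt ℝ (g i) ν₀ := (hg i hi ν₀ hν₀).differentiableAt (by norm_num)
      have h2 : fderiv ℝ (g i) ν₀ v = inner ℝ (gradient (g i) ν₀) v := by
        rw [gradient, InnerProductSpace.toDual_symm_apply]
      rw [h2]
      simp only [PiLp.inner_apply, RCLike.inner_apply, conj_trivial, Finset.mul_sum]
      rw [← Finset.sum_add_distrib]
      exact Finset.sum_congr rfl fun j _ => by ring
    rw [Finset.sum_congr rfl h1, Finset.sum_add_distrib, ← Finset.sum_mul, hsum, one_mul,
      Finset.sum_comm]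
    have h3 : |∑ j, ∑ i ∈ I, a i * (gradient (g i) ν₀ j - gbar j) * v j| ≤ lam / 20 * l1 v := by
      unfold l1
      rw [Finset.mul_sum]
      refine (Finset.abs_sum_le_sum_abs _ _).trans (Finset.sum_le_sum fun j _ => ?_)
      rw [← Finset.sum_mul, abs_mul]
      exact mul_le_mul_of_nonneg_right (hgrad j) (abs_nonneg _)
    have := (abs_le.1 h3).1
    linarith
  set Q := ∑ i ∈ I, a i * quad (H i) v with hQ
  have hQ0 : 0 ≤ Q := Finset.sum_nonneg fun i hi => mul_nonneg (ha i hi) (hHpos i hi v)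
  have hQle : Q ≤ lam * (l1 ν₀ - l1 ν) + lam / 20 * l1 v := by linarith
  have hk0 : (0 : ℝ) ≤ k := Nat.cast_nonneg k
  have ht0 := l1_nonneg v
  have hτ0 : ∑ j ∈ (supp ν₀)ᶜ, |ν₀ j| = 0 :=
    Finset.sum_eq_zero fun j hj => by simpa [supp] using hj
  have hS := l1_sub_l1_le (supp ν₀) ν₀ ν
  rw [hτ0, ← hv] at hS
  have hsplit := l1_split (supp ν₀) v
  set A := ∑ j ∈ supp ν₀, |v j| with hA
  set b := ∑ j ∈ (supp ν₀)ᶜ, |v j| with hb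
  have hA0 : 0 ≤ A := Finset.sum_nonneg fun _ _ => abs_nonneg _
  have hb0 : 0 ≤ b := Finset.sum_nonneg fun _ _ => abs_nonneg _
  have hQ2 : Q ≤ lam * (2 * A - 19 / 20 * l1 v) := by nlinarith
  have htA : l1 v ≤ 40 / 19 * A := by
    by_contra hcon
    push Not at hcon
    have : lam * (2 * A - 19 / 20 * l1 v) < 0 := mul_neg_of_pos_of_neg hlam (by linarith)
    linarith
  rcases (supp ν₀).eq_empty_or_nonempty with hemp | hne
  · have hA' : A = 0 := by simp [hA, hemp]
    have : l1 v = 0 := by linarith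
    rw [this]; positivity
  obtain ⟨hγ1, hHM⟩ := he hne
  have hk1 : (1 : ℝ) ≤ k := by exact_mod_cast (Finset.card_pos.2 hne).trans_le hcard
  by_contra hcon
  push Not at hcon
  have hkε : 0 ≤ 32 * k * ε := by positivity
  -- Since `γ ≤ 1`, violating the claim forces the error above `2 * lam * k`. This makes the support
  -- mismatch negligible relative to `l1 v`.
  have htbig : 2 * lam * k < l1 v := by
    refine lt_of_le_of_lt ?_ hcon
    rw [le_div_iff₀ hγ']
    have : 0 ≤ 2 * lam * k := by positivity
    nlinarith
  -- From `0 ≤ Q` and `k * lam / 2 ≤ l1 v / 4` one gets `bi ≤ ai + (1/4 + 1/20) (ai + bi)`, hence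
  -- `bi ≤ (13/7) ai`, inside the cone of aperture 3.
  have hcone : ∀ i ∈ I, D i ≤ thr → v ∈ cone (S i) 3 := by
    intro i hi hDi
    have h1 := l1_sub_l1_le (S i) ν₀ ν
    rw [← hv] at h1
    have h2 := hτ i hi hDi
    have h3 := l1_split (S i) v
    simp only [cone]
    show ∑ j ∈ (S i)ᶜ, |v j| ≤ 3 * ∑ j ∈ S i, |v j|
    set ai := ∑ j ∈ S i, |v j|
    set bi := ∑ j ∈ (S i)ᶜ, |v j|
    have h4 : 0 ≤ lam * (ai - bi + 2 * (k * lam / 4) + 1 / 20 * l1 v) := by nlinarith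
    have h5 : 0 ≤ ai - bi + 2 * (k * lam / 4) + 1 / 20 * l1 v := nonneg_of_mul_nonneg_right h4 hlam
    nlinarith
  have hnorm : A ^ 2 ≤ k * ‖v‖ ^ 2 :=
    (sq_sum_abs_le (supp ν₀) v).trans (by gcongr)
  have hγ0 : 0 < γ := by linarith
  -- Markov's inequality in additive form: for a far index `a i ≤ a i * D i / thr`, so its lower
  -- bound is nonpositive and positive semidefiniteness is enough. The loss sums to at most `1/20`.
  have hgood : 19 / 20 * (γ * ‖v‖ ^ 2) ≤ ∑ i ∈ I, a i * quad (M i) v := by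
    have h1 : ∀ i ∈ I, a i * (γ * ‖v‖ ^ 2) - a i * D i / thr * (γ * ‖v‖ ^ 2) ≤
        a i * quad (M i) v := by
      intro i hi
      have hw : 0 ≤ γ * ‖v‖ ^ 2 := by positivity
      by_cases hDi : D i ≤ thr
      · have h2 := mul_le_mul_of_nonneg_left (hRE i hi v (hcone i hi hDi)) (ha i hi)
        have h3 : 0 ≤ a i * D i / thr := div_nonneg (mul_nonneg (ha i hi) (hD0 i hi)) hthr.le
        nlinarith
      · push Not at hDi
        have h2 : a i ≤ a i * D i / thr := by
          rw [le_div_iff₀ hthr]; exact mul_le_mul_of_nonneg_left hDi.le (ha i hi)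
        have h3 := mul_nonneg (ha i hi) (hMpos i hi v)
        nlinarith
    have h2 := Finset.sum_le_sum h1
    rw [Finset.sum_sub_distrib, ← Finset.sum_mul, ← Finset.sum_mul, hsum, ← Finset.sum_div] at h2
    have h3 : (∑ i ∈ I, a i * D i) / thr ≤ 1 / 20 := by
      rw [div_le_iff₀ hthr]; linarith
    have hw : 0 ≤ γ * ‖v‖ ^ 2 := by positivity
    nlinarith
  have hdiff : |Q - ∑ i ∈ I, a i * quad (M i) v| ≤ 13 / 2 * ε * l1 v ^ 2 := by
    have h1 : Q - ∑ i ∈ I, a i * quad (M i) v =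
        ∑ b, ∑ c, v b * (∑ i ∈ I, a i * (H i b c - M i b c)) * v c := by
      rw [hQ, quad_sum, quad_sum, ← Finset.sum_sub_distrib]
      refine Finset.sum_congr rfl fun b _ => ?_
      rw [← Finset.sum_sub_distrib]
      refine Finset.sum_congr rfl fun c _ => ?_
      simp only [mul_sub, Finset.sum_sub_distrib]
      ring
    rw [h1]
    exact abs_sum_sum_le v _ hHM
  have hQlow := (abs_le.1 hdiff).1
  have ht2 : l1 v ^ 2 ≤ (40 / 19 * A) ^ 2 := by gcongr
  -- The origin of the constant 32: `(13/2) (40/19)² < 28.9`, below `(19/20) * 32 = 30.4`.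
  have hεt : 13 / 2 * ε * l1 v ^ 2 ≤ 19 / 20 * 32 * ε * A ^ 2 := by
    have := mul_le_mul_of_nonneg_left ht2 hε
    have h2 : 0 ≤ ε * A ^ 2 := by positivity
    nlinarith
  have hmain : 19 / 20 * (γ - 32 * k * ε) * A ^ 2 ≤ k * Q := by
    have h1 : 19 / 20 * (γ * A ^ 2) ≤ 19 / 20 * (γ * (k * ‖v‖ ^ 2)) := by gcongr
    have h2 : 19 / 20 * (γ * ‖v‖ ^ 2) - 19 / 20 * 32 * ε * A ^ 2 ≤ Q := by linarith
    have h3 := mul_le_mul_of_nonneg_left h2 hk0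
    nlinarith
  have := lasso_scalar_bound hγ' hlam hk1 hmain hQ2
  rw [div_lt_iff₀ hγ'] at hcon
  linarith

end Lasso

/-! ### Optimality of the population minimizer -/

section Population

variable {m : ℕ} {O : Type*} [MeasurableSpace O]

/-- First-order condition for a minimizer over a convex set of an expected convex loss. -/
lemma inner_integral_gradient_nonneg {μ : Measure O} {V : Set (EuclideanSpace ℝ (Fin m))}
    (hV : Convex ℝ V) {g : O → EuclideanSpace ℝ (Fin m) → ℝ}
    (hg : ∀ o, ∀ y ∈ V, ContDiffAt ℝ 2 (g o) y)
    (hpos : ∀ o, ∀ y ∈ V, ∀ v, 0 ≤ fderiv ℝ (fderiv ℝ (g o)) y v v)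
    (hint : ∀ y ∈ V, Integrable (fun o => g o y) μ) {ν₀ ν : EuclideanSpace ℝ (Fin m)}
    (hgrad : Integrable (fun o => gradient (g o) ν₀) μ) (hν₀ : ν₀ ∈ V) (hν : ν ∈ V)
    (hmin : IsMinOn (fun y => ∫ o, g o y ∂μ) V ν₀) :
    0 ≤ inner ℝ (∫ o, gradient (g o) ν₀ ∂μ) (ν - ν₀) := by
  have hfd : ∀ o, fderiv ℝ (g o) ν₀ (ν - ν₀) = inner ℝ (ν - ν₀) (gradient (g o) ν₀) := by
    intro o
    rw [gradient, real_inner_comm, InnerProductSpace.toDual_symm_apply]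
  rw [real_inner_comm, ← integral_inner hgrad]
  have hu : Tendsto (fun N : ℕ => 1 / ((N : ℝ) + 1)) atTop (𝓝[≠] 0) := by
    rw [tendsto_nhdsWithin_iff]
    exact ⟨tendsto_one_div_add_atTop_nhds_zero_nat,
      Eventually.of_forall fun N => by simp; positivity⟩
  -- Difference quotients of a convex function lie between the directional derivative at `ν₀` and
  -- the increment to `ν`, both integrable. Dominated convergence along steps `1 / (N + 1)`
  -- therefore yields the derivative with no bound on nearby gradients.
  have hlim := tendsto_integral_of_dominated_convergence (μ := μ)
    (F := fun (N : ℕ) o => (g o (ν₀ + (1 / ((N : ℝ) + 1)) • (ν - ν₀)) - g o ν₀) /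
      (1 / ((N : ℝ) + 1)))
    (f := fun o => inner ℝ (ν - ν₀) (gradient (g o) ν₀))
    (fun o => |inner ℝ (ν - ν₀) (gradient (g o) ν₀)| + |g o ν - g o ν₀|) ?_ ?_ ?_ ?_
  · refine ge_of_tendsto' hlim fun N => ?_
    have hmem : ν₀ + (1 / ((N : ℝ) + 1)) • (ν - ν₀) ∈ V := by
      refine segment_mem hV hν₀ hν ⟨by positivity, ?_⟩
      rw [div_le_one (by positivity)]; linarith [(Nat.cast_nonneg N : (0 : ℝ) ≤ N)]
    rw [integral_div, integral_sub (hint _ hmem) (hint _ hν₀)]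
    have := isMinOn_iff.1 hmin _ hmem
    exact div_nonneg (by linarith) (by positivity)
  · intro N
    have hmem : ν₀ + (1 / ((N : ℝ) + 1)) • (ν - ν₀) ∈ V := by
      refine segment_mem hV hν₀ hν ⟨by positivity, ?_⟩
      rw [div_le_one (by positivity)]; linarith [(Nat.cast_nonneg N : (0 : ℝ) ≤ N)]
    exact (((hint _ hmem).sub (hint _ hν₀)).div_const _).aestronglyMeasurable
  · exact (hgrad.const_inner _).abs.add ((hint _ hν).sub (hint _ hν₀)).abs
  · intro N
    refine Eventually.of_forall fun o => ?_
    have hb := slope_bounds hV hν₀ hν (hg o) (fun y hy => hpos o y hy _)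
      (u := 1 / ((N : ℝ) + 1)) (by positivity)
      (by rw [div_le_one (by positivity)]; linarith [(Nat.cast_nonneg N : (0 : ℝ) ≤ N)])
    rw [hfd] at hb
    rw [Real.norm_eq_abs]
    refine abs_le.2 ⟨?_, ?_⟩
    · linarith [neg_abs_le (inner ℝ (ν - ν₀) (gradient (g o) ν₀)), abs_nonneg (g o ν - g o ν₀)]
    · linarith [abs_nonneg (inner ℝ (ν - ν₀) (gradient (g o) ν₀)), le_abs_self (g o ν - g o ν₀)]
  · refine Eventually.of_forall fun o => ?_
    have hd : HasDerivAt (fun u : ℝ => g o (ν₀ + u • (ν - ν₀)))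
        (fderiv ℝ (g o) (ν₀ + (0 : ℝ) • (ν - ν₀)) (ν - ν₀)) 0 :=
      hasDerivAt_line (hg o _ (by simpa using hν₀))
    have := (hasDerivAt_iff_tendsto_slope.1 hd).comp hu
    simp only [zero_smul, add_zero, hfd] at this
    refine this.congr fun N => ?_
    simp only [Function.comp_apply, slope_def_field, zero_smul, add_zero, sub_zero]

end Population

/-! ### Exponential inequalities for averages over a forest -/

section Concentration

variable {Ω Ξ : Type*} [MeasurableSpace Ω] [MeasurableSpace Ξ] {n s B : ℕ}

/-- The preimage of a product set is a product set with full factors at the unused indices.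
Injectivity keeps the selected coordinates independent; this serves for subsamples, for permutations
and for disjoint blocks of the data. -/
lemma measurePreserving_comp_embedding {ι J : Type*} [Fintype ι] [Fintype J] (P : Measure Ω)
    [IsProbabilityMeasure P] (e : J ↪ ι) :
    MeasurePreserving (fun (Z : ι → Ω) (j : J) => Z (e j)) (Measure.pi fun _ => P)
      (Measure.pi fun _ => P) := by
  classical
  have hm : Measurable fun (Z : ι → Ω) (j : J) => Z (e j) := by fun_prop
  refine ⟨hm, (Measure.pi_eq fun S hS => ?_).symm⟩
  rw [Measure.map_apply hm (MeasurableSet.univ_pi hS)]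
  have h : (fun (Z : ι → Ω) (j : J) => Z (e j)) ⁻¹' Set.univ.pi S =
      Set.univ.pi fun i => if h : ∃ j, e j = i then S h.choose else Set.univ := by
    ext Z
    simp only [Set.mem_preimage, Set.mem_univ_pi]
    constructor
    · intro h i
      split_ifs with hi
      · have := h hi.choose
        rwa [hi.choose_spec] at this
      · trivial
    · intro h j
      have h1 := h (e j)
      have hj : ∃ j', e j' = e j := ⟨j, rfl⟩
      rw [dif_pos hj] at h1
      rwa [e.injective hj.choose_spec] at h1
  rw [h, Measure.pi_pi, ← Finset.prod_subset (Finset.subset_univ (Finset.univ.map e))]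
  · rw [Finset.prod_map]
    refine Finset.prod_congr rfl fun j _ => ?_
    have hj : ∃ j', e j' = e j := ⟨j, rfl⟩
    rw [dif_pos hj, e.injective hj.choose_spec]
  · intro i _ hi
    have : ¬ ∃ j, e j = i := fun ⟨j, hj⟩ => hi (by simp [← hj])
    rw [dif_neg this, measure_univ]

/-- Hoeffding's lemma on `[-M, M]`, with the mean kept in the exponent so that bounds can be chained
through conditional expectations. -/
lemma integral_exp_le_of_abs_le {P : Measure Ω} [IsProbabilityMeasure P] {X : Ω → ℝ} {M : ℝ}
    (hX : Measurable X) (hM : ∀ ω, |X ω| ≤ M) (θ : ℝ) :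
    ∫ ω, Real.exp (θ * X ω) ∂P ≤ Real.exp (θ * ∫ ω, X ω ∂P + θ ^ 2 * M ^ 2 / 2) := by
  have h := (hasSubgaussianMGF_of_mem_Icc (μ := P) (a := -M) (b := M) hX.aemeasurable
    (Eventually.of_forall fun ω => abs_le.1 (hM ω))).mgf_le θ
  have hM0 : 0 ≤ M := by
    obtain ⟨ω⟩ := P.nonempty_of_neZero
    exact (abs_nonneg _).trans (hM ω)
  have h2 : (((‖M - -M‖₊ / 2) ^ 2 : NNReal) : ℝ) = M ^ 2 := by
    push_cast
    rw [Real.norm_of_nonneg (by linarith)]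
    ring
  rw [h2, mgf] at h
  have h3 : ∀ ω, Real.exp (θ * X ω) =
      Real.exp (θ * ∫ ω, X ω ∂P) * Real.exp (θ * (X ω - ∫ ω, X ω ∂P)) := fun ω => by
    rw [← Real.exp_add]; ring_nf
  simp_rw [h3]
  rw [integral_const_mul, Real.exp_add]
  refine mul_le_mul_of_nonneg_left (h.trans_eq ?_) (Real.exp_pos _).le
  ring_nf

lemma integrable_of_abs_le {P : Measure Ω} [IsFiniteMeasure P] {X : Ω → ℝ} {M : ℝ}
    (hX : Measurable X) (hM : ∀ ω, |X ω| ≤ M) : Integrable X P :=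
  Integrable.of_bound hX.aestronglyMeasurable M (Eventually.of_forall hM)

lemma abs_integral_le_of_abs_le {P : Measure Ω} [IsProbabilityMeasure P] {X : Ω → ℝ} {M : ℝ}
    (hM : ∀ ω, |X ω| ≤ M) : |∫ ω, X ω ∂P| ≤ M := by
  have := norm_integral_le_of_norm_le_const (μ := P) (f := X) (C := M) (Eventually.of_forall hM)
  simpa using this

lemma integrable_exp_mul_of_abs_le {P : Measure Ω} [IsFiniteMeasure P] {X : Ω → ℝ} {M : ℝ}
    (hX : Measurable X) (hM : ∀ ω, |X ω| ≤ M) (θ : ℝ) :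
    Integrable (fun ω => Real.exp (θ * X ω)) P := by
  refine integrable_of_abs_le (M := Real.exp (|θ| * M)) (by fun_prop) fun ω => ?_
  rw [abs_of_pos (Real.exp_pos _)]
  refine Real.exp_le_exp.2 ((le_abs_self _).trans ?_)
  rw [abs_mul]
  exact mul_le_mul_of_nonneg_left (hM ω) (abs_nonneg _)

/-- The average of i.i.d. bounded variables. -/
lemma integral_exp_average_le {P : Measure Ω} [IsProbabilityMeasure P] {X : Ω → ℝ} {M : ℝ}
    (hX : Measurable X) (hM : ∀ ω, |X ω| ≤ M) (θ : ℝ) (hB : 0 < B) :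
    ∫ w, Real.exp (θ * ((1 / (B : ℝ)) * ∑ b, X (w b))) ∂(Measure.pi fun _ : Fin B => P) ≤
      Real.exp (θ * ∫ ω, X ω ∂P + θ ^ 2 * M ^ 2 / 2 * (1 / B)) := by
  have h1 : ∀ w : Fin B → Ω, Real.exp (θ * ((1 / (B : ℝ)) * ∑ b, X (w b))) =
      ∏ b, Real.exp (θ / B * X (w b)) := fun w => by
    rw [← Real.exp_sum, ← Finset.mul_sum]; ring_nf
  simp_rw [h1]
  rw [integral_fintype_prod_eq_pow (fun ω => Real.exp (θ / B * X ω)), Fintype.card_fin]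
  have hB' : (B : ℝ) ≠ 0 := by positivity
  calc _ ≤ Real.exp (θ / B * ∫ ω, X ω ∂P + (θ / B) ^ 2 * M ^ 2 / 2) ^ B := by
        exact pow_le_pow_left₀ (integral_nonneg fun _ => (Real.exp_pos _).le)
          (integral_exp_le_of_abs_le hX hM _) _
    _ = _ := by
        rw [← Real.exp_nat_mul]
        congr 1
        field_simp

instance {n s : ℕ} : Finite (Subsample n s) := inferInstance

lemma card_blockIndex (s : ℕ) : Fintype.card (Fin (s / 2) ⊕ Fin (s - s / 2)) = s := by
  simp; omega

lemma nonempty_subsample (h : s ≤ n) : Nonempty (Subsample n s) :=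
  Function.Embedding.nonempty_of_card_le (by simpa only [card_blockIndex, Fintype.card_fin] using h)

lemma integral_uniformOn_univ {T : Type*} [Fintype T] [Nonempty T] [MeasurableSpace T]
    [MeasurableSingletonClass T] (g : T → ℝ) :
    ∫ e, g e ∂(uniformOn (Set.univ : Set T)) = (Fintype.card T : ℝ)⁻¹ * ∑ e, g e := by
  rw [uniformOn, ProbabilityTheory.cond, integral_smul_measure, Measure.restrict_univ, integral_count]
  rw [Measure.count_univ]
  simp [ENat.card_eq_coe_fintype_card]

/-- Averaging over all permutations of the data gives the average over all subsamples. -/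
lemma average_perm_eq {Ω J : Type*} [Fintype J] [Fintype (J ↪ Fin n)] (F : (J → Ω) → ℝ) (Z : Fin n → Ω) (e₀ : J ↪ Fin n) :
    (Fintype.card (Equiv.Perm (Fin n)) : ℝ)⁻¹ * ∑ σ : Equiv.Perm (Fin n), F (fun j => Z (σ (e₀ j)))
      = (Fintype.card (J ↪ Fin n) : ℝ)⁻¹ * ∑ e : J ↪ Fin n, F (fun j => Z (e j)) := by
  have h1 : ∀ e : J ↪ Fin n, ∑ σ : Equiv.Perm (Fin n), F (fun j => Z (σ (e j))) =
      ∑ σ : Equiv.Perm (Fin n), F (fun j => Z (σ (e₀ j))) := by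
    intro e
    -- A permutation carrying `e₀` to `e` reindexes one sum over permutations into the other, so the
    -- inner sum does not depend on the embedding.
    obtain ⟨τ, hτ⟩ := Equiv.Perm.exists_extending_pair e₀ e e₀.injective e.injective
    rw [← Equiv.sum_comp (Equiv.mulRight τ) fun σ => F (fun j => Z (σ (e₀ j)))]
    refine Finset.sum_congr rfl fun σ _ => ?_
    simp only [Equiv.coe_mulRight, Equiv.Perm.mul_apply, hτ]
  have h2 : ∀ σ : Equiv.Perm (Fin n), ∑ e : J ↪ Fin n, F (fun j => Z (σ (e j))) =
      ∑ e : J ↪ Fin n, F (fun j => Z (e j)) := by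
    intro σ
    rw [← Equiv.sum_comp (Equiv.embeddingCongr (Equiv.refl J) σ) fun e => F (fun j => Z (e j))]
    rfl
  have h3 := Finset.sum_comm (s := (Finset.univ : Finset (J ↪ Fin n)))
    (t := (Finset.univ : Finset (Equiv.Perm (Fin n)))) (f := fun e σ => F (fun j => Z (σ (e j))))
  simp only [h1, h2, Finset.sum_const, nsmul_eq_mul, Finset.card_univ] at h3
  have hp : (Fintype.card (Equiv.Perm (Fin n)) : ℝ) ≠ 0 := by
    exact_mod_cast Fintype.card_ne_zero
  have hne : Nonempty (J ↪ Fin n) := ⟨e₀⟩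
  have he : (Fintype.card (J ↪ Fin n) : ℝ) ≠ 0 := by exact_mod_cast Fintype.card_ne_zero
  field_simp
  linarith

set_option maxHeartbeats 1000000 in
/-- Hoeffding's bound for the moment generating function of a complete U-statistic. -/
lemma integral_exp_ustat_le {J : Type*} [Fintype J] {P : Measure Ω} [IsProbabilityMeasure P]
    {F : (J → Ω) → ℝ} {M : ℝ} (hF : Measurable F) (hM : ∀ z, |F z| ≤ M) (θ : ℝ) {K : ℕ}
    (hK : 0 < K) (E : Fin K × J ↪ Fin n) [Fintype (J ↪ Fin n)] :
    ∫ Z, Real.exp (θ * ((Fintype.card (J ↪ Fin n) : ℝ)⁻¹ * ∑ e : J ↪ Fin n, F (fun j => Z (e j))))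
        ∂(Measure.pi fun _ => P) ≤
      Real.exp (θ * ∫ z, F z ∂(Measure.pi fun _ => P) + θ ^ 2 * M ^ 2 / 2 * (1 / K)) := by
  classical
  set N := Fintype.card (Equiv.Perm (Fin n)) with hN
  have hNpos : (0 : ℝ) < N := by exact_mod_cast Fintype.card_pos
  have hKpos : (0 : ℝ) < K := by exact_mod_cast hK
  let e₀ (κ : Fin K) : J ↪ Fin n := ⟨fun j => E (κ, j), fun a b h => by simpa using E.injective h⟩
  -- Hoeffding's device: the average over `K` disjoint blocks, which are i.i.d. The U-statistic is
  -- the mean of `A` over all permutations of the data, so Jensen's inequality bounds its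
  -- exponential moment by that of `A`.
  let A (Z : Fin n → Ω) : ℝ := (1 / (K : ℝ)) * ∑ κ : Fin K, F (fun j => Z (E (κ, j)))
  have hAm : Measurable A := by fun_prop
  have hAM : ∀ Z, |A Z| ≤ M := by
    intro Z
    simp only [A]
    rw [abs_mul, abs_of_pos (by positivity), one_div, inv_mul_le_iff₀ hKpos]
    refine (Finset.abs_sum_le_sum_abs _ _).trans ((Finset.sum_le_sum fun κ _ => hM _).trans ?_)
    simp
  have hU : ∀ Z : Fin n → Ω,
      (Fintype.card (J ↪ Fin n) : ℝ)⁻¹ * ∑ e : J ↪ Fin n, F (fun j => Z (e j)) =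
      ∑ σ : Equiv.Perm (Fin n), (N : ℝ)⁻¹ * A (fun i => Z (σ i)) := by
    intro Z
    have h1 : ∀ κ, (N : ℝ)⁻¹ * ∑ σ : Equiv.Perm (Fin n), F (fun j => Z (σ (E (κ, j)))) =
        (Fintype.card (J ↪ Fin n) : ℝ)⁻¹ * ∑ e : J ↪ Fin n, F (fun j => Z (e j)) := by
      intro κ
      exact average_perm_eq F Z (e₀ κ)
    simp only [A]
    rw [← Finset.mul_sum, ← Finset.mul_sum, Finset.sum_comm, mul_left_comm]
    symm
    rw [Finset.mul_sum, Finset.sum_congr rfl fun κ _ => h1 κ, Finset.sum_const, Finset.card_univ, Fintype.card_fin,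
      nsmul_eq_mul, ← mul_assoc, one_div_mul_cancel hKpos.ne', one_mul]
  have hjensen : ∀ Z : Fin n → Ω,
      Real.exp (θ * ((Fintype.card (J ↪ Fin n) : ℝ)⁻¹ * ∑ e : J ↪ Fin n, F (fun j => Z (e j)))) ≤
      ∑ σ : Equiv.Perm (Fin n), (N : ℝ)⁻¹ * Real.exp (θ * A (fun i => Z (σ i))) := by
    intro Z
    rw [hU, Finset.mul_sum]
    have := convexOn_exp.map_sum_le (t := (Finset.univ : Finset (Equiv.Perm (Fin n))))
      (w := fun _ => (N : ℝ)⁻¹) (p := fun σ => θ * A (fun i => Z (σ i)))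
      (fun _ _ => by positivity) (by simp [hN]) (fun _ _ => Set.mem_univ _)
    simp only [smul_eq_mul] at this
    refine le_trans (le_of_eq ?_) this
    congr 1
    exact Finset.sum_congr rfl fun σ _ => by ring
  have hperm : ∀ σ : Equiv.Perm (Fin n), ∫ Z, Real.exp (θ * A (fun i => Z (σ i)))
      ∂(Measure.pi fun _ => P) = ∫ Z, Real.exp (θ * A Z) ∂(Measure.pi fun _ => P) := by
    intro σ
    have hmp := measurePreserving_comp_embedding P σ.toEmbedding
    have hm : Measurable fun Z => Real.exp (θ * A Z) := by fun_prop
    have := integral_map (μ := Measure.pi fun _ => P) hmp.measurable.aemeasurable (f := fun Z => Real.exp (θ * A Z))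
      hm.aestronglyMeasurable
    rw [hmp.map_eq] at this
    exact this.symm
  have hblock : ∫ Z, Real.exp (θ * A Z) ∂(Measure.pi fun _ : Fin n => P) =
      ∫ w, Real.exp (θ * ((1 / (K : ℝ)) * ∑ κ, F (w κ)))
        ∂(Measure.pi fun _ : Fin K => Measure.pi fun _ : J => P) := by
    have hmp := measurePreserving_comp_embedding P E
    have hc : Measure.map (MeasurableEquiv.curry (Fin K) J Ω) (Measure.pi fun _ => P) =
        Measure.pi fun _ : Fin K => Measure.pi fun _ : J => P := by
      have := Measure.infinitePi_map_curry (fun (_ : Fin K) (_ : J) => P)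
      simpa only [Measure.infinitePi_eq_pi] using this
    have hcomp := (MeasurePreserving.mk (MeasurableEquiv.curry (Fin K) J Ω).measurable hc).comp hmp
    have hm : Measurable fun w : Fin K → J → Ω =>
        Real.exp (θ * ((1 / (K : ℝ)) * ∑ κ, F (w κ))) := by fun_prop
    have := integral_map (μ := Measure.pi fun _ => P) hcomp.measurable.aemeasurable
      (f := fun w : Fin K → J → Ω => Real.exp (θ * ((1 / (K : ℝ)) * ∑ κ, F (w κ))))
      hm.aestronglyMeasurable
    rw [hcomp.map_eq] at this
    exact this.symm
  calc _ ≤ ∫ Z, ∑ σ : Equiv.Perm (Fin n), (N : ℝ)⁻¹ * Real.exp (θ * A (fun i => Z (σ i)))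
        ∂(Measure.pi fun _ => P) := by
        have hUm : Measurable fun Z : Fin n → Ω =>
            (Fintype.card (J ↪ Fin n) : ℝ)⁻¹ * ∑ e : J ↪ Fin n, F (fun j => Z (e j)) := by fun_prop
        refine integral_mono_of_nonneg (Eventually.of_forall fun _ => (Real.exp_pos _).le) ?_
          (Eventually.of_forall hjensen)
        refine integrable_finsetSum _ fun σ _ => Integrable.const_mul ?_ _
        exact integrable_exp_mul_of_abs_le (X := fun Z : Fin n → Ω => A fun i => Z (σ i))
            (M := M) (by fun_prop) (fun Z => hAM fun i => Z (σ i)) θ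
    _ = ∫ Z, Real.exp (θ * A Z) ∂(Measure.pi fun _ => P) := by
        rw [integral_finsetSum]
        · simp only [integral_const_mul, hperm, Finset.sum_const, Finset.card_univ, nsmul_eq_mul]
          rw [← hN]; field_simp
        · intro σ _
          refine Integrable.const_mul ?_ _
          exact integrable_exp_mul_of_abs_le (X := fun Z : Fin n → Ω => A fun i => Z (σ i))
            (M := M) (by fun_prop) (fun Z => hAM fun i => Z (σ i)) θ
    _ ≤ _ := by
        rw [hblock]
        exact integral_exp_average_le hF hM θ hK

lemma measurable_subsample_prod {X Y : Type*} [MeasurableSpace X] [MeasurableSpace Y]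
    {f : X × (Subsample n s × Ξ) → Y} (h : ∀ e, Measurable fun p : X × Ξ => f (p.1, e, p.2)) :
    Measurable f := by
  have h1 : Measurable fun q : Subsample n s × (X × Ξ) => f (q.2.1, q.1, q.2.2) :=
    measurable_from_prod_countable_right h
  exact h1.comp (by fun_prop : Measurable fun p : X × (Subsample n s × Ξ) => (p.2.1, (p.1, p.2.2)))

lemma measurable_tree_eval {φ : ((Fin (s / 2) ⊕ Fin (s - s / 2)) → Ω) × Ξ → ℝ}
    (hφ : Measurable φ) : Measurable fun p : (Fin n → Ω) × (Subsample n s × Ξ) =>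
      φ ((fun j => p.1 (p.2.1 j)), p.2.2) := by
  refine measurable_subsample_prod fun e => hφ.comp ?_
  show Measurable fun p : (Fin n → Ω) × Ξ => ((fun j => p.1 (e j)), p.2)
  fun_prop

lemma measurable_forest_average {φ : ((Fin (s / 2) ⊕ Fin (s - s / 2)) → Ω) × Ξ → ℝ}
    (hφ : Measurable φ) : Measurable fun w : (Fin n → Ω) × (Fin B → Subsample n s × Ξ) =>
      (1 / (B : ℝ)) * ∑ b, φ ((fun j => w.1 ((w.2 b).1 j)), (w.2 b).2) := by
  refine Measurable.const_mul (Finset.measurable_sum _ fun b _ => ?_) _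
  exact (measurable_tree_eval hφ).comp
    (by fun_prop : Measurable fun w : (Fin n → Ω) × (Fin B → Subsample n s × Ξ) => (w.1, w.2 b))

lemma abs_forest_average_le {Ω Ξ : Type*}
    {φ : ((Fin (s / 2) ⊕ Fin (s - s / 2)) → Ω) × Ξ → ℝ} {M : ℝ} (hM : ∀ z, |φ z| ≤ M) (hB : 0 < B)
    (w : (Fin n → Ω) × (Fin B → Subsample n s × Ξ)) :
    |(1 / (B : ℝ)) * ∑ b, φ ((fun j => w.1 ((w.2 b).1 j)), (w.2 b).2)| ≤ M := by
  have hB' : (0 : ℝ) < B := by exact_mod_cast hB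
  rw [abs_mul, abs_of_pos (by positivity), one_div, inv_mul_le_iff₀ hB']
  refine (Finset.abs_sum_le_sum_abs _ _).trans ((Finset.sum_le_sum fun κ _ => hM _).trans ?_)
  simp

/-- Moment generating function of the average of a bounded function over the trees of a forest. -/
lemma integral_exp_forest_average_le {P : Measure Ω} [IsProbabilityMeasure P] {Q : Measure Ξ}
    [IsProbabilityMeasure Q] {φ : ((Fin (s / 2) ⊕ Fin (s - s / 2)) → Ω) × Ξ → ℝ} {M : ℝ}
    (hφ : Measurable φ) (hM : ∀ z, |φ z| ≤ M) (θ : ℝ) (hB : 0 < B) (hs : 0 < s) (hsn : s ≤ n) :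
    ∫ w, Real.exp (θ * ((1 / (B : ℝ)) * ∑ b, φ ((fun j => w.1 ((w.2 b).1 j)), (w.2 b).2)))
        ∂((Measure.pi fun _ : Fin n => P).prod (Measure.pi fun _ : Fin B =>
          (uniformOn (Set.univ : Set (Subsample n s))).prod Q)) ≤
      Real.exp (θ * ∫ z, φ z ∂((Measure.pi fun _ => P).prod Q) +
        θ ^ 2 * M ^ 2 / 2 * (1 / B + 1 / ((n / s : ℕ) : ℝ))) := by
  classical
  have : Nonempty (Subsample n s) := nonempty_subsample hsn
  have : IsProbabilityMeasure (uniformOn (Set.univ : Set (Subsample n s))) :=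
    isProbabilityMeasure_uniformOn Set.finite_univ Set.univ_nonempty
  set τ := (uniformOn (Set.univ : Set (Subsample n s))).prod Q with hτ
  have hψ := measurable_tree_eval (n := n) hφ
  have havg := measurable_forest_average (n := n) (B := B) hφ
  have havgM := abs_forest_average_le (n := n) hM hB
  -- The seed is integrated out. Given the data, the expected contribution of a tree is then the
  -- complete U-statistic with kernel `F`, and the randomness of the forest and of the data add
  -- their variance proxies.
  let F (z : (Fin (s / 2) ⊕ Fin (s - s / 2)) → Ω) : ℝ := ∫ ξ, φ (z, ξ) ∂Q
  have hF : Measurable F := (hφ.stronglyMeasurable.integral_prod_right').measurable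
  have hFM : ∀ z, |F z| ≤ M := fun z => abs_integral_le_of_abs_le fun ξ => hM _
  have hmean : ∀ Z : Fin n → Ω, ∫ p : Subsample n s × Ξ, φ ((fun j => Z (p.1 j)), p.2) ∂τ =
      (Fintype.card (Subsample n s) : ℝ)⁻¹ * ∑ e : Subsample n s, F (fun j => Z (e j)) := by
    intro Z
    rw [hτ, integral_prod, integral_uniformOn_univ]
    refine integrable_of_abs_le ?_ fun p => hM _
    exact hψ.comp (by fun_prop : Measurable fun p : Subsample n s × Ξ => (Z, p))
  have hn : 0 < n / s := Nat.div_pos hsn hs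
  -- Integer division: `n / s` disjoint blocks of size `s` fit into the sample.
  have hE : Nonempty (Fin (n / s) × (Fin (s / 2) ⊕ Fin (s - s / 2)) ↪ Fin n) := by
    refine Function.Embedding.nonempty_of_card_le ?_
    rw [Fintype.card_prod, card_blockIndex, Fintype.card_fin, Fintype.card_fin]
    exact Nat.div_mul_le_self n s
  obtain ⟨E⟩ := hE
  rw [integral_prod _ (integrable_exp_mul_of_abs_le havg havgM θ)]
  calc _ ≤ ∫ Z, Real.exp (θ ^ 2 * M ^ 2 / 2 * (1 / B)) * Real.exp (θ *
        ((Fintype.card (Subsample n s) : ℝ)⁻¹ * ∑ e : Subsample n s, F (fun j => Z (e j))))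
        ∂(Measure.pi fun _ => P) := by
        refine integral_mono_of_nonneg
          (Eventually.of_forall fun _ => integral_nonneg fun _ => (Real.exp_pos _).le) ?_
          (Eventually.of_forall fun Z => ?_)
        · refine Integrable.const_mul (integrable_exp_mul_of_abs_le (M := M)
            (X := fun Z : Fin n → Ω => (Fintype.card (Subsample n s) : ℝ)⁻¹ *
              ∑ e : Subsample n s, F (fun j => Z (e j))) (by fun_prop) (fun Z => ?_) θ) _
          rw [← hmean]
          exact abs_integral_le_of_abs_le fun p => hM _
        · have h := integral_exp_average_le (B := B) (P := τ)
            (X := fun p : Subsample n s × Ξ => φ ((fun j => Z (p.1 j)), p.2))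
            (hψ.comp (by fun_prop : Measurable fun p : Subsample n s × Ξ => (Z, p)))
            (fun p => hM _) θ hB
          rw [hmean Z, add_comm, Real.exp_add] at h
          exact h
    _ ≤ _ := by
        rw [integral_const_mul]
        refine (mul_le_mul_of_nonneg_left (integral_exp_ustat_le hF hFM θ hn E)
          (Real.exp_pos _).le).trans_eq ?_
        rw [← Real.exp_add, integral_prod _ (integrable_of_abs_le hφ hM)]
        congr 1
        ring

/-- Tail bound for the average of a bounded function over the trees of a forest. -/
lemma forest_average_tail {P : Measure Ω} [IsProbabilityMeasure P] {Q : Measure Ξ}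
    [IsProbabilityMeasure Q] {φ : ((Fin (s / 2) ⊕ Fin (s - s / 2)) → Ω) × Ξ → ℝ} {M t v : ℝ}
    (hφ : Measurable φ) (hM : ∀ z, |φ z| ≤ M) (hM0 : 0 < M) (ht : 0 ≤ t) (hB : 0 < B) (hs : 0 < s)
    (hsn : s ≤ n) (hv : 1 / (B : ℝ) + 1 / ((n / s : ℕ) : ℝ) ≤ v) :
    ((Measure.pi fun _ : Fin n => P).prod (Measure.pi fun _ : Fin B =>
          (uniformOn (Set.univ : Set (Subsample n s))).prod Q))
      {w | ∫ z, φ z ∂((Measure.pi fun _ => P).prod Q) + t ≤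
        (1 / (B : ℝ)) * ∑ b, φ ((fun j => w.1 ((w.2 b).1 j)), (w.2 b).2)} ≤
      ENNReal.ofReal (Real.exp (-(t ^ 2 / (2 * M ^ 2 * v)))) := by
  classical
  have : Nonempty (Subsample n s) := nonempty_subsample hsn
  have : IsProbabilityMeasure (uniformOn (Set.univ : Set (Subsample n s))) :=
    isProbabilityMeasure_uniformOn Set.finite_univ Set.univ_nonempty
  have hB' : (0 : ℝ) < B := by exact_mod_cast hB
  have hv0 : 0 < v := lt_of_lt_of_le (by positivity) hv
  have havg := measurable_forest_average (n := n) (B := B) hφ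
  have havgM := abs_forest_average_le (n := n) hM hB
  -- The minimizer of `-θ t + θ² M² v / 2`.
  set θ := t / (M ^ 2 * v) with hθ
  have hθ0 : 0 ≤ θ := by positivity
  refine (ENNReal.le_ofReal_iff_toReal_le (measure_ne_top _ _) (Real.exp_pos _).le).2 ?_
  refine (measure_ge_le_exp_mul_mgf _ hθ0 (integrable_exp_mul_of_abs_le havg havgM θ)).trans ?_
  refine (mul_le_mul_of_nonneg_left
    (integral_exp_forest_average_le hφ hM θ hB hs hsn) (Real.exp_pos _).le).trans ?_
  rw [← Real.exp_add]
  refine Real.exp_le_exp.2 ?_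
  have h1 : θ ^ 2 * M ^ 2 / 2 * (1 / B + 1 / ((n / s : ℕ) : ℝ)) ≤ θ ^ 2 * M ^ 2 / 2 * v := by
    gcongr
  have h2 : θ ^ 2 * M ^ 2 / 2 * v = θ * t - t ^ 2 / (2 * M ^ 2 * v) := by
    rw [hθ]; field_simp; ring
  linarith

/-- A property that holds almost surely for the data of one block holds for every tree. -/
lemma ae_forest_of_ae_block {P : Measure Ω} [IsProbabilityMeasure P] {Q : Measure Ξ}
    [IsProbabilityMeasure Q] {p : ((Fin (s / 2) ⊕ Fin (s - s / 2)) → Ω) × Ξ → Prop}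
    (hp : ∀ᵐ z ∂((Measure.pi fun _ => P).prod Q), p z) (hsn : s ≤ n) :
    ∀ᵐ w ∂((Measure.pi fun _ : Fin n => P).prod (Measure.pi fun _ : Fin B =>
          (uniformOn (Set.univ : Set (Subsample n s))).prod Q)),
      ∀ b, p ((fun j => w.1 ((w.2 b).1 j)), (w.2 b).2) := by
  have : Nonempty (Subsample n s) := nonempty_subsample hsn
  have : IsProbabilityMeasure (uniformOn (Set.univ : Set (Subsample n s))) :=
    isProbabilityMeasure_uniformOn Set.finite_univ Set.univ_nonempty
  rw [ae_all_iff]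
  intro b
  -- The subsample is random, so the property is obtained simultaneously for all of the finitely
  -- many subsamples.
  have h : ∀ᵐ w ∂((Measure.pi fun _ : Fin n => P).prod (Measure.pi fun _ : Fin B =>
          (uniformOn (Set.univ : Set (Subsample n s))).prod Q)),
      ∀ e : Subsample n s, p ((fun j => w.1 (e j)), (w.2 b).2) := by
    rw [ae_all_iff]
    intro e
    have h1 := measurePreserving_comp_embedding P e
    have h2 : MeasurePreserving (fun w : Fin B → Subsample n s × Ξ => (w b).2)
        (Measure.pi fun _ : Fin B => (uniformOn (Set.univ : Set (Subsample n s))).prod Q) Q :=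
      measurePreserving_snd.comp (measurePreserving_eval _ b)
    exact (h1.prod h2).quasiMeasurePreserving.ae hp
  filter_upwards [h] with w hw using hw _

end Concentration

/-! ### Paths, leaves and measurability of random trees -/

section Trees

variable {d : ℕ}

/-- `p` is the address of a node on the path of `x`. -/
def OnPath (x : Feat d) : AxisTree d → List Bool → Prop
  | _, [] => True
  | .leaf, _ :: _ => False
  | .split j c l _, false :: p => x j ≤ c ∧ OnPath x l p
  | .split j c _ r, true :: p => c < x j ∧ OnPath x r p

/-- Whether an address lies on the path of `x` is decided by the splits at its proper ancestors
alone. Hence it is an event about the ancestors, the kind of event on which the random-split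
condition can be conditioned. -/
lemma onPath_iff (x : Feat d) (t : AxisTree d) (p : List Bool) :
    OnPath x t p ↔ ∀ i : Fin p.length, ∃ a : Fin d × ℝ,
      t.nodeAt (p.take i) = some a ∧ (p.get i = true ↔ a.2 < x a.1) := by
  induction p generalizing t with
  | nil => simp [OnPath]
  | cons b p ih =>
    cases t with
    | leaf =>
      simp only [OnPath, false_iff, not_forall]
      exact ⟨⟨0, by simp⟩, by simp [AxisTree.nodeAt]⟩
    | split j c l r =>
      refine Iff.trans ?_ (Fin.forall_fin_succ (n := p.length)).symm
      cases b with
      | false => simp [OnPath, ih, AxisTree.nodeAt]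
      | true => simp [OnPath, ih, AxisTree.nodeAt]

open Classical in
-- Being in the leaf of `x` means agreeing with `x` at every split on its path. As there are
-- countably many addresses, this form yields measurability.
lemma mem_leafCell_iff (x y : Feat d) (t : AxisTree d) :
    y ∈ t.leafCell x ↔ ∀ p, OnPath x t p → ∀ a, t.nodeAt p = some a →
      (x a.1 ≤ a.2 ↔ y a.1 ≤ a.2) := by
  induction t with
  | leaf => simp [AxisTree.leafCell, AxisTree.nodeAt]
  | split j c l r ihl ihr =>
    have hsplit : ∀ P : List Bool → Prop, (∀ p, P p) ↔
        P [] ∧ (∀ p, P (false :: p)) ∧ ∀ p, P (true :: p) := by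
      intro P
      refine ⟨fun h => ⟨h _, fun _ => h _, fun _ => h _⟩, fun ⟨h0, h1, h2⟩ p => ?_⟩
      rcases p with _ | ⟨b, p⟩
      · exact h0
      · cases b
        · exact h1 p
        · exact h2 p
    rw [hsplit]
    by_cases hx : x j ≤ c
    · simp [AxisTree.leafCell, AxisTree.nodeAt, OnPath, hx, ihl, not_lt.2 hx]
    · have hx' := not_le.1 hx
      simp [AxisTree.leafCell, AxisTree.nodeAt, OnPath, hx, ihr, hx']

/-- A random tree all of whose splits are measurable. -/
def MeasurableTree {α : Type*} [MeasurableSpace α] (g : α → AxisTree d) : Prop :=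
  ∀ (p : List Bool) (j : Fin d) (U : Set ℝ), MeasurableSet U →
    MeasurableSet {a | ∃ c ∈ U, (g a).nodeAt p = some (j, c)}

/-- The threshold of a split. -/
def threshold (o : Option (Fin d × ℝ)) : ℝ := (o.map Prod.snd).getD 0

variable {α : Type*} [MeasurableSpace α] {g : α → AxisTree d}

lemma MeasurableTree.comp (hg : MeasurableTree g) {β : Type*} [MeasurableSpace β] {u : β → α}
    (hu : Measurable u) : MeasurableTree (g ∘ u) :=
  fun p j U hU => hu (hg p j U hU)

lemma MeasurableTree.measurableSet_dir (hg : MeasurableTree g) (p : List Bool) (j : Fin d) :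
    MeasurableSet {a | ∃ c, (g a).nodeAt p = some (j, c)} := by
  simpa using hg p j Set.univ MeasurableSet.univ

lemma MeasurableTree.measurableSet_some (hg : MeasurableTree g) (p : List Bool) :
    MeasurableSet {a | ∃ j c, (g a).nodeAt p = some (j, c)} := by
  simp only [Set.ofPred_exists]
  exact MeasurableSet.iUnion fun j => by
    simpa only [Set.ofPred_exists] using hg.measurableSet_dir p j

lemma MeasurableTree.measurable_threshold (hg : MeasurableTree g) (p : List Bool) :
    Measurable fun a => threshold ((g a).nodeAt p) := by
  intro U hU
  have h : (fun a => threshold ((g a).nodeAt p)) ⁻¹' U =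
      (⋃ j, {a | ∃ c ∈ U, (g a).nodeAt p = some (j, c)}) ∪
        ({a | ∃ j c, (g a).nodeAt p = some (j, c)}ᶜ ∩ {_a | (0 : ℝ) ∈ U}) := by
    ext a
    rcases hn : (g a).nodeAt p with _ | ⟨j, c⟩
    · simp [threshold, hn]
    · simp [threshold, hn]
  rw [h]
  exact (MeasurableSet.iUnion fun j => hg p j U hU).union
    ((hg.measurableSet_some p).compl.inter (MeasurableSet.const _))

lemma MeasurableTree.measurableSet_onPath (hg : MeasurableTree g) (x : Feat d) (p : List Bool) :
    MeasurableSet {a | OnPath x (g a) p} := by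
  have h : {a | OnPath x (g a) p} = ⋂ i : Fin p.length, ⋃ j : Fin d,
      {a | ∃ c ∈ {c | p.get i = true ↔ c < x j}, (g a).nodeAt (p.take i) = some (j, c)} := by
    ext a
    simp only [Set.mem_ofPred_eq, Set.mem_iInter, Set.mem_iUnion, onPath_iff, Prod.exists]
    exact forall_congr' fun i => exists_congr fun j => exists_congr fun c => and_comm
  rw [h]
  refine MeasurableSet.iInter fun i => MeasurableSet.iUnion fun j => hg _ _ _ ?_
  cases p.get i
  · have : {c : ℝ | false = true ↔ c < x j} = Set.Ici (x j) := by ext; simp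
    rw [this]; exact measurableSet_Ici
  · have : {c : ℝ | true = true ↔ c < x j} = Set.Iio (x j) := by ext; simp
    rw [this]; exact measurableSet_Iio

lemma MeasurableTree.measurableSet_mem_leafCell (hg : MeasurableTree g) (x : Feat d)
    {Y : α → Feat d} (hY : Measurable Y) : MeasurableSet {a | Y a ∈ (g a).leafCell x} := by
  have h : {a | Y a ∈ (g a).leafCell x} = ⋂ p : List Bool, {a | OnPath x (g a) p}ᶜ ∪
      ⋂ j : Fin d, ({a | ∃ c, (g a).nodeAt p = some (j, c)}ᶜ ∪
        {a | x j ≤ threshold ((g a).nodeAt p) ↔ Y a j ≤ threshold ((g a).nodeAt p)}) := by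
    ext a
    simp only [Set.mem_ofPred_eq, Set.mem_iInter, mem_leafCell_iff, Set.mem_union, Set.mem_compl_iff]
    refine forall_congr' fun p => ?_
    rw [imp_iff_not_or]
    refine or_congr_right ?_
    rcases hn : (g a).nodeAt p with _ | ⟨j, c⟩
    · simp
    · simp only [Option.some.injEq, threshold, Option.map_some, Option.getD_some, Prod.mk.injEq,
        forall_eq', exists_eq_right']
      constructor
      · intro h j'
        by_cases hj : j = j'
        · subst hj; exact Or.inr h
        · exact Or.inl hj
      · intro h
        simpa using h j
  rw [h]
  refine MeasurableSet.iInter fun p => (hg.measurableSet_onPath x p).compl.union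
    (MeasurableSet.iInter fun j => (hg.measurableSet_dir p j).compl.union ?_)
  have hc : MeasurableSet {a | x j ≤ threshold ((g a).nodeAt p)} :=
    measurableSet_le measurable_const (hg.measurable_threshold p)
  have hYj : Measurable fun a => Y a j := by fun_prop
  have hc' : MeasurableSet {a | Y a j ≤ threshold ((g a).nodeAt p)} :=
    measurableSet_le hYj (hg.measurable_threshold p)
  have h2 : {a | x j ≤ threshold ((g a).nodeAt p) ↔ Y a j ≤ threshold ((g a).nodeAt p)} =
      ({a | x j ≤ threshold ((g a).nodeAt p)} ∩ {a | Y a j ≤ threshold ((g a).nodeAt p)}) ∪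
      ({a | x j ≤ threshold ((g a).nodeAt p)}ᶜ ∩ {a | Y a j ≤ threshold ((g a).nodeAt p)}ᶜ) := by
    ext a; simp only [Set.mem_ofPred_eq, Set.mem_union, Set.mem_inter_iff, Set.mem_compl_iff]; tauto
  rw [h2]
  exact (hc.inter hc').union (hc.compl.inter hc'.compl)

end Trees

/-! ### Resampling one observation -/

section Resampling

variable {X O ι : Type*} [MeasurableSpace X] [MeasurableSpace O] [Fintype ι] [DecidableEq ι]

/-- Resampling one coordinate preserves a product measure. -/
lemma measurePreserving_update {Ω : Type*} [MeasurableSpace Ω] (P : Measure Ω)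
    [IsProbabilityMeasure P] (i₀ : ι) :
    MeasurePreserving (fun p : (ι → Ω) × Ω => Function.update p.1 i₀ p.2)
      ((Measure.pi fun _ => P).prod P) (Measure.pi fun _ => P) := by
  have hm : Measurable fun p : (ι → Ω) × Ω => Function.update p.1 i₀ p.2 := by
    refine measurable_pi_lambda _ fun i => ?_
    by_cases hi : i = i₀
    · subst hi; simpa using measurable_snd
    · simp only [Function.update_of_ne hi]; fun_prop
  refine ⟨hm, (Measure.pi_eq fun S hS => ?_).symm⟩
  rw [Measure.map_apply hm (MeasurableSet.univ_pi hS)]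
  have h : (fun p : (ι → Ω) × Ω => Function.update p.1 i₀ p.2) ⁻¹' Set.univ.pi S =
      (Set.univ.pi (Function.update S i₀ Set.univ)) ×ˢ S i₀ := by
    ext ⟨z, y⟩
    simp only [Set.mem_preimage, Set.mem_univ_pi, Set.mem_prod]
    constructor
    · intro h
      refine ⟨fun i => ?_, by simpa using h i₀⟩
      by_cases hi : i = i₀
      · subst hi; simp
      · simpa [hi] using h i
    · rintro ⟨h1, h2⟩ i
      by_cases hi : i = i₀
      · subst hi; simpa using h2
      · simpa [hi] using h1 i
  rw [h, Measure.prod_prod, Measure.pi_pi, ← Finset.prod_erase_mul Finset.univ _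
    (Finset.mem_univ i₀), ← Finset.prod_erase_mul Finset.univ _ (Finset.mem_univ i₀)]
  simp only [Function.update_self, measure_univ, mul_one]
  congr 1
  refine Finset.prod_congr rfl fun i hi => ?_
  rw [Function.update_of_ne (Finset.ne_of_mem_erase hi)]

/-- Integrating out the second component of one observation. -/
lemma integral_pi_compProd_mul {μ : Measure X} [IsProbabilityMeasure μ] {κ : Kernel X O}
    [IsMarkovKernel κ] (i₀ : ι) {W : (ι → X × O) → ℝ} {h : X × O → ℝ} {M M' : ℝ}
    (hW : Measurable W) (hWM : ∀ z, |W z| ≤ M)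
    (hWi : ∀ z x o o', W (Function.update z i₀ (x, o)) = W (Function.update z i₀ (x, o')))
    (hh : Measurable h) (hhM : ∀ z, |h z| ≤ M') :
    ∫ z, W z * h (z i₀) ∂(Measure.pi fun _ => μ ⊗ₘ κ) =
      ∫ z, W z * (∫ o, h ((z i₀).1, o) ∂(κ (z i₀).1)) ∂(Measure.pi fun _ => μ ⊗ₘ κ) := by
  have hhbar : Measurable fun x => ∫ o, h (x, o) ∂(κ x) :=
    (hh.stronglyMeasurable.integral_kernel_prod_right').measurable
  have hhbarM : ∀ x, |∫ o, h (x, o) ∂(κ x)| ≤ M' := fun x => abs_integral_le_of_abs_le fun o => hhM _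
  have hmp := measurePreserving_update (μ ⊗ₘ κ) i₀
  -- Both sides of the claim have this form, with `F = h` and with `F` the conditional mean of `h`.
  -- Observation `i₀` is redrawn, its features first.
  have key : ∀ F : X × O → ℝ, Measurable F → (∀ z, |F z| ≤ M') →
      ∫ z, W z * F (z i₀) ∂(Measure.pi fun _ => μ ⊗ₘ κ) =
        ∫ z, ∫ x, ∫ o, W (Function.update z i₀ (x, o)) * F (x, o) ∂(κ x) ∂μ
          ∂(Measure.pi fun _ => μ ⊗ₘ κ) := by
    intro F hF hFM
    have hm : Measurable fun z : ι → X × O => W z * F (z i₀) := by fun_prop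
    have hb : ∀ z : ι → X × O, |W z * F (z i₀)| ≤ M * M' := fun z => by
      rw [abs_mul]
      exact mul_le_mul (hWM _) (hFM _) (abs_nonneg _) ((abs_nonneg _).trans (hWM z))
    have h1 := integral_map (μ := (Measure.pi fun _ => μ ⊗ₘ κ).prod (μ ⊗ₘ κ))
      hmp.measurable.aemeasurable (f := fun z : ι → X × O => W z * F (z i₀)) hm.aestronglyMeasurable
    rw [hmp.map_eq] at h1
    have hi : Integrable (fun p : (ι → X × O) × (X × O) => W (Function.update p.1 i₀ p.2) *
        F (Function.update p.1 i₀ p.2 i₀)) ((Measure.pi fun _ => μ ⊗ₘ κ).prod (μ ⊗ₘ κ)) :=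
      integrable_of_abs_le (hm.comp hmp.measurable) fun p => hb _
    rw [h1, integral_prod _ hi]
    congr 1
    ext z
    have hm2 : Measurable fun y : X × O => W (Function.update z i₀ y) * F y := by
      have := hm.comp (hmp.measurable.comp (measurable_prodMk_left (x := z)))
      simpa [Function.comp_def] using this
    simp only [Function.update_self]
    rw [Measure.integral_compProd (integrable_of_abs_le (M := M * M') hm2 fun y => ?_)]
    simpa using hb (Function.update z i₀ y)
  rw [key h hh hhM, key (fun z => ∫ o, h (z.1, o) ∂(κ z.1)) (hhbar.comp measurable_fst)
    fun z => hhbarM _]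
  congr 1
  ext z
  congr 1
  ext x
  -- `W` is constant in the outcome of observation `i₀`, so it can be frozen at any `o'` and taken
  -- out of the inner integral.
  obtain ⟨o'⟩ := (κ x).nonempty_of_neZero
  simp only [hWi z x _ o']
  rw [integral_const_mul, integral_const]
  simp

end Resampling

/-! ### Tree weights on one block, and honesty -/

section Weights

variable {d s n B : ℕ} {O Ξ : Type*} [MeasurableSpace O] [MeasurableSpace Ξ]

/-- The tree grown on one block of data. -/
def blockTree (T : TreeLearner d s O Ξ) (z : Fin (s / 2) ⊕ Fin (s - s / 2) → Obs d O) (ξ : Ξ) :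
    AxisTree d :=
  T.grow (fun a => z (Sum.inl a)) (fun a => (z (Sum.inr a)).1) ξ

open Classical in
/-- The points of the estimation half of a block that lie in the leaf of `x`. -/
noncomputable def blockLeaf (T : TreeLearner d s O Ξ) (x : Feat d)
    (p : (Fin (s / 2) ⊕ Fin (s - s / 2) → Obs d O) × Ξ) : Finset (Fin (s - s / 2)) :=
  Finset.univ.filter fun a => (p.1 (Sum.inr a)).1 ∈ (blockTree T p.1 p.2).leafCell x

open Classical in
/-- The weights of one tree on its estimation half. -/
noncomputable def blockWeight (T : TreeLearner d s O Ξ) (x : Feat d)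
    (p : (Fin (s / 2) ⊕ Fin (s - s / 2) → Obs d O) × Ξ) (a : Fin (s - s / 2)) : ℝ :=
  if a ∈ blockLeaf T x p then 1 / ((blockLeaf T x p).card : ℝ) else 0

/-- The weighted average of a function of the observations for one tree. -/
noncomputable def blockAvg (T : TreeLearner d s O Ξ) (x : Feat d) (h : Obs d O → ℝ)
    (p : (Fin (s / 2) ⊕ Fin (s - s / 2) → Obs d O) × Ξ) : ℝ :=
  ∑ a, blockWeight T x p a * h (p.1 (Sum.inr a))

variable (T : TreeLearner d s O Ξ) (x : Feat d)

lemma mem_blockLeaf (p : (Fin (s / 2) ⊕ Fin (s - s / 2) → Obs d O) × Ξ) (a : Fin (s - s / 2)) :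
    a ∈ blockLeaf T x p ↔ (p.1 (Sum.inr a)).1 ∈ (blockTree T p.1 p.2).leafCell x := by
  simp [blockLeaf]

lemma sum_treeWeight_mul (Z : Fin n → Obs d O) (e : Subsample n s) (ξ : Ξ) (h : Obs d O → ℝ) :
    ∑ i, treeWeight T Z e ξ x i * h (Z i) = blockAvg T x h ((fun j => Z (e j)), ξ) := by
  classical
  let e₂ : Fin (s - s / 2) ↪ Fin n := Function.Embedding.inr.trans e
  have hleaf : leafSample T Z e ξ x = (blockLeaf T x ((fun j => Z (e j)), ξ)).map e₂ := by
    ext i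
    simp only [leafSample, Finset.mem_filter, Finset.mem_univ, true_and, Finset.mem_map,
      mem_blockLeaf]
    constructor
    · rintro ⟨⟨a, rfl⟩, h⟩; exact ⟨a, h, rfl⟩
    · rintro ⟨a, h, rfl⟩; exact ⟨⟨a, rfl⟩, h⟩
  simp only [treeWeight, blockAvg, blockWeight, ite_mul, zero_mul, hleaf, Finset.card_map]
  rw [← Finset.sum_filter, ← Finset.sum_filter, Finset.filter_mem_eq_inter, Finset.univ_inter,
    Finset.filter_mem_eq_inter, Finset.univ_inter, Finset.sum_map]
  rfl

lemma sum_forestWeight_mul (Z : Fin n → Obs d O) (w : Fin B → Subsample n s × Ξ)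
    (h : Obs d O → ℝ) :
    ∑ i, forestWeight T Z w x i * h (Z i) =
      (1 / (B : ℝ)) * ∑ b, blockAvg T x h ((fun j => Z ((w b).1 j)), (w b).2) := by
  simp only [forestWeight, ← sum_treeWeight_mul]
  rw [Finset.sum_comm, Finset.mul_sum]
  refine Finset.sum_congr rfl fun i _ => ?_
  rw [mul_assoc, Finset.sum_mul]

lemma forestWeight_nonneg (Z : Fin n → Obs d O) (w : Fin B → Subsample n s × Ξ) (i : Fin n) :
    0 ≤ forestWeight T Z w x i := by
  unfold forestWeight treeWeight
  refine mul_nonneg (by positivity) (Finset.sum_nonneg fun b _ => ?_)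
  split_ifs <;> positivity

lemma blockWeight_nonneg (p : (Fin (s / 2) ⊕ Fin (s - s / 2) → Obs d O) × Ξ)
    (a : Fin (s - s / 2)) : 0 ≤ blockWeight T x p a := by
  unfold blockWeight
  split_ifs <;> positivity

lemma sum_blockWeight (p : (Fin (s / 2) ⊕ Fin (s - s / 2) → Obs d O) × Ξ)
    (h : (blockLeaf T x p).Nonempty) : ∑ a, blockWeight T x p a = 1 := by
  classical
  simp only [blockWeight]
  rw [← Finset.sum_filter, Finset.filter_mem_eq_inter, Finset.univ_inter, Finset.sum_const,
    nsmul_eq_mul, mul_one_div_cancel]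
  exact_mod_cast h.card_pos.ne'

lemma sum_blockWeight_le (p : (Fin (s / 2) ⊕ Fin (s - s / 2) → Obs d O) × Ξ) :
    ∑ a, blockWeight T x p a ≤ 1 := by
  rcases (blockLeaf T x p).eq_empty_or_nonempty with h | h
  · simp [blockWeight, h]
  · exact (sum_blockWeight T x p h).le

lemma blockAvg_le_of_forall {h : Obs d O → ℝ} {M : ℝ} (hM : 0 ≤ M)
    (p : (Fin (s / 2) ⊕ Fin (s - s / 2) → Obs d O) × Ξ)
    (hh : ∀ a ∈ blockLeaf T x p, h (p.1 (Sum.inr a)) ≤ M) : blockAvg T x h p ≤ M := by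
  calc blockAvg T x h p ≤ ∑ a, blockWeight T x p a * M := by
        refine Finset.sum_le_sum fun a _ => ?_
        by_cases ha : a ∈ blockLeaf T x p
        · exact mul_le_mul_of_nonneg_left (hh a ha) (blockWeight_nonneg T x p a)
        · simp [blockWeight, ha]
    _ ≤ M := by
        rw [← Finset.sum_mul]
        exact mul_le_of_le_one_left hM (sum_blockWeight_le T x p)

lemma abs_blockAvg_le {h : Obs d O → ℝ} {D : Obs d O → ℝ} (hh : ∀ z, |h z| ≤ D z)
    (p : (Fin (s / 2) ⊕ Fin (s - s / 2) → Obs d O) × Ξ) :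
    |blockAvg T x h p| ≤ blockAvg T x D p := by
  refine (Finset.abs_sum_le_sum_abs _ _).trans (Finset.sum_le_sum fun a _ => ?_)
  rw [abs_mul, abs_of_nonneg (blockWeight_nonneg T x p a)]
  exact mul_le_mul_of_nonneg_left (hh _) (blockWeight_nonneg T x p a)

lemma abs_blockAvg_le_const {h : Obs d O → ℝ} {M : ℝ} (hM : 0 ≤ M) (hh : ∀ z, |h z| ≤ M)
    (p : (Fin (s / 2) ⊕ Fin (s - s / 2) → Obs d O) × Ξ) : |blockAvg T x h p| ≤ M :=
  (abs_blockAvg_le T x (D := fun _ => M) hh p).trans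
    (blockAvg_le_of_forall T x hM p fun _ _ => le_rfl)

lemma measurableTree_blockTree : MeasurableTree
    fun p : (Fin (s / 2) ⊕ Fin (s - s / 2) → Obs d O) × Ξ => blockTree T p.1 p.2 := by
  have h : MeasurableTree fun a : (Fin (s / 2) → Obs d O) × (Fin (s - s / 2) → Feat d) × Ξ =>
    T.grow a.1 a.2.1 a.2.2 := T.measurable_grow
  exact h.comp (u := fun p : (Fin (s / 2) ⊕ Fin (s - s / 2) → Obs d O) × Ξ =>
    ((fun a => p.1 (Sum.inl a)), (fun a => (p.1 (Sum.inr a)).1), p.2)) (by fun_prop)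

lemma measurableSet_mem_blockLeaf (a : Fin (s - s / 2)) : MeasurableSet
    {p : (Fin (s / 2) ⊕ Fin (s - s / 2) → Obs d O) × Ξ | a ∈ blockLeaf T x p} := by
  have := (measurableTree_blockTree T).measurableSet_mem_leafCell x
    (Y := fun p => (p.1 (Sum.inr a)).1) (by fun_prop)
  simpa [blockLeaf] using this

lemma measurable_blockWeight (a : Fin (s - s / 2)) :
    Measurable fun p : (Fin (s / 2) ⊕ Fin (s - s / 2) → Obs d O) × Ξ => blockWeight T x p a := by
  classical
  have hcard : Measurable fun p : (Fin (s / 2) ⊕ Fin (s - s / 2) → Obs d O) × Ξ =>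
      ((blockLeaf T x p).card : ℝ) := by
    have : ∀ p : (Fin (s / 2) ⊕ Fin (s - s / 2) → Obs d O) × Ξ, ((blockLeaf T x p).card : ℝ) =
        ∑ b, if b ∈ blockLeaf T x p then (1 : ℝ) else 0 := fun p => by simp
    simp only [this]
    exact Finset.measurable_sum _ fun b _ =>
      Measurable.ite (measurableSet_mem_blockLeaf T x b) measurable_const measurable_const
  exact Measurable.ite (measurableSet_mem_blockLeaf T x a) (hcard.const_div _) measurable_const

lemma measurable_blockAvg {h : Obs d O → ℝ} (hh : Measurable h) :
    Measurable (blockAvg T x h) := by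
  unfold blockAvg
  refine Finset.measurable_sum _ fun a _ => (measurable_blockWeight T x a).mul ?_
  fun_prop

/-- Honesty: given the weights, the estimation half is distributed according to `κ`. -/
lemma integral_blockAvg {μ : Measure (Feat d)} [IsProbabilityMeasure μ] {κ : Kernel (Feat d) O}
    [IsMarkovKernel κ] {Q : Measure Ξ} [IsProbabilityMeasure Q] {h : Obs d O → ℝ} {M : ℝ}
    (hM : 0 ≤ M) (hh : Measurable h) (hhM : ∀ z, |h z| ≤ M) :
    ∫ p, blockAvg T x h p ∂((Measure.pi fun _ => μ ⊗ₘ κ).prod Q) =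
      ∫ p, blockAvg T x (fun z => ∫ o, h (z.1, o) ∂(κ z.1)) p
        ∂((Measure.pi fun _ => μ ⊗ₘ κ).prod Q) := by
  classical
  have hhbar : Measurable fun x => ∫ o, h (x, o) ∂(κ x) :=
    (hh.stronglyMeasurable.integral_kernel_prod_right').measurable
  have hhbarM : ∀ x, |∫ o, h (x, o) ∂(κ x)| ≤ M := fun x => abs_integral_le_of_abs_le fun o => hhM _
  have hw1 : ∀ p : (Fin (s / 2) ⊕ Fin (s - s / 2) → Obs d O) × Ξ, ∀ a,
      |blockWeight T x p a| ≤ 1 := fun p a => by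
    rw [abs_of_nonneg (blockWeight_nonneg T x p a)]
    exact (Finset.single_le_sum (fun b _ => blockWeight_nonneg T x p b)
      (Finset.mem_univ a)).trans (sum_blockWeight_le T x p)
  rw [integral_prod_symm _ (integrable_of_abs_le (measurable_blockAvg T x hh)
      (abs_blockAvg_le_const T x hM hhM)),
    integral_prod_symm (blockAvg T x fun z => ∫ o, h (z.1, o) ∂(κ z.1)) (integrable_of_abs_le
      (measurable_blockAvg T x (hhbar.comp measurable_fst))
      (abs_blockAvg_le_const T x hM fun z => hhbarM _))]
  congr 1
  ext ξ
  have hwm : ∀ a, Measurable fun z : Fin (s / 2) ⊕ Fin (s - s / 2) → Obs d O =>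
      blockWeight T x (z, ξ) a := fun a =>
    (measurable_blockWeight T x a).comp measurable_prodMk_right
  have hint : ∀ (F : Obs d O → ℝ), Measurable F → (∀ z, |F z| ≤ M) → ∀ a, Integrable
      (fun z : Fin (s / 2) ⊕ Fin (s - s / 2) → Obs d O =>
        blockWeight T x (z, ξ) a * F (z (Sum.inr a))) (Measure.pi fun _ => μ ⊗ₘ κ) := by
    intro F hF hFM a
    refine integrable_of_abs_le (M := 1 * M) ?_ fun z => ?_
    · exact (hwm a).mul (by fun_prop)
    · rw [abs_mul]
      exact mul_le_mul (hw1 _ _) (hFM _) (abs_nonneg _) zero_le_one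
  unfold blockAvg
  rw [integral_finsetSum _ fun a _ => hint h hh hhM a, integral_finsetSum _ fun a _ =>
    hint (fun z => ∫ o, h (z.1, o) ∂(κ z.1)) (hhbar.comp measurable_fst) (fun z => hhbarM _) a]
  refine Finset.sum_congr rfl fun a _ => ?_
  refine integral_pi_compProd_mul (Sum.inr a) (hwm a) (fun z => hw1 _ _) ?_ hh hhM
  intro z y o o'
  have hl : ∀ b, Function.update z (Sum.inr a) (y, o) (Sum.inl b) =
      Function.update z (Sum.inr a) (y, o') (Sum.inl b) := fun b => by simp
  have hr : ∀ b, (Function.update z (Sum.inr a) (y, o) (Sum.inr b)).1 =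
      (Function.update z (Sum.inr a) (y, o') (Sum.inr b)).1 := fun b => by
    by_cases hb : b = a
    · subst hb; simp
    · simp [hb]
  -- Honesty: changing the outcome of a point of the estimation half changes neither the tree nor
  -- the points in the leaf.
  have hleaf : blockLeaf T x (Function.update z (Sum.inr a) (y, o), ξ) =
      blockLeaf T x (Function.update z (Sum.inr a) (y, o'), ξ) := by
    ext b
    simp only [mem_blockLeaf, blockTree, hl, hr]
  simp only [blockWeight, hleaf]

/-- Honesty allows `h` to be replaced by its conditional mean, which `c * D` dominates. With `D` the
distance to `x` this is the bias bound for gradients; with `c = 0` it says that conditionally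
centered functions have mean zero. -/
lemma abs_integral_blockAvg_le {μ : Measure (Feat d)} [IsProbabilityMeasure μ]
    {κ : Kernel (Feat d) O} [IsMarkovKernel κ] {Q : Measure Ξ} [IsProbabilityMeasure Q]
    {h : Obs d O → ℝ} {D : Feat d → ℝ} {M M' c : ℝ} (hM : 0 ≤ M) (hh : Measurable h)
    (hhM : ∀ z, |h z| ≤ M) (hD : Measurable D) (hDM : ∀ y, |D y| ≤ M') (hM' : 0 ≤ M')
    (hhD : ∀ y, |∫ o, h (y, o) ∂(κ y)| ≤ c * D y) :
    |∫ p, blockAvg T x h p ∂((Measure.pi fun _ => μ ⊗ₘ κ).prod Q)| ≤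
      c * ∫ p, blockAvg T x (fun z => D z.1) p ∂((Measure.pi fun _ => μ ⊗ₘ κ).prod Q) := by
  rw [integral_blockAvg T x hM hh hhM, ← integral_const_mul]
  refine (abs_integral_le_integral_abs).trans (integral_mono_of_nonneg
    (Eventually.of_forall fun _ => abs_nonneg _) ?_ (Eventually.of_forall fun p => ?_))
  · exact (integrable_of_abs_le (measurable_blockAvg T x (hD.comp measurable_fst))
      (abs_blockAvg_le_const T x hM' fun z => hDM _)).const_mul _
  · refine (abs_blockAvg_le T x (D := fun z => c * D z.1) (fun z => hhD _) p).trans_eq ?_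
    simp only [blockAvg, Finset.mul_sum]
    exact Finset.sum_congr rfl fun a _ => by ring

end Weights

/-! ### Chernoff bounds for counts -/

section Counts

variable {Ω : Type*} [MeasurableSpace Ω] {k : ℕ}

open Classical in
lemma integral_exp_indicator_le {μ : Measure Ω} [IsProbabilityMeasure μ] {A : Set Ω}
    (hA : MeasurableSet A) (θ : ℝ) :
    ∫ ω, Real.exp (θ * if ω ∈ A then 1 else 0) ∂μ ≤
      Real.exp (μ.real A * (Real.exp θ - 1)) := by
  have h1 : ∀ ω, Real.exp (θ * if ω ∈ A then 1 else 0) =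
      1 + A.indicator (fun _ => Real.exp θ - 1) ω := by
    intro ω
    by_cases h : ω ∈ A <;> simp [h]
  simp_rw [h1]
  rw [integral_add (integrable_const _) ((integrable_const _).indicator hA),
    integral_indicator hA]
  simp only [integral_const, probReal_univ, smul_eq_mul, measureReal_restrict_apply_univ, mul_one]
  linarith [Real.add_one_le_exp (μ.real A * (Real.exp θ - 1))]

open Classical in
lemma measurable_count {A : Set Ω} (hA : MeasurableSet A) :
    Measurable fun X : Fin k → Ω => ∑ a, if X a ∈ A then (1 : ℝ) else 0 :=
  Finset.measurable_sum _ fun a _ =>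
    Measurable.ite (hA.preimage (measurable_pi_apply a)) measurable_const measurable_const

open Classical in
lemma integral_exp_count_le {μ : Measure Ω} [IsProbabilityMeasure μ] {A : Set Ω}
    (hA : MeasurableSet A) (θ : ℝ) :
    ∫ X : Fin k → Ω, Real.exp (θ * ∑ a, if X a ∈ A then 1 else 0) ∂(Measure.pi fun _ => μ) ≤
      Real.exp (k * (μ.real A * (Real.exp θ - 1))) := by
  simp_rw [Finset.mul_sum, Real.exp_sum]
  rw [integral_fintype_prod_eq_pow (fun ω => Real.exp (θ * if ω ∈ A then 1 else 0)),
    Fintype.card_fin, Real.exp_nat_mul]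
  exact pow_le_pow_left₀ (integral_nonneg fun _ => (Real.exp_pos _).le)
    (integral_exp_indicator_le hA θ) _

open Classical in
/-- Relative Chernoff bounds for the number of points in a set. -/
lemma count_tail {μ : Measure Ω} [IsProbabilityMeasure μ] {A : Set Ω}
    (hA : MeasurableSet A) {ε t : ℝ} (hε0 : 0 < ε) (hε1 : ε ≤ 1) :
    (Measure.pi fun _ : Fin k => μ) {X | ¬ ((1 - ε) * k * μ.real A - t ≤
        ∑ a, (if X a ∈ A then (1 : ℝ) else 0) ∧
      ∑ a, (if X a ∈ A then (1 : ℝ) else 0) ≤ (1 + ε) * k * μ.real A + t)} ≤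
      ENNReal.ofReal (2 * Real.exp (-(ε * t))) := by
  have hcm := measurable_count (k := k) hA
  have hcb : ∀ X : Fin k → Ω, |∑ a, if X a ∈ A then (1 : ℝ) else 0| ≤ k := by
    intro X
    refine (Finset.abs_sum_le_sum_abs _ _).trans
      ((Finset.sum_le_sum (g := fun _ => (1 : ℝ)) fun a _ => ?_).trans (by simp))
    split_ifs <;> simp
  have hp : 0 ≤ μ.real A := measureReal_nonneg
  have hkp : 0 ≤ k * μ.real A := by positivity
  -- Both tails at once: `θ = ε` for the upper and `θ = -ε` for the lower. The inequality used is
  -- `exp θ ≤ 1 + θ + θ²`, valid for `|θ| ≤ 1`.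
  have key : ∀ θ u : ℝ, |θ| = ε → θ * u = ε * ((θ + ε ^ 2) / ε * (k * μ.real A) + t) →
      Real.exp (-(θ * u)) * ∫ X : Fin k → Ω, Real.exp (θ * ∑ a, if X a ∈ A then 1 else 0)
        ∂(Measure.pi fun _ => μ) ≤ Real.exp (-(ε * t)) := by
    intro θ u hθ hu
    refine (mul_le_mul_of_nonneg_left (integral_exp_count_le hA θ) (Real.exp_pos _).le).trans ?_
    rw [← Real.exp_add]
    refine Real.exp_le_exp.2 ?_
    have h1 := (abs_le.1 (Real.abs_exp_sub_one_sub_id_le (hθ.trans_le hε1))).2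
    have h2 : θ ^ 2 = ε ^ 2 := by rw [← hθ, sq_abs]
    have h3 : k * (μ.real A * (Real.exp θ - 1)) ≤ k * μ.real A * (θ + ε ^ 2) := by
      rw [← mul_assoc]
      exact mul_le_mul_of_nonneg_left (by linarith) hkp
    have h4 : ε * ((θ + ε ^ 2) / ε * (k * μ.real A) + t) =
        (θ + ε ^ 2) * (k * μ.real A) + ε * t := by
      field_simp
    rw [h4] at hu
    linarith
  have hup : (Measure.pi fun _ : Fin k => μ) {X | (1 + ε) * k * μ.real A + t ≤
      ∑ a, if X a ∈ A then (1 : ℝ) else 0} ≤ ENNReal.ofReal (Real.exp (-(ε * t))) := by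
    refine (ENNReal.le_ofReal_iff_toReal_le (measure_ne_top _ _) (Real.exp_pos _).le).2 ?_
    refine (measure_ge_le_exp_mul_mgf _ hε0.le (integrable_exp_mul_of_abs_le hcm hcb ε)).trans ?_
    have := key ε ((1 + ε) * k * μ.real A + t) (abs_of_pos hε0) (by field_simp)
    rw [neg_mul]
    exact this
  have hlow : (Measure.pi fun _ : Fin k => μ) {X | ∑ a, (if X a ∈ A then (1 : ℝ) else 0) ≤
      (1 - ε) * k * μ.real A - t} ≤ ENNReal.ofReal (Real.exp (-(ε * t))) := by
    refine (ENNReal.le_ofReal_iff_toReal_le (measure_ne_top _ _) (Real.exp_pos _).le).2 ?_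
    refine (measure_le_le_exp_mul_mgf _ (neg_nonpos.2 hε0.le)
      (integrable_exp_mul_of_abs_le hcm hcb (-ε))).trans ?_
    have := key (-ε) ((1 - ε) * k * μ.real A - t) (by rw [abs_neg, abs_of_pos hε0])
      (by field_simp; ring)
    rw [neg_mul]
    exact this
  calc _ ≤ (Measure.pi fun _ : Fin k => μ) ({X | (1 + ε) * k * μ.real A + t ≤
      ∑ a, if X a ∈ A then (1 : ℝ) else 0} ∪ {X | ∑ a, (if X a ∈ A then (1 : ℝ) else 0) ≤
      (1 - ε) * k * μ.real A - t}) := by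
        refine measure_mono fun X hX => ?_
        simp only [Set.mem_ofPred_eq, not_and_or, not_le, Set.mem_union] at hX ⊢
        exact hX.symm.imp le_of_lt le_of_lt
    _ ≤ _ := (measure_union_le _ _).trans (add_le_add hup hlow)
    _ = _ := by
        rw [← ENNReal.ofReal_add (Real.exp_pos _).le (Real.exp_pos _).le]; ring_nf

open Classical in
lemma count_tail_family {μ : Measure Ω} [IsProbabilityMeasure μ] {𝒢 : Type*} [Fintype 𝒢]
    {A : 𝒢 → Set Ω} (hA : ∀ g, MeasurableSet (A g)) {ε t : ℝ} (hε0 : 0 < ε) (hε1 : ε ≤ 1) :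
    (Measure.pi fun _ : Fin k => μ) {X | ¬ ∀ g, (1 - ε) * k * μ.real (A g) - t ≤
        ∑ a, (if X a ∈ A g then (1 : ℝ) else 0) ∧
      ∑ a, (if X a ∈ A g then (1 : ℝ) else 0) ≤ (1 + ε) * k * μ.real (A g) + t} ≤
      ENNReal.ofReal (Fintype.card 𝒢 * (2 * Real.exp (-(ε * t)))) := by
  simp only [not_forall, Set.ofPred_exists]
  refine (measure_iUnion_fintype_le _ _).trans
    ((Finset.sum_le_sum fun g _ => count_tail (hA g) hε0 hε1).trans_eq ?_)
  rw [Finset.sum_const, Finset.card_univ, nsmul_eq_mul,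
    ENNReal.ofReal_mul (p := (Fintype.card 𝒢 : ℝ)) (by positivity), ENNReal.ofReal_natCast]

end Counts

/-! ### Uniform control of the counts over boxes -/

section Boxes

variable {d k : ℕ}

/-- A closed box. -/
def closedBox (lo hi : Fin d → ℝ) : Set (Feat d) := {y | ∀ j, y j ∈ Set.Icc (lo j) (hi j)}

/-- A half-open box. -/
def halfBox (lo hi : Fin d → ℝ) : Set (Feat d) := {y | ∀ j, y j ∈ Set.Ioc (lo j) (hi j)}

lemma closedBox_eq (lo hi : Fin d → ℝ) : closedBox lo hi =
    (MeasurableEquiv.toLp 2 (Fin d → ℝ)).symm ⁻¹' Set.univ.pi fun j => Set.Icc (lo j) (hi j) := by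
  ext y; simp [closedBox, Pi.le_def, forall_and]

lemma halfBox_eq (lo hi : Fin d → ℝ) : halfBox lo hi =
    (MeasurableEquiv.toLp 2 (Fin d → ℝ)).symm ⁻¹' Set.univ.pi fun j => Set.Ioc (lo j) (hi j) := by
  ext y; simp [halfBox]

lemma measurableSet_closedBox (lo hi : Fin d → ℝ) : MeasurableSet (closedBox lo hi) := by
  rw [closedBox_eq]
  exact (MeasurableEquiv.toLp 2 (Fin d → ℝ)).symm.measurable
    (MeasurableSet.univ_pi fun _ => measurableSet_Icc)

lemma measurableSet_halfBox (lo hi : Fin d → ℝ) : MeasurableSet (halfBox lo hi) := by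
  rw [halfBox_eq]
  exact (MeasurableEquiv.toLp 2 (Fin d → ℝ)).symm.measurable
    (MeasurableSet.univ_pi fun _ => measurableSet_Ioc)

lemma volume_closedBox (lo hi : Fin d → ℝ) :
    volume (closedBox lo hi) = ∏ j, ENNReal.ofReal (hi j - lo j) := by
  rw [closedBox_eq, (EuclideanSpace.volume_preserving_symm_measurableEquiv_toLp
    (Fin d)).measure_preimage_equiv, volume_pi, Measure.pi_pi]
  simp

lemma volume_halfBox (lo hi : Fin d → ℝ) :
    volume (halfBox lo hi) = ∏ j, ENNReal.ofReal (hi j - lo j) := by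
  rw [halfBox_eq, (EuclideanSpace.volume_preserving_symm_measurableEquiv_toLp
    (Fin d)).measure_preimage_equiv, volume_pi, Measure.pi_pi]
  simp

lemma measurableSet_cube (d : ℕ) : MeasurableSet (cube d) :=
  measurableSet_closedBox (fun _ => 0) (fun _ => 1)

/-- Change the factors one at a time; the remaining factors are at most one. -/
lemma prod_sub_prod_le {ι : Type*} (I : Finset ι) {a b : ι → ℝ} (ha : ∀ i ∈ I, 0 ≤ a i)
    (hab : ∀ i ∈ I, a i ≤ b i) (hb : ∀ i ∈ I, b i ≤ 1) :
    ∏ i ∈ I, b i - ∏ i ∈ I, a i ≤ ∑ i ∈ I, (b i - a i) := by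
  classical
  induction I using Finset.induction_on with
  | empty => simp
  | insert i I hi ih =>
    rw [Finset.prod_insert hi, Finset.prod_insert hi, Finset.sum_insert hi]
    have ih' := ih (fun j hj => ha j (Finset.mem_insert_of_mem hj))
      (fun j hj => hab j (Finset.mem_insert_of_mem hj))
      (fun j hj => hb j (Finset.mem_insert_of_mem hj))
    have h1 : ∏ j ∈ I, b j ≤ 1 := Finset.prod_le_one
      (fun j hj => (ha j (Finset.mem_insert_of_mem hj)).trans
        (hab j (Finset.mem_insert_of_mem hj))) fun j hj => hb j (Finset.mem_insert_of_mem hj)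
    have h2 : ∏ j ∈ I, a j ≤ ∏ j ∈ I, b j := Finset.prod_le_prod
      (fun j hj => ha j (Finset.mem_insert_of_mem hj))
      fun j hj => hab j (Finset.mem_insert_of_mem hj)
    have h3 : 0 ≤ ∏ j ∈ I, a j := Finset.prod_nonneg fun j hj => ha j (Finset.mem_insert_of_mem hj)
    have ha' := ha i (Finset.mem_insert_self i I)
    have hab' := hab i (Finset.mem_insert_self i I)
    have hb' := hb i (Finset.mem_insert_self i I)
    nlinarith

lemma featureLaw_le {f : Feat d → ℝ} {A : Set (Feat d)} (hA : MeasurableSet A)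
    {F : ℝ} (hF : ∀ y ∈ A, y ∈ cube d → f y ≤ F) :
    featureLaw f A ≤ ENNReal.ofReal F * volume A := by
  rw [featureLaw, withDensity_apply _ hA, Measure.restrict_restrict hA]
  calc _ ≤ ∫⁻ _ in A ∩ cube d, ENNReal.ofReal F := by
        refine setLIntegral_mono' (hA.inter (measurableSet_cube d)) fun y hy => ?_
        exact ENNReal.ofReal_le_ofReal (hF y hy.1 hy.2)
    _ ≤ _ := by
        rw [setLIntegral_const]
        gcongr
        exact Set.inter_subset_left

lemma le_featureLaw {f : Feat d → ℝ} {A : Set (Feat d)} (hA : MeasurableSet A)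
    (hAc : A ⊆ cube d) {F : ℝ} (hF : ∀ y ∈ A, F ≤ f y) :
    ENNReal.ofReal F * volume A ≤ featureLaw f A := by
  rw [featureLaw, withDensity_apply _ hA, Measure.restrict_restrict hA,
    Set.inter_eq_left.2 hAc, ← setLIntegral_const]
  exact setLIntegral_mono' hA fun y hy => ENNReal.ofReal_le_ofReal (hF y hy)

/-- The density bound `F` is known only on the inner box; the shell around it is charged at the
global bound `c₁`. -/
lemma featureLaw_real_le {f : Feat d → ℝ} {lo hi lo' hi' : Fin d → ℝ}
    {F c₁ : ℝ} (hlo : ∀ j, lo' j ≤ lo j) (hle : ∀ j, lo j ≤ hi j) (hhi : ∀ j, hi j ≤ hi' j)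
    (hF0 : 0 ≤ F) (hF : ∀ y ∈ closedBox lo hi, y ∈ cube d → f y ≤ F) (hc₁ : 0 ≤ c₁)
    (hf₁ : ∀ y ∈ cube d, f y ≤ c₁) [IsFiniteMeasure (featureLaw f)] :
    (featureLaw f).real (closedBox lo' hi') ≤ F * ∏ j, (hi j - lo j) +
      c₁ * (∏ j, (hi' j - lo' j) - ∏ j, (hi j - lo j)) := by
  have hsub : closedBox lo hi ⊆ closedBox lo' hi' := fun y hy j =>
    ⟨(hlo j).trans (hy j).1, (hy j).2.trans (hhi j)⟩
  have hv : volume (closedBox lo hi) = ENNReal.ofReal (∏ j, (hi j - lo j)) := by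
    rw [volume_closedBox, ENNReal.ofReal_prod_of_nonneg fun j _ => by linarith [hle j]]
  have hv' : volume (closedBox lo' hi') = ENNReal.ofReal (∏ j, (hi' j - lo' j)) := by
    rw [volume_closedBox, ENNReal.ofReal_prod_of_nonneg fun j _ => by
      linarith [hle j, hlo j, hhi j]]
  have hp0 : 0 ≤ ∏ j, (hi j - lo j) := Finset.prod_nonneg fun j _ => by linarith [hle j]
  have hpp : ∏ j, (hi j - lo j) ≤ ∏ j, (hi' j - lo' j) :=
    Finset.prod_le_prod (fun j _ => by linarith [hle j]) fun j _ => by linarith [hlo j, hhi j]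
  have h1 := measure_le_inter_add_sdiff (featureLaw f) (closedBox lo' hi') (closedBox lo hi)
  rw [Set.inter_eq_right.2 hsub] at h1
  have h2 := featureLaw_le (measurableSet_closedBox lo hi) hF
  have h3 := featureLaw_le ((measurableSet_closedBox lo' hi').diff (measurableSet_closedBox lo hi))
    (F := c₁) fun y _ hy => hf₁ y hy
  rw [measure_sdiff (μ := volume) hsub (measurableSet_closedBox lo hi).nullMeasurableSet (by rw [hv]; simp),
    hv, hv', ← ENNReal.ofReal_sub _ hp0, ← ENNReal.ofReal_mul hc₁] at h3
  rw [hv, ← ENNReal.ofReal_mul hF0] at h2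
  have h4 := h1.trans (add_le_add h2 h3)
  rw [← ENNReal.ofReal_add (by positivity) (mul_nonneg hc₁ (by linarith))] at h4
  exact ENNReal.toReal_le_of_le_ofReal
    (add_nonneg (by positivity) (mul_nonneg hc₁ (by linarith))) h4

lemma le_featureLaw_real {f : Feat d → ℝ} {lo hi lo' hi' : Fin d → ℝ} {F : ℝ}
    (h0 : ∀ j, 0 ≤ lo j) (h1 : ∀ j, hi j ≤ 1)
    (hlo : ∀ j, lo j ≤ lo' j) (hhi : ∀ j, hi' j ≤ hi j)
    (hF0 : 0 ≤ F) (hF : ∀ y ∈ closedBox lo hi, F ≤ f y) [IsFiniteMeasure (featureLaw f)] :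
    F * ∏ j, max (hi' j - lo' j) 0 ≤ (featureLaw f).real (halfBox lo' hi') := by
  have hsub : halfBox lo' hi' ⊆ closedBox lo hi := fun y hy j =>
    ⟨(hlo j).trans (hy j).1.le, (hy j).2.trans (hhi j)⟩
  have h2 := le_featureLaw (measurableSet_halfBox lo' hi')
    (fun y hy j => ⟨(h0 j).trans (hsub hy j).1, (hsub hy j).2.trans (h1 j)⟩)
    (fun y hy => hF y (hsub hy))
  have h3 : volume (halfBox lo' hi') = ENNReal.ofReal (∏ j, max (hi' j - lo' j) 0) := by
    rw [volume_halfBox, ENNReal.ofReal_prod_of_nonneg fun j _ => le_max_right _ _]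
    refine Finset.prod_congr rfl fun j _ => ?_
    rw [ENNReal.ofReal_max, ENNReal.ofReal_zero, max_eq_left zero_le]
  rw [h3, ← ENNReal.ofReal_mul hF0] at h2
  exact (ENNReal.ofReal_le_iff_le_toReal (measure_ne_top _ _)).1 h2

open Classical in
/-- The number of sample points in every box is close to its expectation. -/
def BoxRegular (c₁ : ℝ) (f : Feat d → ℝ) (ε t : ℝ) (X : Fin k → Feat d) : Prop :=
  ∀ (lo hi : Fin d → ℝ) (F : ℝ), (∀ j, 0 ≤ lo j) → (∀ j, lo j ≤ hi j) → (∀ j, hi j ≤ 1) →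
    0 ≤ F → F ≤ c₁ →
    ((∀ y ∈ closedBox lo hi, f y ≤ F) → ∑ a, (if X a ∈ closedBox lo hi then (1 : ℝ) else 0) ≤
        (1 + ε) * k * (F * ∏ j, (hi j - lo j)) + 2 * t) ∧
    ((∀ y ∈ closedBox lo hi, F ≤ f y) → (1 - ε) * k * (F * ∏ j, (hi j - lo j)) - 2 * t ≤
        ∑ a, if X a ∈ halfBox lo hi then (1 : ℝ) else 0)

open Classical in
-- A box is rounded outward for the upper bound and inward for the lower one, to corners in `(1/k)
-- ℤ`. Rounding moves each side by at most `2/k`, hence the expected count by at most `2 d c₁`;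
-- after the factor `1 ± ε` this is at most the second `t`. The inner box may be empty, whence the
-- truncated sides.
lemma boxRegular_of_grid {f : Feat d → ℝ} {c₁ ε t : ℝ} (hc₁ : 0 ≤ c₁)
    (hf₁ : ∀ y ∈ cube d, f y ≤ c₁) [IsFiniteMeasure (featureLaw f)] (hk : 0 < k)
    (hε0 : 0 < ε) (hε1 : ε ≤ 1) (ht : 4 * d * c₁ ≤ t) {X : Fin k → Feat d}
    (hX : ∀ (q : (Fin d → Fin (k + 1)) × (Fin d → Fin (k + 1))),
      ((∑ a, if X a ∈ closedBox (fun j => ((q.1 j : ℕ) : ℝ) / k) (fun j => ((q.2 j : ℕ) : ℝ) / k)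
        then (1 : ℝ) else 0) ≤ (1 + ε) * k * (featureLaw f).real
          (closedBox (fun j => ((q.1 j : ℕ) : ℝ) / k) (fun j => ((q.2 j : ℕ) : ℝ) / k)) + t) ∧
      (1 - ε) * k * (featureLaw f).real
          (halfBox (fun j => ((q.1 j : ℕ) : ℝ) / k) (fun j => ((q.2 j : ℕ) : ℝ) / k)) - t ≤
        ∑ a, if X a ∈ halfBox (fun j => ((q.1 j : ℕ) : ℝ) / k) (fun j => ((q.2 j : ℕ) : ℝ) / k)
        then (1 : ℝ) else 0) :
    BoxRegular c₁ f ε t X := by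
  intro lo hi F h0 hle h1 hF0 hF1
  have hk' : (0 : ℝ) < k := by exact_mod_cast hk
  have hfloor : ∀ u : ℝ, 0 ≤ u → u ≤ 1 → ∃ i : Fin (k + 1), ((i : ℕ) : ℝ) / k ≤ u ∧
      u - 1 / k ≤ ((i : ℕ) : ℝ) / k := by
    intro u hu0 hu1
    have hb : ⌊k * u⌋₊ ≤ k := by
      refine Nat.floor_le_of_le ?_
      nlinarith
    refine ⟨⟨⌊k * u⌋₊, Nat.lt_succ_of_le hb⟩, ?_, ?_⟩
    · have := Nat.floor_le (by positivity : 0 ≤ k * u)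
      rw [div_le_iff₀ hk']
      linarith
    · have := Nat.lt_floor_add_one (k * u)
      rw [le_div_iff₀ hk', sub_mul, one_div_mul_cancel hk'.ne']
      linarith
  have hceil : ∀ u : ℝ, 0 ≤ u → u ≤ 1 → ∃ i : Fin (k + 1), u ≤ ((i : ℕ) : ℝ) / k ∧
      ((i : ℕ) : ℝ) / k ≤ u + 1 / k ∧ ((i : ℕ) : ℝ) / k ≤ 1 := by
    intro u hu0 hu1
    have hb : ⌈k * u⌉₊ ≤ k := by
      refine Nat.ceil_le.2 ?_
      nlinarith
    refine ⟨⟨⌈k * u⌉₊, Nat.lt_succ_of_le hb⟩, ?_, ?_, ?_⟩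
    · have := Nat.le_ceil (k * u)
      rw [le_div_iff₀ hk']
      linarith
    · have := (Nat.ceil_lt_add_one (by positivity : 0 ≤ k * u)).le
      rw [div_le_iff₀ hk', add_mul, one_div_mul_cancel hk'.ne']
      linarith
    · rw [div_le_one hk']
      exact_mod_cast hb
  choose lf hlf1 hlf2 using fun j => hfloor (lo j) (h0 j) ((hle j).trans (h1 j))
  choose lc hlc1 hlc2 hlc3 using fun j => hceil (lo j) (h0 j) ((hle j).trans (h1 j))
  choose hf' hhf1 hhf2 using fun j => hfloor (hi j) ((h0 j).trans (hle j)) (h1 j)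
  choose hc hhc1 hhc2 hhc3 using fun j => hceil (hi j) ((h0 j).trans (hle j)) (h1 j)
  have hdk : k * (c₁ * (d * (2 / k))) = 2 * d * c₁ := by field_simp
  have hd0 : 0 ≤ d * c₁ := by positivity
  constructor
  · intro hF
    have h2 := (hX (lf, hc)).1
    have h3 := featureLaw_real_le (lo := lo) (hi := hi) hlf1 hle hhc1 hF0
      (fun y hy _ => hF y hy) hc₁ hf₁
    have h4 := prod_sub_prod_le Finset.univ (a := fun j => hi j - lo j)
      (b := fun j => ((hc j : ℕ) : ℝ) / k - ((lf j : ℕ) : ℝ) / k)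
      (fun j _ => by linarith [hle j]) (fun j _ => by linarith [hlf1 j, hhc1 j])
      (fun j _ => by linarith [hhc3 j, (by positivity : (0 : ℝ) ≤ ((lf j : ℕ) : ℝ) / k)])
    have h5 : ∑ j, (((hc j : ℕ) : ℝ) / k - ((lf j : ℕ) : ℝ) / k - (hi j - lo j)) ≤
        d * (2 / k) := by
      refine (Finset.sum_le_sum (g := fun _ => 2 / (k : ℝ)) fun j _ => ?_).trans (by simp)
      have : 2 / (k : ℝ) = 1 / k + 1 / k := by ring
      linarith [hlf2 j, hhc2 j]
    have h6 : (featureLaw f).real (closedBox (fun j => ((lf j : ℕ) : ℝ) / k)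
        (fun j => ((hc j : ℕ) : ℝ) / k)) ≤ F * ∏ j, (hi j - lo j) + c₁ * (d * (2 / k)) :=
      h3.trans (by gcongr; exact h4.trans h5)
    have h7 := mul_le_mul_of_nonneg_left h6 (by positivity : 0 ≤ (1 + ε) * k)
    have h8 : (1 + ε) * k * (F * ∏ j, (hi j - lo j) + c₁ * (d * (2 / k))) =
        (1 + ε) * k * (F * ∏ j, (hi j - lo j)) + (1 + ε) * (2 * d * c₁) := by
      rw [← hdk]; ring
    have h9 : (1 + ε) * (2 * d * c₁) ≤ t := by nlinarith
    have h10 : (∑ a, if X a ∈ closedBox lo hi then (1 : ℝ) else 0) ≤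
        ∑ a, if X a ∈ closedBox (fun j => ((lf j : ℕ) : ℝ) / k)
          (fun j => ((hc j : ℕ) : ℝ) / k) then (1 : ℝ) else 0 := by
      refine Finset.sum_le_sum fun a _ => ?_
      by_cases ha : X a ∈ closedBox lo hi
      · have : X a ∈ closedBox (fun j => ((lf j : ℕ) : ℝ) / k) (fun j => ((hc j : ℕ) : ℝ) / k) :=
          fun j => ⟨(hlf1 j).trans (ha j).1, (ha j).2.trans (hhc1 j)⟩
        rw [if_pos ha, if_pos this]
      · rw [if_neg ha]; split_ifs <;> norm_num
    linarith
  · intro hF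
    have h2 := (hX (lc, hf')).2
    have h3 := le_featureLaw_real (f := f) h0 h1 hlc1 hhf1 hF0 hF
    have h4 := prod_sub_prod_le Finset.univ (b := fun j => hi j - lo j)
      (a := fun j => max (((hf' j : ℕ) : ℝ) / k - ((lc j : ℕ) : ℝ) / k) 0)
      (fun j _ => le_max_right _ _)
      (fun j _ => max_le (by linarith [hlc1 j, hhf1 j]) (by linarith [hle j]))
      (fun j _ => by linarith [h0 j, h1 j])
    have h5 : ∑ j, (hi j - lo j - max (((hf' j : ℕ) : ℝ) / k - ((lc j : ℕ) : ℝ) / k) 0) ≤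
        d * (2 / k) := by
      refine (Finset.sum_le_sum (g := fun _ => 2 / (k : ℝ)) fun j _ => ?_).trans (by simp)
      have : 2 / (k : ℝ) = 1 / k + 1 / k := by ring
      linarith [hlc2 j, hhf2 j, le_max_left (((hf' j : ℕ) : ℝ) / k - ((lc j : ℕ) : ℝ) / k) 0]
    have hdk0 : 0 ≤ d * (2 / (k : ℝ)) := by positivity
    have h6 : F * ∏ j, (hi j - lo j) - c₁ * (d * (2 / k)) ≤ (featureLaw f).real (halfBox
        (fun j => ((lc j : ℕ) : ℝ) / k) (fun j => ((hf' j : ℕ) : ℝ) / k)) := by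
      refine le_trans ?_ h3
      have h7 := mul_le_mul_of_nonneg_left (h4.trans h5) hF0
      have h8 := mul_le_mul_of_nonneg_right hF1 hdk0
      linarith
    have h7 := mul_le_mul_of_nonneg_left h6 (mul_nonneg (by linarith) hk'.le : 0 ≤ (1 - ε) * k)
    have h8 : (1 - ε) * k * (F * ∏ j, (hi j - lo j) - c₁ * (d * (2 / k))) =
        (1 - ε) * k * (F * ∏ j, (hi j - lo j)) - (1 - ε) * (2 * d * c₁) := by
      rw [← hdk]; ring
    have h9 : (1 - ε) * (2 * d * c₁) ≤ t := by nlinarith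
    have h10 : (∑ a, if X a ∈ halfBox (fun j => ((lc j : ℕ) : ℝ) / k)
          (fun j => ((hf' j : ℕ) : ℝ) / k) then (1 : ℝ) else 0) ≤
        ∑ a, if X a ∈ halfBox lo hi then (1 : ℝ) else 0 := by
      refine Finset.sum_le_sum fun a _ => ?_
      by_cases ha : X a ∈ halfBox (fun j => ((lc j : ℕ) : ℝ) / k) (fun j => ((hf' j : ℕ) : ℝ) / k)
      · have : X a ∈ halfBox lo hi :=
          fun j => ⟨(hlc1 j).trans_lt (ha j).1, (ha j).2.trans (hhf1 j)⟩
        rw [if_pos ha, if_pos this]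
      · rw [if_neg ha]; split_ifs <;> norm_num
    linarith

/-- A union bound over `(k + 1)^(2d)` pairs of grid corners, two kinds of boxes and two tails, which
explains the factor 4. -/
lemma boxRegular_tail {f : Feat d → ℝ} {c₁ ε t : ℝ} (hc₁ : 0 ≤ c₁)
    (hf₁ : ∀ y ∈ cube d, f y ≤ c₁) [IsProbabilityMeasure (featureLaw f)] (hk : 0 < k)
    (hε0 : 0 < ε) (hε1 : ε ≤ 1) (ht : 4 * d * c₁ ≤ t) :
    (Measure.pi fun _ : Fin k => featureLaw f) {X | ¬ BoxRegular c₁ f ε t X} ≤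
      ENNReal.ofReal (4 * ((k : ℝ) + 1) ^ (2 * d) * Real.exp (-(ε * t))) := by
  classical
  let A : Bool × ((Fin d → Fin (k + 1)) × (Fin d → Fin (k + 1))) → Set (Feat d) := fun g =>
    if g.1 then closedBox (fun j => ((g.2.1 j : ℕ) : ℝ) / k) (fun j => ((g.2.2 j : ℕ) : ℝ) / k)
    else halfBox (fun j => ((g.2.1 j : ℕ) : ℝ) / k) (fun j => ((g.2.2 j : ℕ) : ℝ) / k)
  have hA : ∀ g, MeasurableSet (A g) := by
    rintro ⟨b, q⟩
    cases b
    · exact measurableSet_halfBox _ _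
    · exact measurableSet_closedBox _ _
  refine (measure_mono fun X hX => ?_).trans ((count_tail_family (t := t) hA hε0 hε1).trans_eq ?_)
  · intro hgood
    exact hX (boxRegular_of_grid hc₁ hf₁ hk hε0 hε1 ht fun q =>
      ⟨(hgood (true, q)).2, (hgood (false, q)).1⟩)
  · congr 1
    simp only [Fintype.card_prod, Fintype.card_bool, Fintype.card_fun, Fintype.card_fin]
    push_cast
    ring

end Boxes

/-! ### The nodes on the path of the target and their bounding boxes -/

section Nodes

variable {d : ℕ}

/-- The lower and upper corners of a box. -/
abbrev Corners (d : ℕ) : Type := (Fin d → ℝ) × (Fin d → ℝ)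

/-- The subtree at the child on the path of `x`. -/
noncomputable def childTree (x : Feat d) : AxisTree d → AxisTree d
  | .leaf => .leaf
  | .split j c l r => if x j ≤ c then l else r

/-- The part of a box on the side of `x` of a split. -/
noncomputable def stepBox (x : Feat d) (b : Corners d) (a : Fin d × ℝ) : Corners d :=
  if x a.1 ≤ a.2 then (b.1, Function.update b.2 a.1 (min (b.2 a.1) a.2))
  else (Function.update b.1 a.1 (max (b.1 a.1) a.2), b.2)

/-- One step along the path of `x`: the subtree and the bounding box of its cell. -/
noncomputable def nextState (x : Feat d) (S : AxisTree d × Corners d) : AxisTree d × Corners d :=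
  (childTree x S.1, (S.1.nodeAt []).elim S.2 (stepBox x S.2))

/-- The subtree and the bounding box of the cell of `x` at depth `m`. -/
noncomputable def pathState (x : Feat d) (t : AxisTree d) (m : ℕ) : AxisTree d × Corners d :=
  (nextState x)^[m] (t, fun _ => 0, fun _ => 1)

/-- The side lengths of a box. -/
def side (b : Corners d) (j : Fin d) : ℝ := b.2 j - b.1 j

/-- `A` is the set of the sample points that reach the node with subtree `S.1`, whose cell has the
bounding box `S.2`. -/
structure NodeInvariant {ι : Type*} (ρ : ℝ) (r : ℕ) (X : ι → Feat d) (x : Feat d) (t : AxisTree d)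
    (S : AxisTree d × Corners d) (A : Finset ι) : Prop where
  regular : S.1.IsRegular ρ r X A
  subset : ∀ i ∈ A, X i ∈ closedBox S.2.1 S.2.2
  superset : ∀ i, X i ∈ halfBox S.2.1 S.2.2 → i ∈ A
  mem : x ∈ closedBox S.2.1 S.2.2
  lower : ∀ j, 0 ≤ S.2.1 j
  upper : ∀ j, S.2.2 j ≤ 1
  leaf : ∀ i, X i ∈ t.leafCell x → i ∈ A ∧ X i ∈ S.1.leafCell x

variable {ι : Type*} {ρ : ℝ} {r : ℕ} {X : ι → Feat d} {x : Feat d} {t : AxisTree d}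
  {S : AxisTree d × Corners d} {A : Finset ι}

lemma NodeInvariant.side_nonneg (h : NodeInvariant ρ r X x t S A) (j : Fin d) :
    0 ≤ side S.2 j := by
  have := h.mem j
  simp only [side]; linarith [this.1, this.2]

lemma nodeInvariant_init [Fintype ι] (hX : ∀ i, X i ∈ cube d) (hx : x ∈ cube d)
    (ht : t.IsRegular ρ r X Finset.univ) :
    NodeInvariant ρ r X x t (t, fun _ => 0, fun _ => 1) Finset.univ where
  regular := ht
  subset i _ := hX i
  superset i _ := Finset.mem_univ i
  mem := hx
  lower _ := le_rfl
  upper _ := le_rfl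
  leaf i hi := ⟨Finset.mem_univ i, hi⟩

open Classical in
-- A left child keeps its threshold and a right child excludes it. The points of a node are thus
-- sandwiched between the half-open and the closed version of its box, and both inclusions survive a
-- split.
lemma NodeInvariant.next (h : NodeInvariant ρ r X x t S A) (hρ : ρ ≤ 1) :
    ∃ A', NodeInvariant ρ r X x t (nextState x S) A' ∧ ρ * A.card ≤ A'.card := by
  obtain ⟨T, b⟩ := S
  cases T with
  | leaf =>
    -- A leaf is a fixed point of `nextState`, so path states are defined at every depth and nothing
    -- is lost after a leaf.
    refine ⟨A, h, ?_⟩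
    have : (0 : ℝ) ≤ A.card := by positivity
    nlinarith
  | split j c tl tr =>
    obtain ⟨h1, h2, h3, h4⟩ := h.regular
    by_cases hx : x j ≤ c
    · have hS : nextState x (AxisTree.split j c tl tr, b) =
          (tl, b.1, Function.update b.2 j (min (b.2 j) c)) := by
        simp [nextState, childTree, AxisTree.nodeAt, stepBox, hx]
      rw [hS]
      refine ⟨_, ⟨h3, ?_, ?_, ?_, h.lower, ?_, ?_⟩, h1⟩
      · intro i hi j'
        rw [Finset.mem_filter] at hi
        have hb := h.subset i hi.1 j'
        by_cases hj : j' = j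
        · subst hj
          exact ⟨hb.1, by simpa using ⟨hb.2, hi.2⟩⟩
        · simpa [hj] using hb
      · intro i hi
        have hj := hi j
        simp only [Function.update_self, Set.mem_Ioc, le_min_iff] at hj
        refine Finset.mem_filter.2 ⟨h.superset i fun j' => ?_, hj.2.2⟩
        by_cases hjj : j' = j
        · subst hjj; exact ⟨hj.1, hj.2.1⟩
        · simpa [hjj] using hi j'
      · intro j'
        have hb := h.mem j'
        by_cases hj : j' = j
        · subst hj
          exact ⟨hb.1, by simpa using ⟨hb.2, hx⟩⟩
        · simpa [hj] using hb
      · intro j'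
        by_cases hj : j' = j
        · subst hj
          simpa using Or.inl (h.upper j')
        · simpa [hj] using h.upper j'
      · intro i hi
        obtain ⟨hA, hc⟩ := h.leaf i hi
        simp only [AxisTree.leafCell, hx, if_true] at hc
        exact ⟨Finset.mem_filter.2 ⟨hA, hc.1⟩, hc.2⟩
    · have hx' := not_le.1 hx
      have hS : nextState x (AxisTree.split j c tl tr, b) =
          (tr, Function.update b.1 j (max (b.1 j) c), b.2) := by
        simp [nextState, childTree, AxisTree.nodeAt, stepBox, hx]
      rw [hS]
      refine ⟨_, ⟨h4, ?_, ?_, ?_, ?_, h.upper, ?_⟩, h2⟩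
      · intro i hi j'
        rw [Finset.mem_filter] at hi
        have hb := h.subset i hi.1 j'
        by_cases hj : j' = j
        · subst hj
          exact ⟨by simpa using ⟨hb.1, hi.2.le⟩, hb.2⟩
        · simpa [hj] using hb
      · intro i hi
        have hj := hi j
        simp only [Function.update_self, Set.mem_Ioc, max_lt_iff] at hj
        refine Finset.mem_filter.2 ⟨h.superset i fun j' => ?_, hj.1.2⟩
        by_cases hjj : j' = j
        · subst hjj; exact ⟨hj.1.1, hj.2⟩
        · simpa [hjj] using hi j'
      · intro j'
        have hb := h.mem j'
        by_cases hj : j' = j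
        · subst hj
          exact ⟨by simpa using ⟨hb.1, hx'.le⟩, hb.2⟩
        · simpa [hj] using hb
      · intro j'
        by_cases hj : j' = j
        · subst hj
          simpa using Or.inl (h.lower j')
        · simpa [hj] using h.lower j'
      · intro i hi
        obtain ⟨hA, hc⟩ := h.leaf i hi
        simp only [AxisTree.leafCell, hx, if_false] at hc
        exact ⟨Finset.mem_filter.2 ⟨hA, hc.1⟩, hc.2⟩

lemma exists_nodeInvariant [Fintype ι] (hX : ∀ i, X i ∈ cube d) (hx : x ∈ cube d)
    (ht : t.IsRegular ρ r X Finset.univ) (hρ0 : 0 ≤ ρ) (hρ : ρ ≤ 1) (m : ℕ) :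
    ∃ A, NodeInvariant ρ r X x t (pathState x t m) A ∧ ρ ^ m * Fintype.card ι ≤ A.card := by
  induction m with
  | zero => exact ⟨Finset.univ, nodeInvariant_init hX hx ht, by simp [Finset.card_univ]⟩
  | succ m ih =>
    obtain ⟨A, hA, hc⟩ := ih
    obtain ⟨A', hA', hc'⟩ := hA.next hρ
    refine ⟨A', ?_, ?_⟩
    · rw [pathState, Function.iterate_succ_apply']; exact hA'
    · rw [pow_succ']
      have := mul_le_mul_of_nonneg_left hc hρ0
      linarith

lemma side_stepBox_of_ne {b : Corners d} {a : Fin d × ℝ} {j : Fin d} (hj : j ≠ a.1) :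
    side (stepBox x b a) j = side b j := by
  unfold stepBox side
  split_ifs <;> simp [hj]

lemma prod_sides_update_upper (lo hi : Fin d → ℝ) (j : Fin d) (c : ℝ) :
    ∏ i, (Function.update hi j c i - lo i) =
      (c - lo j) * ∏ i ∈ Finset.univ.erase j, (hi i - lo i) := by
  rw [← Finset.mul_prod_erase Finset.univ _ (Finset.mem_univ j), Function.update_self]
  congr 1
  exact Finset.prod_congr rfl fun i hi => by rw [Function.update_of_ne (Finset.ne_of_mem_erase hi)]

lemma prod_sides_update_lower (lo hi : Fin d → ℝ) (j : Fin d) (c : ℝ) :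
    ∏ i, (hi i - Function.update lo j c i) =
      (hi j - c) * ∏ i ∈ Finset.univ.erase j, (hi i - lo i) := by
  rw [← Finset.mul_prod_erase Finset.univ _ (Finset.mem_univ j), Function.update_self]
  congr 1
  exact Finset.prod_congr rfl fun i hi => by rw [Function.update_of_ne (Finset.ne_of_mem_erase hi)]

/-- The discarded box has at least `ρ * N` points, so its volume is bounded below by the upper
count; the volume of the whole box is bounded above by the lower count. The product `W` of the uncut
sides cancels, and `τ ≤ ε * ρ * N` absorbs both additive errors. -/
lemma removed_fraction {ε ρ N k W σ σ' F F' u τ : ℝ} (hε0 : 0 < ε) (hε1 : ε < 1) (hρ0 : 0 < ρ)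
    (hρ : ρ ≤ 1) (hN : 0 < N) (hk : 0 < k) (hW : 0 ≤ W) (hF : 0 < F') (hσ : 0 ≤ σ)
    (hτ : τ ≤ ε * ρ * N)
    (h1 : ρ * N ≤ (1 + ε) * k * (F' * (σ' * W)) + τ)
    (h2 : (1 - ε) * k * (F * (σ * W)) - τ ≤ N)
    (hu : u * ((1 + ε) ^ 2 * F') ≤ ρ * (1 - ε) ^ 2 * F) : u * σ ≤ σ' := by
  have h3 : ρ * (1 - ε) * N ≤ (1 + ε) * k * (F' * (σ' * W)) := by linarith
  have h3' : 0 < (1 + ε) * k * (F' * (σ' * W)) :=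
    lt_of_lt_of_le (by have : 0 < 1 - ε := by linarith
                       positivity) h3
  have hW' : 0 < W := by
    rcases hW.eq_or_lt with h | h
    · rw [← h] at h3'; simp at h3'
    · exact h
  have h4 : (1 - ε) * k * (F * (σ * W)) ≤ (1 + ε) * N := by nlinarith [mul_pos hε0 hN]
  have h5 : ρ * (1 - ε) * ((1 - ε) * k * (F * (σ * W))) ≤
      (1 + ε) * ((1 + ε) * k * (F' * (σ' * W))) := by
    have := mul_le_mul_of_nonneg_left h4 (mul_nonneg hρ0.le (by linarith : 0 ≤ 1 - ε))
    have h6 := mul_le_mul_of_nonneg_left h3 (by linarith : 0 ≤ 1 + ε)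
    linarith
  have hkW : 0 < k * W := mul_pos hk hW'
  have h6 : ρ * (1 - ε) ^ 2 * F * σ ≤ (1 + ε) ^ 2 * F' * σ' := by
    refine le_of_mul_le_mul_right ?_ hkW
    nlinarith
  have h7 := mul_le_mul_of_nonneg_right hu hσ
  have hpos : 0 < (1 + ε) ^ 2 * F' := by positivity
  refine le_of_mul_le_mul_left ?_ hpos
  linarith

open Classical in
/-- A split of a node with many points shortens the split side of the cell of `x`. -/
lemma NodeInvariant.side_next_le {k : ℕ} {X : Fin k → Feat d} {A : Finset (Fin k)}
    (h : NodeInvariant ρ r X x t S A) {c₁ ε τ : ℝ} {f : Feat d → ℝ}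
    (hbox : BoxRegular c₁ f ε τ X) (hε0 : 0 < ε) (hε1 : ε < 1) (hρ0 : 0 < ρ) (hρ : ρ ≤ 1)
    (hA : 0 < A.card) (hτ : 2 * τ ≤ ε * ρ * A.card) {a : Fin d × ℝ}
    (ha : S.1.nodeAt [] = some a) {F F' u : ℝ} (hF0 : 0 ≤ F) (hF1 : F ≤ c₁) (hF'0 : 0 < F')
    (hF'1 : F' ≤ c₁) (hF : ∀ y ∈ closedBox S.2.1 S.2.2, F ≤ f y)
    (hF' : ∀ y ∈ closedBox S.2.1 S.2.2, f y ≤ F')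
    (hu : u * ((1 + ε) ^ 2 * F') ≤ ρ * (1 - ε) ^ 2 * F) :
    side (stepBox x S.2 a) a.1 ≤ (1 - u) * side S.2 a.1 := by
  obtain ⟨T, lo, hi⟩ := S
  cases T with
  | leaf => simp [AxisTree.nodeAt] at ha
  | split j c tl tr =>
    simp only [AxisTree.nodeAt, Option.some.injEq] at ha
    subst ha
    simp only at hF hF' ⊢
    obtain ⟨h1, h2, h3, h4⟩ := h.regular
    have hsub := h.subset
    have hsup := h.superset
    have hmem := h.mem
    have hlow := h.lower
    have hupp := h.upper
    simp only at hsub hsup hmem hlow hupp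
    have hk : 0 < k := by
      rcases Nat.eq_zero_or_pos k with hk | hk
      · subst hk; obtain ⟨i, _⟩ := Finset.card_pos.1 hA; exact i.elim0
      · exact hk
    have hN : (0 : ℝ) < A.card := by exact_mod_cast hA
    have hle : ∀ i, lo i ≤ hi i := fun i => (hmem i).1.trans (hmem i).2
    have hcnt : ∀ (P : Fin k → Prop) (lo' hi' : Fin d → ℝ),
        (∀ i ∈ A, P i → X i ∈ closedBox lo' hi') → ((A.filter P).card : ℝ) ≤
        ∑ i, if X i ∈ closedBox lo' hi' then (1 : ℝ) else 0 := by
      intro P lo' hi' hP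
      rw [Finset.sum_boole]
      exact_mod_cast Finset.card_le_card fun i hi => by
        rw [Finset.mem_filter] at hi ⊢
        exact ⟨Finset.mem_univ _, hP i hi.1 hi.2⟩
    have hlower := ((hbox lo hi F hlow hle hupp hF0 hF1).2 hF).trans
      (show (∑ i, if X i ∈ halfBox lo hi then (1 : ℝ) else 0) ≤ A.card by
        rw [Finset.sum_boole]
        exact_mod_cast Finset.card_le_card fun i hi => hsup i (Finset.mem_filter.1 hi).2)
    rw [← Finset.mul_prod_erase Finset.univ _ (Finset.mem_univ j)] at hlower
    have hW : 0 ≤ ∏ i ∈ Finset.univ.erase j, (hi i - lo i) :=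
      Finset.prod_nonneg fun i _ => by linarith [hle i]
    have hσ : 0 ≤ hi j - lo j := by linarith [hle j]
    by_cases hx : x j ≤ c
    · have hpos : 0 < (A.filter fun i => c < X i j).card := by
        have : (0 : ℝ) < (A.filter fun i => c < X i j).card :=
          lt_of_lt_of_le (by positivity) h2
        exact_mod_cast this
      obtain ⟨i₀, hi₀⟩ := Finset.card_pos.1 hpos
      rw [Finset.mem_filter] at hi₀
      have hchi : c ≤ hi j := hi₀.2.le.trans (hsub i₀ hi₀.1 j).2
      have hclo : lo j ≤ c := (hmem j).1.trans hx
      have hsubset : closedBox (Function.update lo j c) hi ⊆ closedBox lo hi := by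
        intro y hy i
        have := hy i
        by_cases hij : i = j
        · subst hij
          rw [Function.update_self] at this
          exact ⟨hclo.trans this.1, this.2⟩
        · rwa [Function.update_of_ne hij] at this
      have hb := (hbox (Function.update lo j c) hi F' (fun i => by
          by_cases hij : i = j
          · subst hij; simpa using (hlow i).trans hclo
          · simpa [hij] using hlow i) (fun i => by
          by_cases hij : i = j
          · subst hij; simpa using hchi
          · simpa [hij] using hle i) hupp hF'0.le hF'1).1 fun y hy => hF' y (hsubset hy)
      have hc := hcnt (fun i => c < X i j) (Function.update lo j c) hi fun i hi hP i' => by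
        by_cases hij : i' = j
        · subst hij; simpa using ⟨hP.le, (hsub i hi i').2⟩
        · simpa [hij] using hsub i hi i'
      rw [prod_sides_update_lower] at hb
      have := removed_fraction hε0 hε1 hρ0 hρ hN (Nat.cast_pos.2 hk) hW hF'0 hσ hτ
        (h2.trans (hc.trans hb)) hlower hu
      simp only [side, stepBox, hx, if_true, Function.update_self, min_eq_right hchi]
      linarith
    · have hx' := not_le.1 hx
      have hpos : 0 < (A.filter fun i => X i j ≤ c).card := by
        have : (0 : ℝ) < (A.filter fun i => X i j ≤ c).card :=
          lt_of_lt_of_le (by positivity) h1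
        exact_mod_cast this
      obtain ⟨i₀, hi₀⟩ := Finset.card_pos.1 hpos
      rw [Finset.mem_filter] at hi₀
      have hclo : lo j ≤ c := (hsub i₀ hi₀.1 j).1.trans hi₀.2
      have hchi : c ≤ hi j := hx'.le.trans (hmem j).2
      have hsubset : closedBox lo (Function.update hi j c) ⊆ closedBox lo hi := by
        intro y hy i
        have := hy i
        by_cases hij : i = j
        · subst hij
          rw [Function.update_self] at this
          exact ⟨this.1, this.2.trans hchi⟩
        · rwa [Function.update_of_ne hij] at this
      have hb := (hbox lo (Function.update hi j c) F' hlow (fun i => by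
          by_cases hij : i = j
          · subst hij; simpa using hclo
          · simpa [hij] using hle i) (fun i => by
          by_cases hij : i = j
          · subst hij; simpa using hchi.trans (hupp i)
          · simpa [hij] using hupp i) hF'0.le hF'1).1 fun y hy => hF' y (hsubset hy)
      have hc := hcnt (fun i => X i j ≤ c) lo (Function.update hi j c) fun i hi hP i' => by
        by_cases hij : i' = j
        · subst hij; simpa using ⟨(hsub i hi i').1, hP⟩
        · simpa [hij] using hsub i hi i'
      rw [prod_sides_update_upper] at hb
      have := removed_fraction hε0 hε1 hρ0 hρ hN (Nat.cast_pos.2 hk) hW hF'0 hσ hτ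
        (h1.trans (hc.trans hb)) hlower hu
      simp only [side, stepBox, hx, if_false, Function.update_self, max_eq_right hclo]
      linarith

end Nodes

open scoped ENNReal

/-! ### Conditioning on the splits at the ancestors -/

section Paths

variable {d : ℕ}

/-- The bounding box of a cell of `x` from the splits at the ancestors of its node. -/
noncomputable def boxOfSplits (x : Feat d) (b : Corners d) {k : ℕ} (h : Fin k → Fin d × ℝ) :
    Corners d :=
  (List.ofFn h).foldl (stepBox x) b

lemma measurable_stepBox (x : Feat d) :
    Measurable fun q : Corners d × (Fin d × ℝ) => stepBox x q.1 q.2 := by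
  have h : ∀ j : Fin d, Measurable fun q : Corners d × ℝ => stepBox x q.1 (j, q.2) := by
    intro j
    have hup : ∀ {α : Type} [MeasurableSpace α] (F : α → Fin d → ℝ) (G : α → ℝ), Measurable F →
        Measurable G → Measurable fun a => Function.update (F a) j (G a) := by
      intro α _ F G hF hG
      refine measurable_pi_lambda _ fun i => ?_
      by_cases hi : i = j
      · subst hi; simpa using hG
      · simp only [Function.update_of_ne hi]; fun_prop
    have hset : MeasurableSet {q : Corners d × ℝ | x j ≤ q.2} :=
      measurableSet_le measurable_const measurable_snd
    have h1 : Measurable fun q : Corners d × ℝ => min (q.1.2 j) q.2 := by fun_prop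
    have h2 : Measurable fun q : Corners d × ℝ => max (q.1.1 j) q.2 := by fun_prop
    refine Measurable.ite hset ?_ ?_
    · exact Measurable.prodMk (by fun_prop) (hup _ _ (by fun_prop) h1)
    · exact Measurable.prodMk (hup _ _ (by fun_prop) h2) (by fun_prop)
  have h2 : Measurable fun q : Fin d × (Corners d × ℝ) => stepBox x q.2.1 (q.1, q.2.2) :=
    measurable_from_prod_countable_right h
  exact h2.comp (by fun_prop : Measurable fun q : Corners d × (Fin d × ℝ) =>
    (q.2.1, (q.1, q.2.2)))

lemma measurable_boxOfSplits (x : Feat d) (b : Corners d) (k : ℕ) :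
    Measurable fun h : Fin k → Fin d × ℝ => boxOfSplits x b h := by
  induction k with
  | zero => simp [boxOfSplits]
  | succ k ih =>
    have h1 : (fun h : Fin (k + 1) → Fin d × ℝ => boxOfSplits x b h) = fun h =>
        stepBox x (boxOfSplits x b fun i : Fin k => h i.castSucc) (h (Fin.last k)) := by
      ext1 h
      simp only [boxOfSplits]
      rw [List.ofFn_succ_last, List.foldl_append]
      rfl
    rw [h1]
    exact (measurable_stepBox x).comp
      (Measurable.prodMk (ih.comp (by fun_prop)) (by fun_prop))

/-- On the path of `x` the bounding box is a function of the ancestors' splits. Any quantity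
computed from the box is therefore known before the next split is drawn. -/
lemma iterate_nextState (x : Feat d) (t : AxisTree d) (b : Corners d) (p : List Bool)
    (h : Fin p.length → Fin d × ℝ) (hx : ∀ i, p.get i = true ↔ (h i).2 < x (h i).1)
    (hs : t.AncestorSplits p h) :
    ((nextState x)^[p.length] (t, b)).2 = boxOfSplits x b h ∧
      ((nextState x)^[p.length] (t, b)).1.nodeAt [] = t.nodeAt p := by
  induction p generalizing t b with
  | nil => simp [boxOfSplits]
  | cons c p ih =>
    have h0 := hs ⟨0, by simp⟩
    simp only [List.take_zero] at h0
    cases t with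
    | leaf => simp [AxisTree.nodeAt] at h0
    | split j u l r =>
      simp only [AxisTree.nodeAt, Option.some.injEq] at h0
      have hx0 := hx ⟨0, by simp⟩
      rw [← h0] at hx0
      simp only [List.get_eq_getElem, List.getElem_cons_zero] at hx0
      have hbox : boxOfSplits x b h =
          boxOfSplits x (stepBox x b (j, u)) (fun i : Fin p.length => h i.succ) := by
        simp only [boxOfSplits]
        rw [show List.ofFn h = h ⟨0, by simp⟩ :: List.ofFn fun i : Fin p.length => h i.succ from
          List.ofFn_succ, List.foldl_cons, ← h0]
      have hnode : ∀ q, (childTree x (AxisTree.split j u l r)).nodeAt q =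
          (AxisTree.split j u l r).nodeAt (c :: q) := by
        intro q
        cases c with
        | false =>
          have : x j ≤ u := by simpa using hx0
          simp [childTree, AxisTree.nodeAt, this]
        | true =>
          have : ¬ x j ≤ u := by simpa using hx0
          simp [childTree, AxisTree.nodeAt, this]
      have := ih (childTree x (AxisTree.split j u l r)) (stepBox x b (j, u))
        (fun i => h i.succ) (fun i => by simpa using hx i.succ) (fun i => by
          have := hs i.succ
          rw [hnode]; simpa using this)
      rw [hbox, ← hnode]
      exact this

lemma exists_onPath (x : Feat d) (t : AxisTree d) (b : Corners d) (m : ℕ)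
    (h : ∀ i ≤ m, ∃ a, ((nextState x)^[i] (t, b)).1.nodeAt [] = some a) :
    ∃ p : List Bool, p.length = m ∧ OnPath x t p ∧ ∃ a, t.nodeAt p = some a := by
  induction m generalizing t b with
  | zero => exact ⟨[], rfl, by simp [OnPath], h 0 le_rfl⟩
  | succ m ih =>
    obtain ⟨a, ha⟩ := h 0 (Nat.zero_le _)
    cases t with
    | leaf => simp [AxisTree.nodeAt] at ha
    | split j c l r =>
      obtain ⟨p, hp, hon, hn⟩ := ih (childTree x (.split j c l r)) (stepBox x b (j, c))
        fun i hi => h (i + 1) (by omega)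
      by_cases hx : x j ≤ c
      · simp only [childTree, hx, if_true] at hon hn
        exact ⟨false :: p, by simp [hp], ⟨hx, hon⟩, hn⟩
      · simp only [childTree, hx, if_false] at hon hn
        exact ⟨true :: p, by simp [hp], ⟨not_le.1 hx, hon⟩, hn⟩

lemma OnPath.unique {x : Feat d} {t : AxisTree d} {p p' : List Bool} (h : OnPath x t p)
    (h' : OnPath x t p') (hl : p.length = p'.length) : p = p' := by
  induction p generalizing t p' with
  | nil => exact (List.length_eq_zero_iff.1 hl.symm).symm
  | cons b p ih =>
    cases p' with
    | nil => simp at hl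
    | cons b' p' =>
      have hl' : p.length = p'.length := by simpa using hl
      cases t with
      | leaf => simp [OnPath] at h
      | split j c l r =>
        cases b <;> cases b' <;> simp only [OnPath] at h h'
        · rw [ih h.2 h'.2 hl']
        · exact absurd h.1 (not_le.2 h'.1)
        · exact absurd h'.1 (not_le.2 h.1)
        · rw [ih h.2 h'.2 hl']

variable {Ξ : Type*} [MeasurableSpace Ξ] {Q : Measure Ξ} {g : Ξ → AxisTree d}

/-- Every split is along every coordinate with conditional probability at least `c`, given the
splits at the ancestors. -/
def RandomSplits (Q : Measure Ξ) (g : Ξ → AxisTree d) (c : ℝ≥0∞) : Prop :=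
  ∀ (p : List Bool) (j : Fin d) (A : Set (Fin p.length → Fin d × ℝ)), MeasurableSet A →
    c * Q {ξ | (∃ h ∈ A, (g ξ).AncestorSplits p h) ∧
        ∃ (j' : Fin d) (c : ℝ), (g ξ).nodeAt p = some (j', c)} ≤
      Q {ξ | (∃ h ∈ A, (g ξ).AncestorSplits p h) ∧ ∃ c : ℝ, (g ξ).nodeAt p = some (j, c)}

/-- The splits at the ancestors of `p`, with a default value where there is no such node. -/
def ancestors (t : AxisTree d) (a₀ : Fin d × ℝ) (p : List Bool) (i : Fin p.length) : Fin d × ℝ :=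
  (t.nodeAt (p.take i)).getD a₀

/-- The sequence of ancestor splits is unique when it exists, so the existential event becomes an
event about the map `ancestors`, to which pushforward measures apply. -/
lemma exists_mem_ancestorSplits_iff (t : AxisTree d) (a₀ : Fin d × ℝ) (p : List Bool)
    (A : Set (Fin p.length → Fin d × ℝ)) : (∃ h ∈ A, t.AncestorSplits p h) ↔
      (∃ h, t.AncestorSplits p h) ∧ ancestors t a₀ p ∈ A := by
  have key : ∀ h, t.AncestorSplits p h → ancestors t a₀ p = h := fun h hh => by
    ext1 i
    simp [ancestors, hh i]
  constructor
  · rintro ⟨h, hA, hh⟩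
    exact ⟨⟨h, hh⟩, by rwa [key h hh]⟩
  · rintro ⟨⟨h, hh⟩, hA⟩
    exact ⟨h, by rwa [← key h hh], hh⟩

lemma MeasurableTree.measurable_ancestors (hg : MeasurableTree g) (a₀ : Fin d × ℝ)
    (p : List Bool) : Measurable fun ξ => ancestors (g ξ) a₀ p := by
  refine measurable_pi_lambda _ fun i U hU => ?_
  have h : (fun ξ => ancestors (g ξ) a₀ p i) ⁻¹' U =
      (⋃ j, {ξ | ∃ c ∈ {c | (j, c) ∈ U}, (g ξ).nodeAt (p.take i) = some (j, c)}) ∪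
        ({ξ | ∃ j c, (g ξ).nodeAt (p.take i) = some (j, c)}ᶜ ∩ {_ξ | a₀ ∈ U}) := by
    ext ξ
    rcases hn : (g ξ).nodeAt (p.take i) with _ | ⟨j, c⟩
    · simp [ancestors, hn]
    · simp [ancestors, hn]
  rw [h]
  exact (MeasurableSet.iUnion fun j => hg _ j _ (measurable_prodMk_left hU)).union
    ((hg.measurableSet_some _).compl.inter (MeasurableSet.const _))

lemma MeasurableTree.measurableSet_ancestorSplits (hg : MeasurableTree g) (p : List Bool) :
    MeasurableSet {ξ | ∃ h, (g ξ).AncestorSplits p h} := by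
  have h : {ξ | ∃ h, (g ξ).AncestorSplits p h} =
      ⋂ i : Fin p.length, {ξ | ∃ j c, (g ξ).nodeAt (p.take i) = some (j, c)} := by
    ext ξ
    simp only [Set.mem_ofPred_eq, Set.mem_iInter, AxisTree.AncestorSplits]
    constructor
    · rintro ⟨h, hh⟩ i
      exact ⟨_, _, hh i⟩
    · intro hh
      choose j c hc using hh
      exact ⟨fun i => (j i, c i), hc⟩
  rw [h]
  exact MeasurableSet.iInter fun i => hg.measurableSet_some _

/-- The hypothesis over all events `A` is a domination between two pushforwards under `ancestors`,
hence holds for integrals of every nonnegative function of the ancestors. -/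
lemma RandomSplits.lintegral_le {c : ℝ≥0∞} (hQ : RandomSplits Q g c) (hg : MeasurableTree g)
    (a₀ : Fin d × ℝ) (p : List Bool) (j : Fin d) {G : (Fin p.length → Fin d × ℝ) → ℝ≥0∞}
    (hG : Measurable G) :
    c * ∫⁻ ξ in {ξ | (∃ h, (g ξ).AncestorSplits p h) ∧ ∃ j c, (g ξ).nodeAt p = some (j, c)},
        G (ancestors (g ξ) a₀ p) ∂Q ≤
      ∫⁻ ξ in {ξ | (∃ h, (g ξ).AncestorSplits p h) ∧ ∃ c, (g ξ).nodeAt p = some (j, c)},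
        G (ancestors (g ξ) a₀ p) ∂Q := by
  have hH := hg.measurable_ancestors a₀ p
  rw [← lintegral_map hG hH, ← lintegral_map hG hH, ← smul_eq_mul, ← lintegral_smul_measure]
  refine lintegral_mono' ?_ le_rfl
  refine Measure.le_iff.2 fun A hA => ?_
  have h := hQ p j A hA
  simp only [exists_mem_ancestorSplits_iff _ a₀] at h
  rw [Measure.smul_apply, Measure.map_apply hH hA, Measure.map_apply hH hA,
    Measure.restrict_apply (hH hA), Measure.restrict_apply (hH hA), smul_eq_mul]
  convert h using 3
  · ext ξ; simp only [Set.mem_inter_iff, Set.mem_preimage, Set.mem_ofPred_eq]; tauto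
  · ext ξ; simp only [Set.mem_inter_iff, Set.mem_preimage, Set.mem_ofPred_eq]; tauto

/-- One step of the potential along the path of `x`, on the event that `p` is on this path. -/
lemma RandomSplits.setLIntegral_step {c v : ℝ≥0∞} (hQ : RandomSplits Q g c)
    (hg : MeasurableTree g) (x : Feat d) (a₀ : Fin d × ℝ) {Ψ : Corners d → ℝ≥0∞}
    (hΨ : Measurable Ψ) {J : Corners d → Fin d} (hJ : Measurable J) (p : List Bool)
    (hstep : ∀ᵐ ξ ∂Q, ∀ a, (pathState x (g ξ) p.length).1.nodeAt [] = some a →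
      Ψ (stepBox x (pathState x (g ξ) p.length).2 a) +
        (if a.1 = J (pathState x (g ξ) p.length).2 then v * Ψ (pathState x (g ξ) p.length).2
          else 0) ≤ Ψ (pathState x (g ξ) p.length).2) :
    ∫⁻ ξ in {ξ | OnPath x (g ξ) p ∧ ∃ a, (g ξ).nodeAt p = some a},
        Ψ (pathState x (g ξ) (p.length + 1)).2 ∂Q +
      v * (c * ∫⁻ ξ in {ξ | OnPath x (g ξ) p ∧ ∃ a, (g ξ).nodeAt p = some a},
        Ψ (pathState x (g ξ) p.length).2 ∂Q) ≤
      ∫⁻ ξ in {ξ | OnPath x (g ξ) p ∧ ∃ a, (g ξ).nodeAt p = some a},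
        Ψ (pathState x (g ξ) p.length).2 ∂Q := by
  classical
  let b₀ : Corners d := (fun _ => 0, fun _ => 1)
  -- The ancestor sequences for which the turns prescribed by `p` are those of `x`.
  let Ap : Set (Fin p.length → Fin d × ℝ) := {h | ∀ i, p.get i = true ↔ (h i).2 < x (h i).1}
  have hAp : MeasurableSet Ap := by
    have : Ap = ⋂ i, {h | p.get i = true ↔ (h i).2 < x (h i).1} := by ext; simp [Ap]
    rw [this]
    refine MeasurableSet.iInter fun i => ?_
    have hm : MeasurableSet {q : Fin d × ℝ | q.2 < x q.1} :=
      measurableSet_lt measurable_snd ((measurable_of_countable fun j : Fin d => x j).comp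
        measurable_fst)
    have hm' : MeasurableSet {h : Fin p.length → Fin d × ℝ | (h i).2 < x (h i).1} :=
      hm.preimage (measurable_pi_apply (X := fun _ : Fin p.length => Fin d × ℝ) i)
    cases p.get i
    · have : {h : Fin p.length → Fin d × ℝ | false = true ↔ (h i).2 < x (h i).1} =
          {h : Fin p.length → Fin d × ℝ | (h i).2 < x (h i).1}ᶜ := by ext; simp
      rw [this]; exact hm'.compl
    · have : {h : Fin p.length → Fin d × ℝ | true = true ↔ (h i).2 < x (h i).1} =
          {h : Fin p.length → Fin d × ℝ | (h i).2 < x (h i).1} := by ext; simp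
      rw [this]; exact hm'
  set N := {ξ | (∃ h, (g ξ).AncestorSplits p h) ∧ ∃ j c, (g ξ).nodeAt p = some (j, c)} with hN
  set Np := {ξ | OnPath x (g ξ) p ∧ ∃ a, (g ξ).nodeAt p = some a} with hNp
  let Nj (j : Fin d) := {ξ | (∃ h, (g ξ).AncestorSplits p h) ∧ ∃ c, (g ξ).nodeAt p = some (j, c)}
  have hNjm : ∀ j, MeasurableSet (Nj j) := fun j =>
    (hg.measurableSet_ancestorSplits p).inter (hg.measurableSet_dir p j)
  have hNm : MeasurableSet N := (hg.measurableSet_ancestorSplits p).inter (hg.measurableSet_some p)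
  have hH := hg.measurable_ancestors a₀ p
  have hon : ∀ ξ, OnPath x (g ξ) p ↔
      (∃ h, (g ξ).AncestorSplits p h) ∧ ancestors (g ξ) a₀ p ∈ Ap := by
    intro ξ
    rw [← exists_mem_ancestorSplits_iff, onPath_iff]
    constructor
    · intro h
      choose a ha1 ha2 using h
      exact ⟨a, ha2, ha1⟩
    · rintro ⟨h, h1, h2⟩ i
      exact ⟨h i, h2 i, h1 i⟩
  have hNpeq : Np = N ∩ (fun ξ => ancestors (g ξ) a₀ p) ⁻¹' Ap := by
    ext ξ
    simp only [hNp, hN, Set.mem_ofPred_eq, Set.mem_inter_iff, Set.mem_preimage, hon, Prod.exists]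
    tauto
  have hNpm : MeasurableSet Np := by rw [hNpeq]; exact hNm.inter (hH hAp)
  have hpath : ∀ ξ ∈ Np, (pathState x (g ξ) p.length).2 =
      boxOfSplits x b₀ (ancestors (g ξ) a₀ p) ∧
      (pathState x (g ξ) p.length).1.nodeAt [] = (g ξ).nodeAt p := by
    intro ξ hξ
    obtain ⟨⟨h, hh⟩, hA⟩ := (hon ξ).1 hξ.1
    have hh' : (g ξ).AncestorSplits p (ancestors (g ξ) a₀ p) := by
      intro i; simp [ancestors, hh i]
    exact iterate_nextState x (g ξ) b₀ p _ hA hh'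
  let W (h : Fin p.length → Fin d × ℝ) : ℝ≥0∞ := Ap.indicator (fun h => Ψ (boxOfSplits x b₀ h)) h
  have hbm := measurable_boxOfSplits x b₀ p.length
  have hW : Measurable W := (hΨ.comp hbm).indicator hAp
  -- The favourable coordinate `J` depends only on the ancestors. The potential is decomposed by its
  -- value, since the domination is available for one fixed coordinate at a time.
  let Gj (j : Fin d) (h : Fin p.length → Fin d × ℝ) : ℝ≥0∞ :=
    if J (boxOfSplits x b₀ h) = j then W h else 0
  have hGj : ∀ j, Measurable (Gj j) := fun j =>
    Measurable.ite ((hJ.comp hbm) (measurableSet_singleton j)) hW measurable_const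
  have hsumG : ∀ h, ∑ j, Gj j h = W h := fun h => by simp [Gj]
  -- On the path event, `D` is the current potential if the actual split is along the favourable
  -- coordinate, and zero otherwise.
  let D (ξ : Ξ) : ℝ≥0∞ := ∑ j, (Nj j).indicator (fun ξ => Gj j (ancestors (g ξ) a₀ p)) ξ
  have hD : Measurable D := Finset.measurable_sum _ fun j _ =>
    ((hGj j).comp hH).indicator (hNjm j)
  have hWint : ∫⁻ ξ in Np, Ψ (pathState x (g ξ) p.length).2 ∂Q =
      ∫⁻ ξ in N, W (ancestors (g ξ) a₀ p) ∂Q := by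
    have h1 : ∀ ξ, W (ancestors (g ξ) a₀ p) = ((fun ξ => ancestors (g ξ) a₀ p) ⁻¹' Ap).indicator
        (fun ξ => Ψ (boxOfSplits x b₀ (ancestors (g ξ) a₀ p))) ξ := fun ξ => by
      simp only [W, Set.indicator, Set.mem_preimage]
    simp_rw [h1]
    rw [setLIntegral_indicator (hH hAp), Set.inter_comm, ← hNpeq]
    exact setLIntegral_congr_fun hNpm fun ξ hξ => by rw [(hpath ξ hξ).1]
  have hDint : c * ∫⁻ ξ in N, W (ancestors (g ξ) a₀ p) ∂Q ≤ ∫⁻ ξ in Np, D ξ ∂Q := by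
    have h1 : ∫⁻ ξ in N, W (ancestors (g ξ) a₀ p) ∂Q =
        ∑ j, ∫⁻ ξ in N, Gj j (ancestors (g ξ) a₀ p) ∂Q := by
      simp only [← hsumG]
      exact lintegral_finsetSum _ fun j _ => (hGj j).comp hH
    have h2 : ∫⁻ ξ in Np, D ξ ∂Q = ∑ j, ∫⁻ ξ in Nj j, Gj j (ancestors (g ξ) a₀ p) ∂Q := by
      refine (lintegral_finsetSum _ fun j _ =>
        ((hGj j).comp hH).indicator (hNjm j)).trans ?_
      refine Finset.sum_congr rfl fun j _ => ?_
      rw [setLIntegral_indicator (hNjm j)]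
      have h3 : Nj j ∩ Np = Nj j ∩ (fun ξ => ancestors (g ξ) a₀ p) ⁻¹' Ap := by
        rw [hNpeq]
        ext ξ
        simp only [Nj, hN, Set.mem_inter_iff, Set.mem_ofPred_eq, Set.mem_preimage]
        constructor
        · tauto
        · rintro ⟨⟨h, c, hc⟩, hA⟩; exact ⟨⟨h, c, hc⟩, ⟨h, j, c, hc⟩, hA⟩
      rw [h3, Set.inter_comm, ← setLIntegral_indicator (hH hAp)]
      refine lintegral_congr fun ξ => ?_
      by_cases hA : ancestors (g ξ) a₀ p ∈ Ap <;> simp [Gj, W, hA]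
    rw [h1, h2, Finset.mul_sum]
    exact Finset.sum_le_sum fun j _ => hQ.lintegral_le hg a₀ p j (hGj j)
  rw [hWint]
  calc _ ≤ ∫⁻ ξ in Np, Ψ (pathState x (g ξ) (p.length + 1)).2 ∂Q + v * ∫⁻ ξ in Np, D ξ ∂Q := by
        gcongr
    _ = ∫⁻ ξ in Np, (Ψ (pathState x (g ξ) (p.length + 1)).2 + v * D ξ) ∂Q := by
        rw [lintegral_add_right _ (hD.const_mul v), lintegral_const_mul _ hD]
    _ ≤ ∫⁻ ξ in Np, Ψ (pathState x (g ξ) p.length).2 ∂Q := by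
        refine lintegral_mono_ae ?_
        filter_upwards [ae_restrict_of_ae hstep, ae_restrict_mem hNpm] with ξ h1 hξ
        obtain ⟨hb, hn⟩ := hpath ξ hξ
        obtain ⟨a, ha⟩ := hξ.2
        have h2 := h1 a (hn.trans ha)
        refine le_trans (add_le_add (le_of_eq ?_) ?_) h2
        · rw [pathState, Function.iterate_succ_apply', ← pathState, nextState]
          simp [hn, ha]
        · have hA : ancestors (g ξ) a₀ p ∈ Ap := ((hon ξ).1 hξ.1).2
          have hanc := ((hon ξ).1 hξ.1).1
          have hDval : D ξ = Gj a.1 (ancestors (g ξ) a₀ p) := by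
            simp only [D]
            rw [Finset.sum_eq_single a.1]
            · exact Set.indicator_of_mem (show ξ ∈ Nj a.1 from ⟨hanc, a.2, ha⟩) _
            · intro j _ hj
              refine Set.indicator_of_notMem (fun hmem => hj ?_) _
              obtain ⟨c, hc⟩ := hmem.2
              rw [ha, Option.some.injEq] at hc
              rw [hc]
            · simp
          rw [hDval, hb]
          simp only [Gj, W, Set.indicator_of_mem hA]
          by_cases hJa : J (boxOfSplits x b₀ (ancestors (g ξ) a₀ p)) = a.1
          · simp [hJa]
          · simp [hJa, Ne.symm hJa]
    _ = _ := hWint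

end Paths

/-! ### Geometric decay of a potential along the path -/

section Decay

variable {d : ℕ} {Ξ : Type*} [MeasurableSpace Ξ] {Q : Measure Ξ} {g : Ξ → AxisTree d}

/-- The events that a given address of length `m` is a split node on the path of `x` are disjoint,
and by `hsome` they cover almost every seed. The one-address inequality is summed over them. -/
lemma RandomSplits.lintegral_step {c v : ℝ≥0∞} (hQ : RandomSplits Q g c)
    (hg : MeasurableTree g) (x : Feat d) (a₀ : Fin d × ℝ) {Ψ : Corners d → ℝ≥0∞}
    (hΨ : Measurable Ψ) {J : Corners d → Fin d} (hJ : Measurable J) (m : ℕ)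
    (hsome : ∀ᵐ ξ ∂Q, ∀ i ≤ m, ∃ a, (pathState x (g ξ) i).1.nodeAt [] = some a)
    (hstep : ∀ᵐ ξ ∂Q, ∀ a, (pathState x (g ξ) m).1.nodeAt [] = some a →
      Ψ (stepBox x (pathState x (g ξ) m).2 a) +
        (if a.1 = J (pathState x (g ξ) m).2 then v * Ψ (pathState x (g ξ) m).2
          else 0) ≤ Ψ (pathState x (g ξ) m).2) :
    ∫⁻ ξ, Ψ (pathState x (g ξ) (m + 1)).2 ∂Q + v * (c * ∫⁻ ξ, Ψ (pathState x (g ξ) m).2 ∂Q) ≤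
      ∫⁻ ξ, Ψ (pathState x (g ξ) m).2 ∂Q := by
  let E (p : {p : List Bool // p.length = m}) : Set Ξ :=
    {ξ | OnPath x (g ξ) p.1 ∧ ∃ a, (g ξ).nodeAt p.1 = some a}
  have hE : ∀ p, MeasurableSet (E p) := fun p => by
    have := (hg.measurableSet_onPath x p.1).inter (hg.measurableSet_some p.1)
    convert this using 1
    ext ξ
    simp [E]
  have hdisj : Pairwise (Function.onFun Disjoint E) := fun p p' hp => by
    refine Set.disjoint_left.2 fun ξ h h' => hp (Subtype.ext ?_)
    exact OnPath.unique h.1 h'.1 (p.2.trans p'.2.symm)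
  have hcover : Q.restrict (⋃ p, E p) = Q := by
    refine Measure.restrict_eq_self_of_ae_mem ?_
    filter_upwards [hsome] with ξ h
    obtain ⟨p, hp, h1, h2⟩ := exists_onPath x (g ξ) _ m h
    exact Set.mem_iUnion.2 ⟨⟨p, hp⟩, h1, h2⟩
  have hsum : ∀ F : Ξ → ℝ≥0∞, ∫⁻ ξ, F ξ ∂Q = ∑' p, ∫⁻ ξ in E p, F ξ ∂Q := fun F => by
    conv_lhs => rw [← hcover]
    exact lintegral_iUnion hE hdisj F
  rw [hsum fun ξ => Ψ (pathState x (g ξ) (m + 1)).2, hsum fun ξ => Ψ (pathState x (g ξ) m).2,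
    ← ENNReal.tsum_mul_left, ← ENNReal.tsum_mul_left, ← ENNReal.tsum_add]
  refine ENNReal.tsum_le_tsum ?_
  rintro ⟨p, rfl⟩
  exact hQ.setLIntegral_step hg x a₀ hΨ hJ p hstep

/-- Induction on the depth. Finiteness of the initial potential keeps every integral finite, which
permits subtracting the expected loss in `ℝ≥0∞`. -/
lemma RandomSplits.lintegral_pathState_le [IsProbabilityMeasure Q] {c v : ℝ} (hc : 0 ≤ c)
    (hv : 0 ≤ v) (hvc : v * c ≤ 1) (hQ : RandomSplits Q g (ENNReal.ofReal c))
    (hg : MeasurableTree g) (x : Feat d) (a₀ : Fin d × ℝ) {Ψ : Corners d → ℝ≥0∞}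
    (hΨ : Measurable Ψ) (hΨ₀ : Ψ (fun _ => 0, fun _ => 1) ≠ ⊤)
    {J : Corners d → Fin d} (hJ : Measurable J) (m : ℕ)
    (hsome : ∀ᵐ ξ ∂Q, ∀ i < m, ∃ a, (pathState x (g ξ) i).1.nodeAt [] = some a)
    (hstep : ∀ᵐ ξ ∂Q, ∀ i < m, ∀ a, (pathState x (g ξ) i).1.nodeAt [] = some a →
      Ψ (stepBox x (pathState x (g ξ) i).2 a) +
        (if a.1 = J (pathState x (g ξ) i).2 then
          ENNReal.ofReal v * Ψ (pathState x (g ξ) i).2 else 0) ≤ Ψ (pathState x (g ξ) i).2) :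
    ∫⁻ ξ, Ψ (pathState x (g ξ) m).2 ∂Q ≤
      ENNReal.ofReal ((1 - v * c) ^ m) * Ψ (fun _ => 0, fun _ => 1) := by
  have hκ : 0 ≤ 1 - v * c := by linarith
  induction m with
  | zero => simp [pathState]
  | succ m ih =>
    have ih' := ih (hsome.mono fun ξ h i hi => h i (by omega))
      (hstep.mono fun ξ h i hi => h i (by omega))
    have h1 := hQ.lintegral_step hg x a₀ hΨ hJ m
      (hsome.mono fun ξ h i hi => h i (by omega)) (hstep.mono fun ξ h => h m (by omega))
    set I := ∫⁻ ξ, Ψ (pathState x (g ξ) m).2 ∂Q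
    have hI : I ≠ ⊤ := ne_top_of_le_ne_top (ENNReal.mul_ne_top ENNReal.ofReal_ne_top hΨ₀) ih'
    rw [← mul_assoc, ← ENNReal.ofReal_mul hv] at h1
    have h2 : I = ENNReal.ofReal (1 - v * c) * I + ENNReal.ofReal (v * c) * I := by
      rw [← add_mul, ← ENNReal.ofReal_add hκ (by positivity)]
      simp
    have h3 : ∫⁻ ξ, Ψ (pathState x (g ξ) (m + 1)).2 ∂Q ≤ ENNReal.ofReal (1 - v * c) * I := by
      have h4 := h1.trans h2.le
      exact (ENNReal.add_le_add_iff_right (ENNReal.mul_ne_top ENNReal.ofReal_ne_top hI)).1 h4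
    calc _ ≤ ENNReal.ofReal (1 - v * c) * I := h3
      _ ≤ ENNReal.ofReal (1 - v * c) *
          (ENNReal.ofReal ((1 - v * c) ^ m) * Ψ (fun _ => 0, fun _ => 1)) := by gcongr
      _ = _ := by rw [← mul_assoc, ← ENNReal.ofReal_mul hκ, pow_succ']

end Decay

/-! ### The potential for one side of the cell -/

section Potential

variable {d : ℕ}

/-- The side `j₀`, inflated by a factor for every side that is not yet of length at most `h`. -/
noncomputable def potential (h : ℝ) (e : ℕ) (j₀ : Fin d) (b : Corners d) : ℝ :=
  side b j₀ * ∏ j, max (side b j / h) 1 ^ e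

open Classical in
/-- A coordinate in which the box is longer than `h`, and `j₀` if there is none. -/
noncomputable def longSide (h : ℝ) (j₀ : Fin d) (b : Corners d) : Fin d :=
  if H : (Finset.univ.filter fun j => h < side b j).Nonempty then H.choose else j₀

lemma measurable_side (j : Fin d) : Measurable fun b : Corners d => side b j := by
  unfold side; fun_prop

lemma measurable_potential (h : ℝ) (e : ℕ) (j₀ : Fin d) : Measurable (potential h e j₀) := by
  unfold potential
  refine (measurable_side j₀).mul (Finset.measurable_prod _ fun j _ => ?_)
  exact (((measurable_side j).div_const h).max measurable_const).pow_const e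

open Classical in
-- The choice depends on the box only through the finite set of its long coordinates.
lemma measurable_longSide (h : ℝ) (j₀ : Fin d) : Measurable (longSide h j₀) := by
  let F (S : Finset (Fin d)) : Fin d := if H : S.Nonempty then H.choose else j₀
  let P (b : Corners d) : Finset (Fin d) := Finset.univ.filter fun j => h < side b j
  refine measurable_to_countable' fun j => ?_
  have h1 : longSide h j₀ ⁻¹' {j} = ⋃ S ∈ {S : Finset (Fin d) | F S = j}, ⋂ i,
      {b | h < side b i ↔ i ∈ S} := by
    ext b
    simp only [Set.mem_preimage, Set.mem_singleton_iff, Set.mem_iUnion, Set.mem_iInter,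
      Set.mem_ofPred_eq, exists_prop]
    constructor
    · intro hb
      exact ⟨P b, hb, fun i => by simp [P]⟩
    · rintro ⟨S, hS, hb⟩
      have : P b = S := by ext i; simp [P, hb i]
      rw [← hS, ← this]
      rfl
  rw [h1]
  refine MeasurableSet.biUnion (Set.to_countable _) fun S _ => MeasurableSet.iInter fun i => ?_
  have hm : MeasurableSet {b : Corners d | h < side b i} :=
    measurableSet_lt measurable_const (measurable_side i)
  by_cases hi : i ∈ S
  · simpa [hi] using hm
  · have : {b : Corners d | h < side b i ↔ i ∈ S} = {b : Corners d | h < side b i}ᶜ := by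
      ext; simp [hi]
    rw [this]; exact hm.compl

lemma side_le_potential {h : ℝ} {e : ℕ} {j₀ : Fin d} {b : Corners d} (hb : 0 ≤ side b j₀) :
    side b j₀ ≤ potential h e j₀ b := by
  refine le_mul_of_one_le_right hb ?_
  calc (1 : ℝ) = ∏ _j : Fin d, (1 : ℝ) := by simp
    _ ≤ _ := Finset.prod_le_prod (fun _ _ => zero_le_one) fun j _ => one_le_pow₀ (le_max_right _ _)

lemma potential_init {h : ℝ} (hh0 : 0 < h) (hh1 : h ≤ 1) (e : ℕ) (j₀ : Fin d) :
    potential h e j₀ (fun _ => 0, fun _ => 1) = (1 / h) ^ (e * d) := by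
  have : max (1 / h) 1 = 1 / h := max_eq_left (by rw [le_div_iff₀ hh0]; linarith)
  simp [potential, side, pow_mul, -one_div, this]

/-- No split increases the potential. If some side exceeds `h`, cutting the designated long one
multiplies its factor by `1 - β` in spite of the truncation at one, because `(1 - β) * side` is
still at least `h'`; the power `e` turns this into `q`. If all sides are short, the designated
coordinate is `j₀`, whose side shrinks by `q` directly. -/
lemma potential_step {h h' β q : ℝ} {e : ℕ} (hh0 : 0 < h') (hh : h' ≤ (1 - β) * h)
    (hq0 : 0 ≤ q) (hq : (1 - β) ^ e ≤ q) (hβ : β ≤ 1) (j₀ j : Fin d) {b b' : Corners d}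
    (hb : ∀ i, 0 ≤ side b i) (hne : ∀ i, i ≠ j → side b' i = side b i) (h0 : 0 ≤ side b' j)
    (hle : side b' j ≤ side b j) (hlong : h < side b j → side b' j ≤ (1 - β) * side b j)
    (hshort : (∀ i, side b i ≤ h) → side b' j ≤ q * side b j) :
    potential h' e j₀ b' ≤ potential h' e j₀ b ∧
      (j = longSide h j₀ b → potential h' e j₀ b' ≤ q * potential h' e j₀ b) := by
  classical
  have hle' : ∀ i, side b' i ≤ side b i := fun i => by
    by_cases hi : i = j
    · rw [hi]; exact hle
    · exact (hne i hi).le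
  have hb' : ∀ i, 0 ≤ side b' i := fun i => by
    by_cases hi : i = j
    · rw [hi]; exact h0
    · rw [hne i hi]; exact hb i
  have hmax : ∀ i, max (side b' i / h') 1 ≤ max (side b i / h') 1 := fun i =>
    max_le_max (by gcongr; exact hle' i) le_rfl
  have hprod : ∏ i, max (side b' i / h') 1 ^ e ≤ ∏ i, max (side b i / h') 1 ^ e :=
    Finset.prod_le_prod (fun i _ => by positivity) fun i _ => pow_le_pow_left₀ (by positivity) (hmax i) e
  have hp0 : ∀ b : Corners d, 0 ≤ ∏ i, max (side b i / h') 1 ^ e := fun b => by positivity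
  refine ⟨mul_le_mul (hle' j₀) hprod (hp0 _) (hb j₀), fun hj => ?_⟩
  by_cases hS : (Finset.univ.filter fun j => h < side b j).Nonempty
  · have hjS : h < side b j := by
      have h1 := hS.choose_spec
      rw [longSide, dif_pos hS] at hj
      rw [← hj] at h1
      exact (Finset.mem_filter.1 h1).2
    have h2 := hlong hjS
    have hβ0 : 0 ≤ 1 - β := by linarith
    have h3 : max (side b' j / h') 1 ≤ (1 - β) * max (side b j / h') 1 := by
      have hmx : 1 ≤ (1 - β) * (side b j / h') := by
        rw [← mul_div_assoc, le_div_iff₀ hh0, one_mul]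
        exact hh.trans (by gcongr)
      have h4 : (1 - β) * (side b j / h') ≤ (1 - β) * max (side b j / h') 1 := by
        gcongr; exact le_max_left _ _
      refine max_le ?_ (hmx.trans h4)
      refine le_trans ?_ h4
      rw [← mul_div_assoc]
      gcongr
    have h5 : ∏ i, max (side b' i / h') 1 ^ e ≤ q * ∏ i, max (side b i / h') 1 ^ e := by
      rw [← Finset.mul_prod_erase _ _ (Finset.mem_univ j),
        ← Finset.mul_prod_erase _ (fun i => max (side b i / h') 1 ^ e) (Finset.mem_univ j),
        ← mul_assoc]
      refine mul_le_mul ?_ (Finset.prod_le_prod (fun i _ => by positivity)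
        fun i _ => pow_le_pow_left₀ (by positivity) (hmax i) e) (by positivity) (by positivity)
      calc max (side b' j / h') 1 ^ e ≤ ((1 - β) * max (side b j / h') 1) ^ e := by gcongr
        _ = (1 - β) ^ e * max (side b j / h') 1 ^ e := mul_pow _ _ _
        _ ≤ _ := by gcongr
    calc potential h' e j₀ b' ≤ side b j₀ * (q * ∏ i, max (side b i / h') 1 ^ e) :=
          mul_le_mul (hle' j₀) h5 (hp0 _) (hb j₀)
      _ = _ := by rw [potential]; ring
  · rw [longSide, dif_neg hS] at hj
    subst hj
    have hs : ∀ i, side b i ≤ h := fun i => by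
      by_contra hi
      exact hS ⟨i, Finset.mem_filter.2 ⟨Finset.mem_univ i, not_le.1 hi⟩⟩
    calc potential h' e j b' ≤ (q * side b j) * ∏ i, max (side b i / h') 1 ^ e :=
          mul_le_mul (hshort hs) hprod (hp0 _) (mul_nonneg hq0 (hb j))
      _ = _ := by rw [potential]; ring

lemma side_stepBox_le (x : Feat d) (b : Corners d) (a : Fin d × ℝ) :
    side (stepBox x b a) a.1 ≤ side b a.1 := by
  unfold stepBox side
  split_ifs
  · simp
  · have := le_max_left (b.1 a.1) a.2
    simp only [Function.update_self]; linarith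

end Potential

/-! ### Expected side length for fixed data -/

section Shrinkage

variable {d : ℕ} {ρ : ℝ} {r : ℕ}

open Classical in
lemma exists_mem_leafCell_of_isRegular {ι : Type*} {X : ι → Feat d} {t : AxisTree d}
    {A : Finset ι} (hr : 1 ≤ r) (ht : t.IsRegular ρ r X A) (x : Feat d) :
    ∃ i ∈ A, X i ∈ t.leafCell x := by
  induction t generalizing A with
  | leaf =>
    obtain ⟨i, hi⟩ := Finset.card_pos.1 (hr.trans ht.1)
    exact ⟨i, hi, Set.mem_univ _⟩
  | split j c l r ihl ihr =>
    obtain ⟨-, -, h1, h2⟩ := ht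
    by_cases hx : x j ≤ c
    · obtain ⟨i, hi, hl⟩ := ihl h1
      rw [Finset.mem_filter] at hi
      exact ⟨i, hi.1, by simp only [AxisTree.leafCell, hx, if_true]; exact ⟨hi.2, hl⟩⟩
    · obtain ⟨i, hi, hl⟩ := ihr h2
      rw [Finset.mem_filter] at hi
      exact ⟨i, hi.1, by simp only [AxisTree.leafCell, hx, if_false]; exact ⟨hi.2, hl⟩⟩

lemma closedBox_subset_cube {lo hi : Fin d → ℝ} (h0 : ∀ j, 0 ≤ lo j) (h1 : ∀ j, hi j ≤ 1) :
    closedBox lo hi ⊆ cube d := fun _ hy j =>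
  ⟨(h0 j).trans (hy j).1, (hy j).2.trans (h1 j)⟩

variable {Ξ : Type*} [MeasurableSpace Ξ] {Q : Measure Ξ} {g : Ξ → AxisTree d} {k : ℕ}
  {X : Fin k → Feat d} {x : Feat d} {c₀ c₁ : ℝ} {f : Feat d → ℝ}

lemma nodeAt_nil_of_not_leaf {ι : Type*} {X : ι → Feat d} {t : AxisTree d} {A : Finset ι}
    (ht : t.IsRegular ρ r X A) (hA : 2 * r ≤ A.card) : ∃ a, t.nodeAt [] = some a := by
  cases t with
  | leaf => exact absurd ht.2 (by omega)
  | split j c l r => exact ⟨_, rfl⟩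

/-- The expected length of a side of the cell of `x` decays geometrically in the depth, as long as
the nodes contain many points. -/
lemma lintegral_side_le [IsProbabilityMeasure Q] {π τ h N : ℝ} {e M : ℕ} (hg : MeasurableTree g)
    (hρ0 : 0 < ρ) (hρ : ρ ≤ 1 / 5) (hπ0 : 0 ≤ π) (hπ1 : π ≤ 1)
    (hreg : ∀ᵐ ξ ∂Q, (g ξ).IsRegular ρ r X Finset.univ)
    (hrand : RandomSplits Q g (ENNReal.ofReal (π / d)))
    (hX : ∀ i, X i ∈ cube d) (hx : x ∈ cube d) (hbox : BoxRegular c₁ f (1 / 25) τ X)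
    (hc₀ : 0 < c₀) (hf : ∀ y ∈ cube d, c₀ ≤ f y ∧ f y ≤ c₁) (hh0 : 0 < h) (hh1 : h ≤ 1)
    (hlocal : ∀ y ∈ cube d, (∀ j, |y j - x j| ≤ h) → |f y - f x| ≤ 1 / 25 * c₀)
    (he : (1 - ρ * (c₀ / c₁) / 2) ^ e ≤ 1 - 3 / 4 * ρ)
    (hM : ∀ i < M, N ≤ ρ ^ i * k) (hN0 : 0 < N) (hNτ : 2 * τ ≤ 1 / 25 * ρ * N)
    (hNr : 2 * r ≤ N) (j₀ : Fin d) :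
    ∫⁻ ξ, ENNReal.ofReal (side (pathState x (g ξ) M).2 j₀) ∂Q ≤
      ENNReal.ofReal ((1 - 3 / 4 * ρ * (π / d)) ^ M *
        (1 / ((1 - ρ * (c₀ / c₁) / 2) * h)) ^ (e * d)) := by
  set β := ρ * (c₀ / c₁) / 2 with hβ
  have hfx := hf x hx
  have hc₁ : 0 < c₁ := by linarith
  have hcc : c₀ / c₁ ≤ 1 := by rw [div_le_one hc₁]; linarith
  have hcc0 : 0 < c₀ / c₁ := by positivity
  have hβ0 : 0 < β := by positivity
  have hβ1 : β ≤ 1 / 10 := by nlinarith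
  set h' := (1 - β) * h with hh'
  have hh'0 : 0 < h' := mul_pos (by linarith) hh0
  have hh'1 : h' ≤ 1 := by nlinarith
  have hd : (0 : ℝ) < d := by exact_mod_cast j₀.pos
  have hd1 : (1 : ℝ) ≤ d := by exact_mod_cast j₀.pos
  have hπd : π / d ≤ 1 := by rw [div_le_one hd]; linarith
  have hπd0 : 0 ≤ π / d := by positivity
  have hq0 : (0 : ℝ) ≤ 1 - 3 / 4 * ρ := by linarith
  have hinv : ∀ᵐ ξ ∂Q, ∀ i, ∃ A, NodeInvariant ρ r X x (g ξ) (pathState x (g ξ) i) A ∧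
      ρ ^ i * k ≤ A.card := by
    filter_upwards [hreg] with ξ h i
    simpa using exists_nodeInvariant hX hx h hρ0.le (by linarith) i
  have hcard : ∀ {i : ℕ} {A : Finset (Fin k)}, i < M → ρ ^ i * k ≤ A.card → 2 * r ≤ A.card := by
    intro i A hi hA
    have : ((2 * r : ℕ) : ℝ) ≤ A.card := by
      push_cast
      exact hNr.trans ((hM i hi).trans hA)
    exact_mod_cast this
  have hmain : ∀ᵐ ξ ∂Q, ∀ i < M, ∀ a, (pathState x (g ξ) i).1.nodeAt [] = some a →
      potential h' e j₀ (stepBox x (pathState x (g ξ) i).2 a) ≤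
          potential h' e j₀ (pathState x (g ξ) i).2 ∧
        (a.1 = longSide h j₀ (pathState x (g ξ) i).2 →
          potential h' e j₀ (stepBox x (pathState x (g ξ) i).2 a) ≤
            (1 - 3 / 4 * ρ) * potential h' e j₀ (pathState x (g ξ) i).2) := by
    filter_upwards [hinv] with ξ hξ i hi a ha
    obtain ⟨A, hA, hAc⟩ := hξ i
    obtain ⟨A', hA', -⟩ := hξ (i + 1)
    have hnext : (pathState x (g ξ) (i + 1)).2 = stepBox x (pathState x (g ξ) i).2 a := by
      rw [pathState, Function.iterate_succ_apply', ← pathState, nextState]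
      simp [ha]
    have hNA : N ≤ A.card := (hM i hi).trans hAc
    have hApos : 0 < A.card := by
      have : (0 : ℝ) < A.card := hN0.trans_le hNA
      exact_mod_cast this
    have hτA : 2 * τ ≤ 1 / 25 * ρ * A.card := hNτ.trans (by gcongr)
    have hsub := closedBox_subset_cube hA.lower hA.upper
    refine potential_step hh'0 le_rfl hq0 he (by linarith) j₀ a.1 (fun i => hA.side_nonneg i)
      (fun i hi => side_stepBox_of_ne hi) ?_ (side_stepBox_le _ _ _) (fun _ => ?_) (fun hs => ?_)
    · rw [← hnext]; exact hA'.side_nonneg _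
    · refine hA.side_next_le hbox (by norm_num) (by norm_num) hρ0 (by linarith) hApos hτA ha
        hc₀.le (by linarith : c₀ ≤ c₁) hc₁ le_rfl (fun y hy => (hf y (hsub hy)).1)
        (fun y hy => (hf y (hsub hy)).2) ?_
      -- Only the global bounds `c₀` and `c₁` are available on a long box. The halving in `β`
      -- absorbs the counting errors: `(26/25)² / 2 < (24/25)²`.
      have h1 : β * c₁ = ρ * c₀ / 2 := by rw [hβ]; field_simp
      have h2 : 0 < ρ * c₀ := by positivity
      nlinarith
    · have hloc : ∀ y ∈ closedBox (pathState x (g ξ) i).2.1 (pathState x (g ξ) i).2.2,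
          |f y - f x| ≤ 1 / 25 * f x := fun y hy => by
        refine (hlocal y (hsub hy) fun j => ?_).trans (by linarith)
        have h1 := hy j
        have h2 := hA.mem j
        have h3 := hs j
        simp only [side] at h3
        rw [abs_le]
        constructor <;> linarith [h1.1, h1.2, h2.1, h2.2]
      have hmin : 0 < min ((1 + 1 / 25) * f x) c₁ := lt_min (by linarith) hc₁
      rw [show (1 - 3 / 4 * ρ) = 1 - (3 / 4 * ρ) by ring]
      refine hA.side_next_le hbox (by norm_num) (by norm_num) hρ0 (by linarith) hApos hτA ha
        (F := (1 - 1 / 25) * f x) (F' := min ((1 + 1 / 25) * f x) c₁)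
        (by linarith) (by linarith) hmin (min_le_right _ _) (fun y hy => ?_) (fun y hy => ?_) ?_
      · linarith [(abs_le.1 (hloc y hy)).1]
      · exact le_min (by linarith [(abs_le.1 (hloc y hy)).2]) (hf y (hsub hy)).2
      · have h1 := min_le_left ((1 + 1 / 25) * f x) c₁
        have h2 : 0 < ρ * f x := mul_pos hρ0 (by linarith)
        -- On a short box the density is within `1/25` of `f x`; the fraction `3/4` is allowed
        -- because `(3/4) (26/25)³ < (24/25)³`.
        calc 3 / 4 * ρ * ((1 + 1 / 25) ^ 2 * min ((1 + 1 / 25) * f x) c₁)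
            ≤ 3 / 4 * ρ * ((1 + 1 / 25) ^ 2 * ((1 + 1 / 25) * f x)) := by gcongr
          _ ≤ _ := by nlinarith
  have hpot0 : ∀ᵐ ξ ∂Q, ∀ i, 0 ≤ potential h' e j₀ (pathState x (g ξ) i).2 := by
    filter_upwards [hinv] with ξ hξ i
    obtain ⟨A, hA, -⟩ := hξ i
    exact (hA.side_nonneg j₀).trans (side_le_potential (hA.side_nonneg j₀))
  have hdecay := hrand.lintegral_pathState_le (v := 3 / 4 * ρ) hπd0 (by positivity)
    (by nlinarith) hg x (j₀, 0) (Ψ := fun b => ENNReal.ofReal (potential h' e j₀ b))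
    (measurable_potential h' e j₀).ennreal_ofReal ENNReal.ofReal_ne_top
    (measurable_longSide h j₀) M
    (by
      filter_upwards [hinv] with ξ hξ i hi
      obtain ⟨A, hA, hAc⟩ := hξ i
      exact nodeAt_nil_of_not_leaf hA.regular (hcard hi hAc))
    (by
      filter_upwards [hmain, hpot0] with ξ hξ hp i hi a ha
      obtain ⟨h1, h2⟩ := hξ i hi a ha
      split_ifs with hJ
      · rw [← ENNReal.ofReal_mul (by positivity)]
        have h3 : potential h' e j₀ (pathState x (g ξ) i).2 =
            (1 - 3 / 4 * ρ) * potential h' e j₀ (pathState x (g ξ) i).2 +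
              3 / 4 * ρ * potential h' e j₀ (pathState x (g ξ) i).2 := by ring
        conv_rhs => rw [h3, ENNReal.ofReal_add (mul_nonneg hq0 (hp i))
          (mul_nonneg (by positivity) (hp i))]
        gcongr
        exact h2 hJ
      · rw [add_zero]
        exact ENNReal.ofReal_le_ofReal h1)
  calc _ ≤ ∫⁻ ξ, ENNReal.ofReal (potential h' e j₀ (pathState x (g ξ) M).2) ∂Q := by
        refine lintegral_mono_ae ?_
        filter_upwards [hinv] with ξ hξ
        obtain ⟨A, hA, -⟩ := hξ M
        exact ENNReal.ofReal_le_ofReal (side_le_potential (hA.side_nonneg j₀))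
    _ ≤ _ := hdecay
    _ = _ := by
      rw [potential_init hh'0 hh'1, ← ENNReal.ofReal_mul]
      refine pow_nonneg ?_ _
      nlinarith

end Shrinkage

/-! ### Almost sure properties of one block -/

section BlockLaw

variable {d s n B : ℕ} {O Ξ : Type*} [MeasurableSpace O] [MeasurableSpace Ξ]
  {f : Feat d → ℝ} {κ : Kernel (Feat d) O}

lemma norm_le_sum_abs {m : ℕ} (v : EuclideanSpace ℝ (Fin m)) : ‖v‖ ≤ ∑ j, |v j| := by
  have hS : 0 ≤ ∑ j, |v j| := Finset.sum_nonneg fun _ _ => abs_nonneg _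
  rw [EuclideanSpace.norm_eq]
  refine Real.sqrt_le_iff.2 ⟨hS, ?_⟩
  rw [sq (∑ j, |v j|), Finset.sum_mul]
  refine Finset.sum_le_sum fun j _ => ?_
  rw [Real.norm_eq_abs, sq]
  exact mul_le_mul_of_nonneg_left
    (Finset.single_le_sum (f := fun j => |v j|) (fun _ _ => abs_nonneg _) (Finset.mem_univ j))
    (abs_nonneg _)

instance [IsProbabilityMeasure (featureLaw f)] [IsMarkovKernel κ] :
    IsProbabilityMeasure (obsLaw f κ) := by
  unfold obsLaw; infer_instance

lemma measurePreserving_fst_obsLaw [IsProbabilityMeasure (featureLaw f)] [IsMarkovKernel κ] :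
    MeasurePreserving Prod.fst (obsLaw f κ) (featureLaw f) :=
  ⟨measurable_fst, Measure.fst_compProd _ _⟩

lemma featureLaw_hyperplane (f : Feat d → ℝ) (j : Fin d) (c : ℝ) :
    featureLaw f {y | y j = c} = 0 := by
  refine (withDensity_absolutelyContinuous _ _).trans Measure.absolutelyContinuous_restrict ?_
  have h := (EuclideanSpace.volume_preserving_symm_measurableEquiv_toLp (Fin d)).measure_preimage
    (s := {y | y j = c}) (MeasurableSet.nullMeasurableSet (measurableSet_eq_fun
      (measurable_pi_apply j) measurable_const))
  rw [volume_pi, Measure.pi_hyperplane] at h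
  exact h

lemma ae_mem_cube (f : Feat d → ℝ) : ∀ᵐ y ∂featureLaw f, y ∈ cube d :=
  (withDensity_absolutelyContinuous _ _).ae_le (ae_restrict_mem (measurableSet_cube d))

lemma ae_pi_mem_cube {J : Type*} [Fintype J] [IsProbabilityMeasure (featureLaw f)]
    [IsMarkovKernel κ] :
    ∀ᵐ z ∂(Measure.pi fun _ : J => obsLaw f κ), ∀ i, (z i).1 ∈ cube d := by
  refine ae_all_iff.2 fun i => ?_
  have h := (measurePreserving_fst_obsLaw (f := f) (κ := κ)).quasiMeasurePreserving.ae
    (ae_mem_cube f)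
  exact (measurePreserving_eval (fun _ : J => obsLaw f κ) i).quasiMeasurePreserving.ae h

/-- For a pair of indices, one observation is redrawn with the other fixed: a tie puts its features
on a hyperplane, which is null for a law with a density. -/
lemma ae_pi_coord_injective {J : Type*} [Fintype J] [DecidableEq J]
    [IsProbabilityMeasure (featureLaw f)] [IsMarkovKernel κ] :
    ∀ᵐ z ∂(Measure.pi fun _ : J => obsLaw f κ), ∀ j, Function.Injective fun i => (z i).1 j := by
  have hpair : ∀ i i' : J, i ≠ i' → ∀ j, ∀ᵐ z ∂(Measure.pi fun _ : J => obsLaw f κ),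
      (z i).1 j ≠ (z i').1 j := by
    intro i i' hii j
    rw [ae_iff]
    simp only [ne_eq, not_not]
    have hA : MeasurableSet {z : J → Obs d O | (z i).1 j = (z i').1 j} :=
      measurableSet_eq_fun (by fun_prop) (by fun_prop)
    have hmp := measurePreserving_update (obsLaw f κ) i
    rw [← hmp.measure_preimage hA.nullMeasurableSet]
    refine (Measure.measure_prod_null (hmp.measurable hA)).2 (Eventually.of_forall fun z => ?_)
    have hset : Prod.mk z ⁻¹' ((fun p : (J → Obs d O) × Obs d O => Function.update p.1 i p.2) ⁻¹'
        {z | (z i).1 j = (z i').1 j}) = Prod.fst ⁻¹' {y : Feat d | y j = (z i').1 j} := by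
      ext y
      simp [Function.update_of_ne hii.symm]
    simp only [hset, Pi.zero_apply]
    refine (measurePreserving_fst_obsLaw.measure_preimage ?_).trans (featureLaw_hyperplane f j _)
    have : Measurable fun y : Feat d => y j := by fun_prop
    exact (this (measurableSet_singleton _)).nullMeasurableSet
  have hall : ∀ᵐ z ∂(Measure.pi fun _ : J => obsLaw f κ), ∀ i i' : J, ∀ j, i ≠ i' →
      (z i).1 j ≠ (z i').1 j := by
    refine ae_all_iff.2 fun i => ae_all_iff.2 fun i' => ae_all_iff.2 fun j => ?_
    by_cases hi : i = i'
    · exact Eventually.of_forall fun z h => absurd hi h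
    · exact (hpair i i' hi j).mono fun z h _ => h
  filter_upwards [hall] with z hz j i i' h
  by_contra hi
  exact hz i i' j hi h

/-- The data of a block are in general position. -/
def BlockGeneral (z : Fin (s / 2) ⊕ Fin (s - s / 2) → Obs d O) : Prop :=
  GeneralPosition (Sum.elim (fun i => (z (Sum.inl i)).1) fun a => (z (Sum.inr a)).1)

lemma ae_blockGeneral [IsProbabilityMeasure (featureLaw f)] [IsMarkovKernel κ] :
    ∀ᵐ z ∂(Measure.pi fun _ : Fin (s / 2) ⊕ Fin (s - s / 2) => obsLaw f κ), BlockGeneral z := by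
  filter_upwards [ae_pi_mem_cube (f := f) (κ := κ), ae_pi_coord_injective (f := f) (κ := κ)]
    with z h1 h2
  have h : (Sum.elim (fun i => (z (Sum.inl i)).1) fun a => (z (Sum.inr a)).1) =
      fun i => (z i).1 := by
    ext1 i; cases i <;> rfl
  rw [BlockGeneral, h]
  exact ⟨h1, h2⟩

lemma block_boxRegular_tail {c₁ ε t : ℝ} (hc₁ : 0 ≤ c₁)
    (hf₁ : ∀ y ∈ cube d, f y ≤ c₁) [IsProbabilityMeasure (featureLaw f)] [IsMarkovKernel κ]
    (hk : 0 < s - s / 2) (hε0 : 0 < ε) (hε1 : ε ≤ 1) (ht : 4 * d * c₁ ≤ t) :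
    (Measure.pi fun _ : Fin (s / 2) ⊕ Fin (s - s / 2) => obsLaw f κ)
        {z | ¬ BoxRegular c₁ f ε t fun a => (z (Sum.inr a)).1} ≤
      ENNReal.ofReal (4 * (((s - s / 2 : ℕ) : ℝ) + 1) ^ (2 * d) * Real.exp (-(ε * t))) := by
  have h1 := measurePreserving_comp_embedding (obsLaw f κ)
    (Function.Embedding.inr : Fin (s - s / 2) ↪ Fin (s / 2) ⊕ Fin (s - s / 2))
  have h2 := measurePreserving_pi (fun _ : Fin (s - s / 2) => obsLaw f κ)
    (fun _ => featureLaw f) fun _ => measurePreserving_fst_obsLaw (f := f) (κ := κ)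
  have h3 := h2.comp h1
  -- The event ranges over uncountably many boxes and is not known to be measurable; this inequality
  -- for a pushforward holds for every set.
  refine (Measure.le_map_apply h3.measurable.aemeasurable
    {X | ¬ BoxRegular c₁ f ε t X}).trans ?_
  rw [h3.map_eq]
  exact boxRegular_tail hc₁ hf₁ hk hε0 hε1 ht

end BlockLaw

/-! ### Mean distance to the target within its leaf -/

section BlockShrinkage

variable {d s : ℕ} {O Ξ : Type*} [MeasurableSpace O] [MeasurableSpace Ξ]
  {f : Feat d → ℝ} {κ : Kernel (Feat d) O} {T : TreeLearner d s O Ξ} {Q : Measure Ξ}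
  {ρ π : ℝ} {r : ℕ}

lemma measurableTree_blockTree_right (T : TreeLearner d s O Ξ)
    (z : Fin (s / 2) ⊕ Fin (s - s / 2) → Obs d O) : MeasurableTree fun ξ => blockTree T z ξ :=
  (measurableTree_blockTree T).comp (u := fun ξ => (z, ξ)) (by fun_prop)

lemma TreeLearner.IsForestRegular.ae_regular (hT : T.IsForestRegular Q ρ π r)
    {z : Fin (s / 2) ⊕ Fin (s - s / 2) → Obs d O} (hz : BlockGeneral z) :
    ∀ᵐ ξ ∂Q, (blockTree T z ξ).IsRegular ρ r (fun a => (z (Sum.inr a)).1) Finset.univ :=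
  hT.regular _ _ hz

lemma TreeLearner.IsForestRegular.randomSplits (hT : T.IsForestRegular Q ρ π r)
    {z : Fin (s / 2) ⊕ Fin (s - s / 2) → Obs d O} (hz : BlockGeneral z) :
    RandomSplits Q (fun ξ => blockTree T z ξ) (ENNReal.ofReal (π / d)) :=
  fun p j A hA => hT.random_split _ _ hz p j A hA

/-- Almost surely the leaf of `x` contains points of the estimation half. -/
lemma ae_blockLeaf_nonempty [IsProbabilityMeasure Q] [IsProbabilityMeasure (featureLaw f)]
    [IsMarkovKernel κ] (hT : T.IsForestRegular Q ρ π r) (hr : 1 ≤ r) (x : Feat d) :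
    ∀ᵐ p ∂((Measure.pi fun _ : Fin (s / 2) ⊕ Fin (s - s / 2) => obsLaw f κ).prod Q),
      (blockLeaf T x p).Nonempty := by
  have hm : MeasurableSet {p : (Fin (s / 2) ⊕ Fin (s - s / 2) → Obs d O) × Ξ |
      (blockLeaf T x p).Nonempty} := by
    have h : {p : (Fin (s / 2) ⊕ Fin (s - s / 2) → Obs d O) × Ξ | (blockLeaf T x p).Nonempty} =
        ⋃ a, {p | a ∈ blockLeaf T x p} := by
      ext p; simp [Finset.Nonempty]
    rw [h]
    exact MeasurableSet.iUnion fun a => measurableSet_mem_blockLeaf T x a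
  refine (Measure.ae_prod_iff_ae_ae hm).2 ?_
  filter_upwards [ae_blockGeneral (f := f) (κ := κ)] with z hz
  filter_upwards [hT.ae_regular hz] with ξ hξ
  obtain ⟨a, -, ha⟩ := exists_mem_leafCell_of_isRegular hr hξ x
  exact ⟨a, (mem_blockLeaf T x _ a).2 ha⟩

open Classical in
/-- The distance to `x` along a coordinate, for points of the cube. -/
noncomputable def coordDist (x : Feat d) (j : Fin d) (y : Feat d) : ℝ :=
  if y ∈ cube d then |y j - x j| else 0

lemma coordDist_nonneg (x : Feat d) (j : Fin d) (y : Feat d) : 0 ≤ coordDist x j y := by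
  unfold coordDist; split_ifs <;> positivity

lemma coordDist_le_one {x : Feat d} (hx : x ∈ cube d) (j : Fin d) (y : Feat d) :
    coordDist x j y ≤ 1 := by
  unfold coordDist
  split_ifs with hy
  · rw [abs_le]
    constructor <;> linarith [(hx j).1, (hx j).2, (hy j).1, (hy j).2]
  · exact zero_le_one

lemma measurable_coordDist (x : Feat d) (j : Fin d) : Measurable (coordDist x j) := by
  classical
  unfold coordDist
  refine Measurable.ite (measurableSet_cube d) ?_ measurable_const
  have : Measurable fun y : Feat d => y j - x j := by fun_prop
  exact measurable_abs.comp this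

lemma blockAvg_nonneg (T : TreeLearner d s O Ξ) (x : Feat d) {h : Obs d O → ℝ}
    (hh : ∀ z, 0 ≤ h z) (p : (Fin (s / 2) ⊕ Fin (s - s / 2) → Obs d O) × Ξ) :
    0 ≤ blockAvg T x h p :=
  Finset.sum_nonneg fun a _ => mul_nonneg (blockWeight_nonneg T x p a) (hh _)

/-- The leaf points in the estimation half lie in the bounding box at depth `M`, and so does `x`.
Their distance along a coordinate is thus at most the corresponding side. -/
lemma lintegral_blockAvg_coordDist_le [IsProbabilityMeasure Q] {c₀ c₁ τ h N : ℝ} {e M : ℕ}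
    (hT : T.IsForestRegular Q ρ π r) (hρ0 : 0 < ρ) (hρ : ρ ≤ 1 / 5) (hπ0 : 0 ≤ π) (hπ1 : π ≤ 1)
    {z : Fin (s / 2) ⊕ Fin (s - s / 2) → Obs d O} (hz : BlockGeneral z)
    {x : Feat d} (hx : x ∈ cube d)
    (hbox : BoxRegular c₁ f (1 / 25) τ fun a => (z (Sum.inr a)).1)
    (hc₀ : 0 < c₀) (hf : ∀ y ∈ cube d, c₀ ≤ f y ∧ f y ≤ c₁) (hh0 : 0 < h) (hh1 : h ≤ 1)
    (hlocal : ∀ y ∈ cube d, (∀ j, |y j - x j| ≤ h) → |f y - f x| ≤ 1 / 25 * c₀)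
    (he : (1 - ρ * (c₀ / c₁) / 2) ^ e ≤ 1 - 3 / 4 * ρ)
    (hM : ∀ i < M, N ≤ ρ ^ i * (s - s / 2 : ℕ)) (hN0 : 0 < N) (hNτ : 2 * τ ≤ 1 / 25 * ρ * N)
    (hNr : 2 * r ≤ N) (j : Fin d) :
    ∫⁻ ξ, ENNReal.ofReal (blockAvg T x (fun z => coordDist x j z.1) (z, ξ)) ∂Q ≤
      ENNReal.ofReal ((1 - 3 / 4 * ρ * (π / d)) ^ M *
        (1 / ((1 - ρ * (c₀ / c₁) / 2) * h)) ^ (e * d)) := by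
  have hreg := hT.ae_regular hz
  have hcube : ∀ a, (z (Sum.inr a)).1 ∈ cube d := fun a => hz.1 (Sum.inr a)
  refine le_trans (lintegral_mono_ae ?_) (lintegral_side_le
    (measurableTree_blockTree_right T z) hρ0 hρ hπ0 hπ1 hreg (hT.randomSplits hz) hcube hx hbox hc₀
    hf hh0 hh1 hlocal he hM hN0 hNτ hNr j)
  filter_upwards [hreg] with ξ hξ
  obtain ⟨A, hA, -⟩ := exists_nodeInvariant hcube hx hξ hρ0.le (by linarith) M
  refine ENNReal.ofReal_le_ofReal (blockAvg_le_of_forall T x (hA.side_nonneg j) _ fun a ha => ?_)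
  have h1 := hA.subset a (hA.leaf a ((mem_blockLeaf T x _ a).1 ha)).1 j
  have h2 := hA.mem j
  simp only [coordDist, hcube a, if_true, side]
  rw [abs_le]
  constructor <;> linarith [h1.1, h1.2, h2.1, h2.2]

open Classical in
/-- The distance to `x`, for points of the cube. -/
noncomputable def cubeDist (x y : Feat d) : ℝ := if y ∈ cube d then ‖y - x‖ else 0

lemma cubeDist_nonneg (x y : Feat d) : 0 ≤ cubeDist x y := by
  unfold cubeDist; split_ifs <;> positivity

lemma cubeDist_le_sum (x y : Feat d) : cubeDist x y ≤ ∑ j, coordDist x j y := by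
  unfold cubeDist coordDist
  split_ifs
  · simpa using norm_le_sum_abs (y - x)
  · simp

lemma cubeDist_le {x : Feat d} (hx : x ∈ cube d) (y : Feat d) : cubeDist x y ≤ d :=
  (cubeDist_le_sum x y).trans ((Finset.sum_le_sum fun j _ => coordDist_le_one hx j y).trans
    (by simp))

lemma measurable_cubeDist (x : Feat d) : Measurable (cubeDist x) := by
  classical
  unfold cubeDist
  exact Measurable.ite (measurableSet_cube d) (by fun_prop) measurable_const

/-- Coordinate by coordinate: `b` bounds the average over seeds for regular data, and `b'` bounds
the probability of irregular data, where the distance is at most one. -/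
lemma integral_blockAvg_cubeDist_le [IsProbabilityMeasure Q] [IsProbabilityMeasure (featureLaw f)]
    [IsMarkovKernel κ] {c₀ c₁ τ h N : ℝ} {e M : ℕ}
    (hT : T.IsForestRegular Q ρ π r) (hρ0 : 0 < ρ) (hρ : ρ ≤ 1 / 5) (hπ0 : 0 ≤ π) (hπ1 : π ≤ 1)
    {x : Feat d} (hx : x ∈ cube d) (hs : 0 < s - s / 2)
    (hc₀ : 0 < c₀) (hf : ∀ y ∈ cube d, c₀ ≤ f y ∧ f y ≤ c₁) (hh0 : 0 < h) (hh1 : h ≤ 1)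
    (hlocal : ∀ y ∈ cube d, (∀ j, |y j - x j| ≤ h) → |f y - f x| ≤ 1 / 25 * c₀)
    (he : (1 - ρ * (c₀ / c₁) / 2) ^ e ≤ 1 - 3 / 4 * ρ)
    (hM : ∀ i < M, N ≤ ρ ^ i * (s - s / 2 : ℕ)) (hN0 : 0 < N) (hNτ : 2 * τ ≤ 1 / 25 * ρ * N)
    (hNr : 2 * r ≤ N) (hτ : 4 * d * c₁ ≤ τ) {b b' : ℝ}
    (hb : (1 - 3 / 4 * ρ * (π / d)) ^ M *
        (1 / ((1 - ρ * (c₀ / c₁) / 2) * h)) ^ (e * d) ≤ b)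
    (hb' : 4 * (((s - s / 2 : ℕ) : ℝ) + 1) ^ (2 * d) * Real.exp (-(1 / 25 * τ)) ≤ b')
    (hb0 : 0 ≤ b) :
    ∫ p, blockAvg T x (fun z => cubeDist x z.1) p
        ∂((Measure.pi fun _ : Fin (s / 2) ⊕ Fin (s - s / 2) => obsLaw f κ).prod Q) ≤
      d * (b + b') := by
  classical
  set P := Measure.pi fun _ : Fin (s / 2) ⊕ Fin (s - s / 2) => obsLaw f κ with hP
  have hb'0 : 0 ≤ b' := le_trans (by positivity) hb'
  have hc₁ : 0 ≤ c₁ := by linarith [hf x hx]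
  let bad : Set (Fin (s / 2) ⊕ Fin (s - s / 2) → Obs d O) :=
    {z | ¬ BoxRegular c₁ f (1 / 25) τ fun a => (z (Sum.inr a)).1}
  have hbad : P bad ≤ ENNReal.ofReal b' :=
    (block_boxRegular_tail hc₁ (fun y hy => (hf y hy).2) hs (by norm_num) (by norm_num) hτ).trans
      (ENNReal.ofReal_le_ofReal hb')
  have hmeas : ∀ j, Measurable (blockAvg T x fun z => coordDist x j z.1) := fun j =>
    measurable_blockAvg T x ((measurable_coordDist x j).comp measurable_fst)
  have hnn : ∀ j p, 0 ≤ blockAvg T x (fun z => coordDist x j z.1) p := fun j p =>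
    blockAvg_nonneg T x (fun z => coordDist_nonneg x j z.1) p
  have hle1 : ∀ j p, |blockAvg T x (fun z => coordDist x j z.1) p| ≤ 1 := fun j p =>
    abs_blockAvg_le_const T x zero_le_one
      (fun z => by rw [abs_of_nonneg (coordDist_nonneg _ _ _)]; exact coordDist_le_one hx j z.1) p
  have hcoord : ∀ j, ∫ p, blockAvg T x (fun z => coordDist x j z.1) p ∂(P.prod Q) ≤ b + b' := by
    intro j
    rw [integral_eq_lintegral_of_nonneg_ae (Eventually.of_forall (hnn j))
      (hmeas j).aestronglyMeasurable]
    refine ENNReal.toReal_le_of_le_ofReal (by positivity) ?_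
    rw [lintegral_prod _ (hmeas j).ennreal_ofReal.aemeasurable]
    calc _ ≤ ∫⁻ z, (ENNReal.ofReal b + bad.indicator (fun _ => 1) z) ∂P := by
          refine lintegral_mono_ae ?_
          filter_upwards [ae_blockGeneral (f := f) (κ := κ)] with z hz
          by_cases hzb : z ∈ bad
          · rw [Set.indicator_of_mem hzb]
            refine le_trans ?_ le_add_self
            calc _ ≤ ∫⁻ _ξ, 1 ∂Q := lintegral_mono fun ξ => by
                  rw [← ENNReal.ofReal_one]
                  exact ENNReal.ofReal_le_ofReal ((le_abs_self _).trans (hle1 j _))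
              _ = 1 := by simp
          · refine le_trans ?_ le_self_add
            exact (lintegral_blockAvg_coordDist_le hT hρ0 hρ hπ0 hπ1 hz hx (not_not.1 hzb) hc₀ hf
              hh0 hh1 hlocal he hM hN0 hNτ hNr j).trans (ENNReal.ofReal_le_ofReal hb)
      _ ≤ ENNReal.ofReal b + P bad := by
          rw [lintegral_add_left measurable_const]
          refine add_le_add (by simp) ?_
          simpa using lintegral_indicator_const_le (μ := P) bad 1
      _ ≤ _ := by
          rw [ENNReal.ofReal_add hb0 hb'0]
          gcongr
  have hint : ∀ j, Integrable (blockAvg T x fun z => coordDist x j z.1) (P.prod Q) := fun j =>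
    integrable_of_abs_le (hmeas j) (hle1 j)
  calc _ ≤ ∫ p, ∑ j, blockAvg T x (fun z => coordDist x j z.1) p ∂(P.prod Q) := by
        refine integral_mono ?_ (integrable_finsetSum _ fun j _ => hint j) fun p => ?_
        · refine integrable_of_abs_le (M := d)
            (measurable_blockAvg T x ((measurable_cubeDist x).comp measurable_fst)) fun p => ?_
          exact abs_blockAvg_le_const T x (by positivity) (fun z => by
            rw [abs_of_nonneg (cubeDist_nonneg _ _)]; exact cubeDist_le hx z.1) p
        · simp only [blockAvg]
          rw [Finset.sum_comm]
          refine Finset.sum_le_sum fun a _ => ?_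
          rw [← Finset.mul_sum]
          exact mul_le_mul_of_nonneg_left (cubeDist_le_sum _ _) (blockWeight_nonneg T x p a)
    _ = ∑ j, ∫ p, blockAvg T x (fun z => coordDist x j z.1) p ∂(P.prod Q) :=
        integral_finsetSum _ fun j _ => hint j
    _ ≤ ∑ _j : Fin d, (b + b') := Finset.sum_le_sum fun j _ => hcoord j
    _ = _ := by simp [mul_add]

end BlockShrinkage

/-! ### Choice of the depth and the resulting rate -/

section Depth

/-- The bound `ρ ≤ 1/5` is needed here: the factor `5/4` satisfies `(4/7) (5/4) < 3/4`, the slack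
used in the choice of the depth. -/
lemma log_inv_one_sub_le {ρ : ℝ} (hρ0 : 0 < ρ) (hρ : ρ ≤ 1 / 5) :
    Real.log (1 - ρ)⁻¹ ≤ 5 / 4 * ρ := by
  have h1 : 0 < (1 - ρ)⁻¹ := inv_pos.2 (by linarith)
  refine (Real.log_le_sub_one_of_pos h1).trans ?_
  rw [sub_le_iff_le_add, inv_le_iff_one_le_mul₀ (by linarith)]
  nlinarith

lemma log_inv_one_sub_pos {ρ : ℝ} (hρ0 : 0 < ρ) (hρ : ρ ≤ 1 / 5) : 0 < Real.log (1 - ρ)⁻¹ :=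
  Real.log_pos ((one_lt_inv₀ (by linarith)).2 (by linarith))

lemma log_inv_pos {ρ : ℝ} (hρ0 : 0 < ρ) (hρ : ρ ≤ 1 / 5) : 0 < Real.log ρ⁻¹ :=
  Real.log_pos ((one_lt_inv₀ hρ0).2 (by linarith))

lemma rate_eq (ρ π : ℝ) (d : ℕ) : 1 / (2 * alpha ρ π * d) =
    π * Real.log (1 - ρ)⁻¹ / (2 * d * Real.log ρ⁻¹) := by
  rw [alpha, one_div, mul_div_assoc', div_mul_eq_mul_div, inv_div]
  ring_nf

lemma rate_pos {ρ π : ℝ} (hρ0 : 0 < ρ) (hρ : ρ ≤ 1 / 5) (hπ0 : 0 < π) {d : ℕ} (hd : 1 ≤ d) :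
    0 < 1 / (2 * alpha ρ π * d) := by
  rw [rate_eq]
  have h1 := log_inv_one_sub_pos hρ0 hρ
  have h2 := log_inv_pos hρ0 hρ
  have h3 : (0 : ℝ) < d := by exact_mod_cast hd
  positivity

lemma rate_le {ρ π : ℝ} (hρ0 : 0 < ρ) (hρ : ρ ≤ 1 / 5) (hπ1 : π ≤ 1) {d : ℕ}
    (hd : 1 ≤ d) : 1 / (2 * alpha ρ π * d) ≤ 1 / 2 := by
  rw [rate_eq]
  have h1 := log_inv_one_sub_pos hρ0 hρ
  have h2 := log_inv_pos hρ0 hρ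
  have h3 : (1 : ℝ) ≤ d := by exact_mod_cast hd
  have h4 : Real.log (1 - ρ)⁻¹ ≤ Real.log ρ⁻¹ :=
    Real.log_le_log (inv_pos.2 (by linarith)) (inv_anti₀ hρ0 (by linarith))
  rw [div_le_iff₀ (by positivity)]
  calc π * Real.log (1 - ρ)⁻¹ ≤ 1 * Real.log ρ⁻¹ := by gcongr
    _ ≤ d * Real.log ρ⁻¹ := by gcongr
    _ = _ := by ring

/-- All nodes above depth `M` must have more points than the counting error `τ`, which is
logarithmic in `k`. Demanding about `k^(1/8)` points is more than enough and still leaves `7/8` of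
the maximal depth. -/
lemma exists_depth {d : ℕ} (hd : 1 ≤ d) {ρ π c₁ : ℝ} (hρ0 : 0 < ρ) (hρ : ρ ≤ 1 / 5) (hπ0 : 0 < π)
    (hπ1 : π ≤ 1) (hc₁ : 0 ≤ c₁) (r : ℕ) :
    ∃ A : ℝ, 0 < A ∧ ∀ k : ℕ, 1 ≤ k → ∃ (τ N : ℝ) (M : ℕ), 4 * d * c₁ ≤ τ ∧ 0 < N ∧
      2 * τ ≤ 1 / 25 * ρ * N ∧ 2 * r ≤ N ∧ (∀ i < M, N ≤ ρ ^ i * k) ∧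
      (1 - 3 / 4 * ρ * (π / d)) ^ M ≤ A * (k : ℝ) ^ (-(1 / (2 * alpha ρ π * d))) ∧
      4 * ((k : ℝ) + 1) ^ (2 * d) * Real.exp (-(1 / 25 * τ)) ≤
        A * (k : ℝ) ^ (-(1 / (2 * alpha ρ π * d))) := by
  set b := 1 / (2 * alpha ρ π * d) with hb
  have hbpos : 0 < b := rate_pos hρ0 hρ hπ0 hd
  have hble : b ≤ 1 / 2 := rate_le hρ0 hρ hπ1 hd
  have hd1 : (1 : ℝ) ≤ d := by exact_mod_cast hd
  have hd0 : (0 : ℝ) < d := by linarith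
  set R : ℝ := 25 * (2 * d + 1) * 16 + 4 * d * c₁ with hR
  have hR0 : 0 < R := by positivity
  set A₀ : ℝ := 50 * R / ρ + 2 * r with hA₀
  have hA₀0 : 0 < A₀ := by positivity
  -- Chosen so that `(k^(-7/8))^θ = k^(-b)`, compensating for the lost eighth of the depth.
  set θ : ℝ := 8 / 7 * b with hθ
  have hθ0 : 0 < θ := by positivity
  refine ⟨A₀ ^ θ + 4, by positivity, fun k hk => ?_⟩
  have hk1 : (1 : ℝ) ≤ k := by exact_mod_cast hk
  have hk0 : (0 : ℝ) < k := by linarith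
  set y : ℝ := (k : ℝ) ^ (1 / 8 : ℝ) with hy
  have hy1 : 1 ≤ y := Real.one_le_rpow hk1 (by norm_num)
  have hkb : 0 < (k : ℝ) ^ (-b) := Real.rpow_pos_of_pos hk0 _
  have hlog : Real.log (k + 1) ≤ 16 * y := by
    have h1 : Real.log ((k : ℝ) + 1) ≤ Real.log (2 * k) :=
      Real.log_le_log (by linarith) (by linarith)
    have h2 := Real.log_le_rpow_div (x := 2 * k) (ε := 1 / 8) (by positivity) (by norm_num)
    rw [Real.mul_rpow (by norm_num) hk0.le] at h2
    have h3 : (2 : ℝ) ^ (1 / 8 : ℝ) ≤ 2 := by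
      calc (2 : ℝ) ^ (1 / 8 : ℝ) ≤ 2 ^ (1 : ℝ) :=
            Real.rpow_le_rpow_of_exponent_le (by norm_num) (by norm_num)
        _ = 2 := Real.rpow_one 2
    have h4 : (2 : ℝ) ^ (1 / 8 : ℝ) * y ≤ 2 * y := by gcongr
    rw [← hy] at h2
    linarith
  -- Makes `exp (-τ/25)` at most `(k + 1)^(-(2d + 1))`, which beats the `(k + 1)^(2d)` of the union
  -- bound by one power.
  set τ : ℝ := 25 * (2 * d + 1) * Real.log (k + 1) + 4 * d * c₁ with hτ
  have hlog0 : 0 ≤ Real.log ((k : ℝ) + 1) := Real.log_nonneg (by linarith)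
  have hτR : τ ≤ R * y := by
    have h1 : 25 * (2 * d + 1) * Real.log (k + 1) ≤ 25 * (2 * d + 1) * (16 * y) := by gcongr
    have h2 : 4 * d * c₁ ≤ 4 * d * c₁ * y := le_mul_of_one_le_right (by positivity) hy1
    calc τ ≤ 25 * (2 * d + 1) * (16 * y) + 4 * d * c₁ * y := add_le_add h1 h2
      _ = R * y := by rw [hR]; ring
  -- The depth is the first one at which `ρ ^ M * k` drops below the required node size; minimality
  -- gives the lower bound at all smaller depths.
  have hex : ∃ M : ℕ, ρ ^ M * k < A₀ * y := by
    obtain ⟨M, hM⟩ := exists_pow_lt_of_lt_one (x := A₀ * y / k) (y := ρ) (by positivity)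
      (by linarith)
    exact ⟨M, (lt_div_iff₀ hk0).1 hM⟩
  classical
  refine ⟨τ, A₀ * y, Nat.find hex, ?_, by positivity, ?_, ?_, fun i hi => ?_, ?_, ?_⟩
  · have : 0 ≤ 25 * (2 * (d : ℝ) + 1) * Real.log (k + 1) := by positivity
    linarith
  · have h1 : 50 * R / ρ * y ≤ A₀ * y := by
      gcongr
      rw [hA₀]
      have : (0 : ℝ) ≤ r := by positivity
      linarith
    have h2 : ρ * (50 * R / ρ * y) = 50 * (R * y) := by field_simp
    have h3 := mul_le_mul_of_nonneg_left h1 hρ0.le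
    linarith
  · have h1 : 2 * (r : ℝ) ≤ A₀ := by
      rw [hA₀]
      have : 0 ≤ 50 * R / ρ := by positivity
      linarith
    exact h1.trans (le_mul_of_one_le_right hA₀0.le hy1)
  · exact not_lt.1 (Nat.find_min hex hi)
  · set M := Nat.find hex
    have hM : ρ ^ M * k < A₀ * y := Nat.find_spec hex
    have hlρ := log_inv_pos hρ0 hρ
    -- The decay per level is at least as fast as the target rate: the left side equals `(4/7) (π/d)
    -- log (1-ρ)⁻¹`, at most `(5/7) ρ (π/d)`.
    have hθlog : θ * Real.log ρ⁻¹ ≤ 3 / 4 * ρ * (π / d) := by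
      have h1 : θ * Real.log ρ⁻¹ = 4 / 7 * (π / d) * Real.log (1 - ρ)⁻¹ := by
        rw [hθ, hb, rate_eq]
        generalize Real.log ρ⁻¹ = u at hlρ
        field_simp
        ring
      rw [h1]
      have h2 := log_inv_one_sub_le hρ0 hρ
      have h3 : 0 < π / d := by positivity
      calc 4 / 7 * (π / d) * Real.log (1 - ρ)⁻¹ ≤ 4 / 7 * (π / d) * (5 / 4 * ρ) := by gcongr
        _ ≤ _ := by nlinarith [mul_pos h3 hρ0]
    have hκ : 1 - 3 / 4 * ρ * (π / d) ≤ ρ ^ θ := by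
      have h1 : ρ ^ θ = Real.exp (-(θ * Real.log ρ⁻¹)) := by
        rw [Real.rpow_def_of_pos hρ0, Real.log_inv]; ring_nf
      rw [h1]
      have h2 := Real.add_one_le_exp (-(θ * Real.log ρ⁻¹))
      linarith
    have hκ0 : 0 ≤ 1 - 3 / 4 * ρ * (π / d) := by
      have h3 : π / d ≤ 1 := by rw [div_le_one hd0]; linarith
      have h4 : 0 < π / d := by positivity
      nlinarith
    have hρM : ρ ^ M ≤ A₀ * (k : ℝ) ^ (-(7 / 8) : ℝ) := by
      have h1 : (k : ℝ) ^ (-(7 / 8) : ℝ) = y / k := by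
        rw [hy, show (-(7 / 8) : ℝ) = 1 / 8 - 1 by norm_num, Real.rpow_sub hk0, Real.rpow_one]
      rw [h1, mul_div_assoc', le_div_iff₀ hk0]
      exact hM.le
    calc (1 - 3 / 4 * ρ * (π / d)) ^ M ≤ (ρ ^ θ) ^ M := by gcongr
      _ = (ρ ^ M) ^ θ := by
        rw [← Real.rpow_natCast, ← Real.rpow_mul hρ0.le, ← Real.rpow_natCast,
          ← Real.rpow_mul hρ0.le, mul_comm]
      _ ≤ (A₀ * (k : ℝ) ^ (-(7 / 8) : ℝ)) ^ θ := by gcongr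
      _ = A₀ ^ θ * (k : ℝ) ^ (-b) := by
        rw [Real.mul_rpow hA₀0.le (Real.rpow_nonneg hk0.le _), ← Real.rpow_mul hk0.le]
        congr 2
        rw [hθ]; ring
      _ ≤ (A₀ ^ θ + 4) * (k : ℝ) ^ (-b) := by gcongr; linarith
  · have h1 : Real.exp (-(1 / 25 * τ)) ≤ (((k : ℝ) + 1) ^ (2 * d + 1))⁻¹ := by
      rw [← Real.exp_log (by positivity : (0 : ℝ) < ((k : ℝ) + 1) ^ (2 * d + 1)), ← Real.exp_neg,
        Real.log_pow]
      refine Real.exp_le_exp.2 ?_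
      have : 0 ≤ d * c₁ := by positivity
      push_cast
      rw [hτ]
      nlinarith
    have h2 : (k : ℝ)⁻¹ ≤ (k : ℝ) ^ (-b) := by
      rw [← Real.rpow_neg_one]
      exact Real.rpow_le_rpow_of_exponent_le hk1 (by linarith)
    calc 4 * ((k : ℝ) + 1) ^ (2 * d) * Real.exp (-(1 / 25 * τ))
        ≤ 4 * ((k : ℝ) + 1) ^ (2 * d) * (((k : ℝ) + 1) ^ (2 * d + 1))⁻¹ := by gcongr
      _ = 4 * ((k : ℝ) + 1)⁻¹ := by rw [pow_succ]; field_simp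
      _ ≤ 4 * (k : ℝ)⁻¹ := by gcongr; linarith
      _ ≤ 4 * (k : ℝ) ^ (-b) := by gcongr
      _ ≤ (A₀ ^ θ + 4) * (k : ℝ) ^ (-b) := by
        gcongr
        have : 0 ≤ A₀ ^ θ := by positivity
        linarith

/-- The mean distance to `x` of the points in its leaf is of the order of the rate. -/
theorem exists_shrinkage (d : ℕ) (hd : 1 ≤ d) {ρ π : ℝ} (hρ0 : 0 < ρ) (hρ : ρ ≤ 1 / 5)
    (hπ0 : 0 < π) (hπ1 : π ≤ 1) (r : ℕ) {c₀ c₁ : ℝ} (hc₀ : 0 < c₀) (hc : c₀ ≤ c₁) {ω : ℝ → ℝ}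
    (hω : Tendsto ω (𝓝[>] 0) (𝓝 0)) :
    ∃ A : ℝ, 0 < A ∧ ∀ (O Ξ : Type*) [MeasurableSpace O] [MeasurableSpace Ξ]
      (f : Feat d → ℝ) (κ : Kernel (Feat d) O) (x : Feat d) (s : ℕ) (T : TreeLearner d s O Ξ)
      (Q : Measure Ξ) [IsProbabilityMeasure (featureLaw f)] [IsMarkovKernel κ]
      [IsProbabilityMeasure Q], 1 ≤ s → (∀ y ∈ cube d, c₀ ≤ f y ∧ f y ≤ c₁) → x ∈ cube d →
      (∀ y ∈ cube d, |f y - f x| ≤ ω ‖y - x‖) → T.IsForestRegular Q ρ π r →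
      ∫ p, blockAvg T x (fun z => cubeDist x z.1) p
        ∂((Measure.pi fun _ : Fin (s / 2) ⊕ Fin (s - s / 2) => obsLaw f κ).prod Q) ≤
      A * (s : ℝ) ^ (-(1 / (2 * alpha ρ π * d))) := by
  have hc₁ : 0 < c₁ := by linarith
  have hd1 : (1 : ℝ) ≤ d := by exact_mod_cast hd
  have hd0 : (0 : ℝ) < d := by linarith
  obtain ⟨A, hA0, hA⟩ := exists_depth hd hρ0 hρ hπ0 hπ1 hc₁.le r
  -- The modulus is controlled only at positive arguments near zero, so `y = x` is treated
  -- separately below.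
  obtain ⟨h₀, hh₀, hω₀⟩ : ∃ h₀ > 0, ∀ t ∈ Set.Ioo (0 : ℝ) h₀, ω t ≤ 1 / 25 * c₀ := by
    have h1 := hω.eventually (gt_mem_nhds (show (0 : ℝ) < 1 / 25 * c₀ by positivity))
    obtain ⟨u, hu, hsub⟩ := mem_nhdsGT_iff_exists_Ioo_subset.1 h1
    exact ⟨u, hu, fun t ht => (hsub ht).le⟩
  -- If every coordinate differs by at most `h`, the Euclidean distance is at most `d * h ≤ h₀ / 2`.
  set h : ℝ := min 1 (h₀ / (2 * d)) with hh
  have hh0 : 0 < h := lt_min one_pos (by positivity)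
  have hβ : ρ * (c₀ / c₁) / 2 ≤ 1 / 10 := by
    have h1 : c₀ / c₁ ≤ 1 := by rw [div_le_one hc₁]; exact hc
    have h2 : 0 < c₀ / c₁ := by positivity
    nlinarith
  have hβ0 : 0 < ρ * (c₀ / c₁) / 2 := by positivity
  obtain ⟨e, he⟩ := exists_pow_lt_of_lt_one (x := 1 - 3 / 4 * ρ)
    (y := 1 - ρ * (c₀ / c₁) / 2) (by linarith) (by linarith)
  set Φ : ℝ := (1 / ((1 - ρ * (c₀ / c₁) / 2) * h)) ^ (e * d) with hΦ
  have hΦ0 : 0 < Φ := by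
    have : 0 < 1 - ρ * (c₀ / c₁) / 2 := by linarith
    positivity
  refine ⟨2 * (d * (A * Φ + A)), by positivity, ?_⟩
  intro O Ξ _ _ f κ x s T Q _ _ _ hs hf hx hfx hT
  have hk : 1 ≤ s - s / 2 := by omega
  obtain ⟨τ, N, M, h1, h2, h3, h4, h5, h6, h7⟩ := hA (s - s / 2) hk
  have hk1 : (1 : ℝ) ≤ ((s - s / 2 : ℕ) : ℝ) := by exact_mod_cast hk
  set b := 1 / (2 * alpha ρ π * d) with hb
  have hbpos : 0 < b := rate_pos hρ0 hρ hπ0 hd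
  have hble : b ≤ 1 / 2 := rate_le hρ0 hρ hπ1 hd
  have hs0 : (0 : ℝ) < s := by exact_mod_cast hs
  set K : ℝ := ((s - s / 2 : ℕ) : ℝ) ^ (-b) with hK
  have hK0 : 0 < K := Real.rpow_pos_of_pos (by linarith) _
  -- The estimation half has at least `s / 2` points and the exponent is at most one, so passing
  -- from its size to `s` costs a factor 2.
  have hKs : K ≤ 2 * (s : ℝ) ^ (-b) := by
    have hks : (s : ℝ) / 2 ≤ ((s - s / 2 : ℕ) : ℝ) := by
      have : s ≤ 2 * (s - s / 2) := by omega
      have h8 : (s : ℝ) ≤ 2 * ((s - s / 2 : ℕ) : ℝ) := by exact_mod_cast this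
      linarith
    calc K ≤ ((s : ℝ) / 2) ^ (-b) :=
          Real.rpow_le_rpow_of_nonpos (by positivity) hks (by linarith)
      _ = 2 ^ b * (s : ℝ) ^ (-b) := by
          rw [Real.div_rpow hs0.le (by norm_num), Real.rpow_neg (by norm_num : (0 : ℝ) ≤ 2),
            div_inv_eq_mul, mul_comm]
      _ ≤ 2 ^ (1 : ℝ) * (s : ℝ) ^ (-b) := by
          have : (2 : ℝ) ^ b ≤ 2 ^ (1 : ℝ) :=
            Real.rpow_le_rpow_of_exponent_le (by norm_num) (by linarith)
          gcongr
      _ = _ := by rw [Real.rpow_one]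
  have hlocal : ∀ y ∈ cube d, (∀ j, |y j - x j| ≤ h) → |f y - f x| ≤ 1 / 25 * c₀ := by
    intro y hy hyx
    rcases eq_or_ne y x with rfl | hne
    · simp only [sub_self, abs_zero]; positivity
    · refine (hfx y hy).trans (hω₀ _ ⟨norm_pos_iff.2 (sub_ne_zero.2 hne), ?_⟩)
      calc ‖y - x‖ ≤ ∑ j, |(y - x) j| := norm_le_sum_abs _
        _ ≤ ∑ _j : Fin d, h := Finset.sum_le_sum fun j _ => hyx j
        _ = d * h := by simp
        _ ≤ d * (h₀ / (2 * d)) := by gcongr; exact min_le_right _ _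
        _ = h₀ / 2 := by field_simp
        _ < h₀ := by linarith
  refine (integral_blockAvg_cubeDist_le hT hρ0 hρ hπ0.le hπ1 hx (by omega) hc₀ hf hh0
    (min_le_left _ _) hlocal he.le h5 h2 h3 h4 h1 (b := A * K * Φ) (b' := A * K) ?_ h7
    (by positivity)).trans ?_
  · gcongr
  · calc d * (A * K * Φ + A * K) = d * (A * Φ + A) * K := by ring
      _ ≤ d * (A * Φ + A) * (2 * (s : ℝ) ^ (-b)) := by gcongr
      _ = _ := by ring

end Depth

/-! ### Consequences of the assumptions on the loss -/

section Nuisance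

variable {d m : ℕ} {O : Type*} [MeasurableSpace O] {κ : Kernel (Feat d) O}
  {V : Set (EuclideanSpace ℝ (Fin m))} {ℓ : Obs d O → EuclideanSpace ℝ (Fin m) → ℝ}
  {H : Obs d O → Matrix (Fin m) (Fin m) ℝ} {ν₀ : Feat d → EuclideanSpace ℝ (Fin m)} {k : ℕ}
  {γ L Lν : ℝ}

lemma gradient_apply_eq (g : EuclideanSpace ℝ (Fin m) → ℝ) (ν : EuclideanSpace ℝ (Fin m))
    (j : Fin m) : gradient g ν j = fderiv ℝ g ν (EuclideanSpace.single j 1) := by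
  have h : fderiv ℝ g ν (EuclideanSpace.single j 1) =
      inner ℝ (gradient g ν) (EuclideanSpace.single j (1 : ℝ)) := by
    rw [gradient, InnerProductSpace.toDual_symm_apply]
  rw [h, real_inner_comm, EuclideanSpace.inner_single_left]
  simp

open Classical in
/-- A function of the observations, set to zero outside the cube. -/
noncomputable def onCube {d : ℕ} {O : Type*} (h : Obs d O → ℝ) (z : Obs d O) : ℝ :=
  if z.1 ∈ cube d then h z else 0

lemma onCube_of_mem {O : Type*} {h : Obs d O → ℝ} {z : Obs d O} (hz : z.1 ∈ cube d) : onCube h z = h z := by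
  simp [onCube, hz]

lemma measurable_onCube {h : Obs d O → ℝ} (hh : Measurable h) : Measurable (onCube h) := by
  classical
  unfold onCube
  exact Measurable.ite (measurable_fst (measurableSet_cube d)) hh measurable_const

lemma abs_onCube_le {O : Type*} {h : Obs d O → ℝ} {M : ℝ} (hM : 0 ≤ M)
    (hh : ∀ z : Obs d O, z.1 ∈ cube d → |h z| ≤ M) (z : Obs d O) : |onCube h z| ≤ M := by
  unfold onCube
  split_ifs with hz
  · exact hh z hz
  · simpa using hM

/-- A coordinate of the gradient is the limit of difference quotients with step `1 / i`.
Differentiability is known only for features in the cube, hence the truncation `onCube`. -/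
lemma NuisanceAssumptions.measurable_gradient (hN : NuisanceAssumptions κ V ℓ H ν₀ k γ L Lν)
    {ν : EuclideanSpace ℝ (Fin m)} (hν : ν ∈ V) (j : Fin m) :
    Measurable (onCube fun z => gradient (ℓ z) ν j) := by
  refine measurable_of_tendsto_metrizable (f := fun (i : ℕ) => onCube fun z =>
    (i : ℝ) • (ℓ z (ν + (i : ℝ)⁻¹ • EuclideanSpace.single j 1) - ℓ z ν)) (fun i => ?_) ?_
  · have h1 := hN.measurable_loss (ν + (i : ℝ)⁻¹ • EuclideanSpace.single j 1)
    have h2 := hN.measurable_loss ν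
    exact measurable_onCube (by fun_prop)
  · refine tendsto_pi_nhds.2 fun z => ?_
    by_cases hz : z.1 ∈ cube d
    · simp only [onCube, hz, if_true]
      rw [gradient_apply_eq]
      refine (((hN.smooth_loss z hz ν hν).differentiableAt (by norm_num)).hasFDerivAt).lim _ ?_
      simpa using tendsto_natCast_atTop_atTop (R := ℝ)
    · simp only [onCube, hz, if_false]
      exact tendsto_const_nhds

lemma quad_nonneg_of_posSemidef {M : Matrix (Fin m) (Fin m) ℝ} (hM : M.PosSemidef)
    (v : EuclideanSpace ℝ (Fin m)) : 0 ≤ quad M v := by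
  have h := hM.dotProduct_mulVec_nonneg (fun a => v a)
  simpa [quad, dotProduct, Matrix.mulVec, Finset.mul_sum, mul_assoc] using h

variable [IsMarkovKernel κ]

lemma NuisanceAssumptions.integrable_matrix (hN : NuisanceAssumptions κ V ℓ H ν₀ k γ L Lν)
    {y : Feat d} (hy : y ∈ cube d) (a b : Fin m) : Integrable (fun o => H (y, o) a b) (κ y) :=
  integrable_of_abs_le ((hN.measurable_matrix a b).comp measurable_prodMk_left)
    fun o => hN.bounded_matrix (y, o) hy a b

lemma NuisanceAssumptions.quad_integral_nonneg (hN : NuisanceAssumptions κ V ℓ H ν₀ k γ L Lν)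
    {y : Feat d} (hy : y ∈ cube d) (v : EuclideanSpace ℝ (Fin m)) :
    0 ≤ quad (Matrix.of fun a b => ∫ o, H (y, o) a b ∂(κ y)) v := by
  have hint : ∀ a b, Integrable (fun o => v a * H (y, o) a b * v b) (κ y) := fun a b =>
    ((hN.integrable_matrix hy a b).const_mul _).mul_const _
  have h : quad (Matrix.of fun a b => ∫ o, H (y, o) a b ∂(κ y)) v =
      ∫ o, quad (H (y, o)) v ∂(κ y) := by
    simp only [quad, Matrix.of_apply]
    rw [integral_finsetSum _ fun a _ => integrable_finsetSum _ fun b _ => hint a b]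
    refine Finset.sum_congr rfl fun a _ => ?_
    rw [integral_finsetSum _ fun b _ => hint a b]
    refine Finset.sum_congr rfl fun b _ => ?_
    rw [integral_mul_const, integral_const_mul]
  rw [h]
  exact integral_nonneg fun o => quad_nonneg_of_posSemidef (hN.posSemidef_matrix (y, o) hy) v

/-- The coordinate vector of a support index lies in the cone; testing the eigenvalue condition on
it compares `γ` with a diagonal entry. -/
lemma NuisanceAssumptions.eigenvalue_le_one (hN : NuisanceAssumptions κ V ℓ H ν₀ k γ L Lν)
    {x : Feat d} (hx : x ∈ cube d) (hne : (supp (ν₀ x)).Nonempty) : γ ≤ 1 := by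
  obtain ⟨j, hj⟩ := hne
  have hcone : EuclideanSpace.single j (1 : ℝ) ∈ cone (supp (ν₀ x)) 3 := by
    have h0 : ∑ i ∈ (supp (ν₀ x))ᶜ, |(EuclideanSpace.single j (1 : ℝ)) i| = 0 := by
      refine Finset.sum_eq_zero fun i hi => ?_
      have : i ≠ j := fun h => (Finset.mem_compl.1 hi) (h ▸ hj)
      simp [this]
    rw [cone, Set.mem_ofPred_eq, h0]
    exact mul_nonneg (by norm_num) (Finset.sum_nonneg fun _ _ => abs_nonneg _)
  have h1 := hN.restricted_eigenvalue x hx _ hcone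
  have h2 : quad (Matrix.of fun a b => ∫ o, H (x, o) a b ∂(κ x)) (EuclideanSpace.single j 1) =
      ∫ o, H (x, o) j j ∂(κ x) := by
    simp [quad]
  have h3 : ‖(EuclideanSpace.single j (1 : ℝ) : EuclideanSpace ℝ (Fin m))‖ = 1 := by simp
  rw [h2, h3] at h1
  have h4 := abs_integral_le_of_abs_le (P := κ x) (X := fun o => H (x, o) j j) (M := 1)
    fun o => hN.bounded_matrix (x, o) hx j j
  linarith [le_abs_self (∫ o, H (x, o) j j ∂(κ x))]

lemma integral_gradient_apply {μ : Measure O} {g : O → EuclideanSpace ℝ (Fin m)}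
    (hg : Integrable g μ) (j : Fin m) : (∫ o, g o ∂μ) j = ∫ o, g o j ∂μ :=
  ((EuclideanSpace.proj (𝕜 := ℝ) j).integral_comp_comm hg).symm

/-- The centered gradient of the loss at `ν₀ x`. -/
lemma NuisanceAssumptions.abs_integral_gradient_le (hN : NuisanceAssumptions κ V ℓ H ν₀ k γ L Lν)
    {x : Feat d} (hx : x ∈ cube d) (j : Fin m) (y : Feat d) :
    |∫ o, onCube (fun z => gradient (ℓ z) (ν₀ x) j -
        (∫ o, gradient (ℓ (x, o)) (ν₀ x) ∂(κ x)) j) (y, o) ∂(κ y)| ≤ |L| * cubeDist x y := by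
  by_cases hy : y ∈ cube d
  · have hν := (hN.minimizer x hx).1
    have hint := hN.integrable_gradient y hy _ hν
    have hintj : Integrable (fun o => gradient (ℓ (y, o)) (ν₀ x) j) (κ y) :=
      (EuclideanSpace.proj (𝕜 := ℝ) j).integrable_comp hint
    have h1 : ∫ o, onCube (fun z => gradient (ℓ z) (ν₀ x) j -
        (∫ o, gradient (ℓ (x, o)) (ν₀ x) ∂(κ x)) j) (y, o) ∂(κ y) =
        ((∫ o, gradient (ℓ (y, o)) (ν₀ x) ∂(κ y)) -
          ∫ o, gradient (ℓ (x, o)) (ν₀ x) ∂(κ x)) j := by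
      simp only [onCube, hy, if_true]
      rw [integral_sub hintj (integrable_const _), PiLp.sub_apply, integral_gradient_apply hint]
      simp
    rw [h1]
    refine (PiLp.norm_apply_le _ j).trans ((hN.lipschitz_gradient _ hν y hy x hx).trans ?_)
    simp only [cubeDist, hy, if_true]
    gcongr
    exact le_abs_self L
  · simp [onCube, cubeDist, hy]

/-- The extra `1` keeps the bound positive, as the tail inequality requires, even for `G = 0`. -/
lemma NuisanceAssumptions.abs_gradient_sub_le (hN : NuisanceAssumptions κ V ℓ H ν₀ k γ L Lν)
    {x : Feat d} (hx : x ∈ cube d) {G : ℝ}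
    (hG : ∀ z : Obs d O, z.1 ∈ cube d → ∀ j, |gradient (ℓ z) (ν₀ x) j| ≤ G) (j : Fin m)
    (z : Obs d O) (hz : z.1 ∈ cube d) :
    |gradient (ℓ z) (ν₀ x) j - (∫ o, gradient (ℓ (x, o)) (ν₀ x) ∂(κ x)) j| ≤ 2 * |G| + 1 := by
  have h1 := hG z hz j
  have h2 : |(∫ o, gradient (ℓ (x, o)) (ν₀ x) ∂(κ x)) j| ≤ G := by
    rw [integral_gradient_apply (hN.integrable_gradient x hx _ (hN.minimizer x hx).1)]
    exact abs_integral_le_of_abs_le fun o => hG (x, o) hx j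
  have h3 := abs_sub (gradient (ℓ z) (ν₀ x) j) ((∫ o, gradient (ℓ (x, o)) (ν₀ x) ∂(κ x)) j)
  linarith [le_abs_self G]

lemma NuisanceAssumptions.measurable_gradient_sub {κ : Kernel (Feat d) O}
    (hN : NuisanceAssumptions κ V ℓ H ν₀ k γ L Lν) {x : Feat d} (hx : x ∈ cube d) (j : Fin m)
    (c : ℝ) : Measurable (onCube fun z => gradient (ℓ z) (ν₀ x) j - c) := by
  have h := (hN.measurable_gradient (hN.minimizer x hx).1 j).sub
    (measurable_onCube (d := d) (O := O) (measurable_const (a := c)))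
  convert h using 1
  ext z
  by_cases hz : z.1 ∈ cube d <;> simp [onCube, hz]

lemma NuisanceAssumptions.integral_matrix_sub (hN : NuisanceAssumptions κ V ℓ H ν₀ k γ L Lν)
    (b c : Fin m) (y : Feat d) :
    ∫ o, onCube (fun z => H z b c - ∫ o, H (z.1, o) b c ∂(κ z.1)) (y, o) ∂(κ y) = 0 := by
  by_cases hy : y ∈ cube d
  · simp only [onCube, hy, if_true]
    rw [integral_sub (hN.integrable_matrix hy b c) (integrable_const _)]
    simp
  · simp [onCube, hy]

lemma NuisanceAssumptions.abs_matrix_sub_le (hN : NuisanceAssumptions κ V ℓ H ν₀ k γ L Lν)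
    (b c : Fin m) (z : Obs d O) (hz : z.1 ∈ cube d) :
    |H z b c - ∫ o, H (z.1, o) b c ∂(κ z.1)| ≤ 2 := by
  have h1 := hN.bounded_matrix z hz b c
  have h2 : |∫ o, H (z.1, o) b c ∂(κ z.1)| ≤ 1 :=
    abs_integral_le_of_abs_le fun o => hN.bounded_matrix (z.1, o) hz b c
  linarith [abs_sub (H z b c) (∫ o, H (z.1, o) b c ∂(κ z.1))]

lemma NuisanceAssumptions.measurable_matrix_sub (hN : NuisanceAssumptions κ V ℓ H ν₀ k γ L Lν)
    (b c : Fin m) : Measurable (onCube fun z => H z b c - ∫ o, H (z.1, o) b c ∂(κ z.1)) := by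
  refine measurable_onCube ((hN.measurable_matrix b c).sub ?_)
  have h : Measurable fun y : Feat d => ∫ o, H (y, o) b c ∂(κ y) :=
    ((hN.measurable_matrix b c).stronglyMeasurable.integral_kernel_prod_right'
      (κ := κ)).measurable
  exact h.comp measurable_fst

/-- The nuisance parameter at `x` is small off the support at a nearby point. -/
lemma NuisanceAssumptions.sum_off_support_le {κ : Kernel (Feat d) O}
    (hN : NuisanceAssumptions κ V ℓ H ν₀ k γ L Lν)
    {x y : Feat d} (hx : x ∈ cube d) (hy : y ∈ cube d) {u : ℝ} (hu : |Lν| * ‖y - x‖ ≤ u) :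
    ∑ j ∈ (supp (ν₀ y))ᶜ, |ν₀ x j| ≤ k * u := by
  have hu0 : 0 ≤ u := le_trans (by positivity) hu
  have hj : ∀ j ∈ (supp (ν₀ y))ᶜ, |ν₀ x j| ≤ u := fun j hj => by
    have h0 : ν₀ y j = 0 := by simpa [supp] using hj
    calc |ν₀ x j| = ‖(ν₀ x - ν₀ y) j‖ := by simp [h0]
      _ ≤ ‖ν₀ x - ν₀ y‖ := PiLp.norm_apply_le _ j
      _ ≤ Lν * ‖x - y‖ := hN.lipschitz_nuisance x hx y hy
      _ ≤ |Lν| * ‖y - x‖ := by rw [norm_sub_rev]; gcongr; exact le_abs_self _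
      _ ≤ u := hu
  -- Only indices in the support at `x` contribute, at most `k` of them.
  calc ∑ j ∈ (supp (ν₀ y))ᶜ, |ν₀ x j|
      = ∑ j ∈ (supp (ν₀ y))ᶜ ∩ supp (ν₀ x), |ν₀ x j| := by
        symm
        refine Finset.sum_subset Finset.inter_subset_left fun j h1 h2 => ?_
        have : j ∉ supp (ν₀ x) := fun h => h2 (Finset.mem_inter.2 ⟨h1, h⟩)
        have h0 : ν₀ x j = 0 := by simpa [supp] using this
        simp [h0]
    _ ≤ ((supp (ν₀ y))ᶜ ∩ supp (ν₀ x)).card • u :=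
        Finset.sum_le_card_nsmul _ _ _ fun j h => hj j (Finset.mem_inter.1 h).1
    _ ≤ k * u := by
        rw [nsmul_eq_mul]
        gcongr
        exact (Finset.card_le_card Finset.inter_subset_right).trans (hN.sparse x hx)

end Nuisance

/-! ### Forest weights and averages over trees -/

section Forest

variable {d s n B : ℕ} {O Ξ : Type*} [MeasurableSpace O] [MeasurableSpace Ξ]

lemma sum_forestWeight (T : TreeLearner d s O Ξ) (x : Feat d) (hB : 0 < B)
    (Z : Fin n → Obs d O) (w : Fin B → Subsample n s × Ξ)
    (h : ∀ b, (blockLeaf T x ((fun j => Z ((w b).1 j)), (w b).2)).Nonempty) :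
    ∑ i, forestWeight T Z w x i = 1 := by
  have h1 := sum_forestWeight_mul T x Z w fun _ => 1
  simp only [mul_one, blockAvg] at h1
  rw [h1, Finset.sum_congr rfl fun b _ => sum_blockWeight T x _ (h b)]
  have : (B : ℝ) ≠ 0 := by positivity
  simp [this]

/-- The average over the trees of a forest of a function of the data and the seed of a tree. -/
noncomputable def forestAvg {Ω : Type*} (φ : ((Fin (s / 2) ⊕ Fin (s - s / 2)) → Ω) × Ξ → ℝ)
    (w : (Fin n → Ω) × (Fin B → Subsample n s × Ξ)) : ℝ :=
  (1 / (B : ℝ)) * ∑ b, φ ((fun j => w.1 ((w.2 b).1 j)), (w.2 b).2)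

lemma forestAvg_tail_abs {Ω : Type*} [MeasurableSpace Ω] {P : Measure Ω} [IsProbabilityMeasure P]
    {Q : Measure Ξ} [IsProbabilityMeasure Q]
    {φ : ((Fin (s / 2) ⊕ Fin (s - s / 2)) → Ω) × Ξ → ℝ} {M t v u : ℝ}
    (hφ : Measurable φ) (hM : ∀ z, |φ z| ≤ M) (hM0 : 0 < M) (ht : 0 ≤ t) (hB : 0 < B) (hs : 0 < s)
    (hsn : s ≤ n) (hv : 1 / (B : ℝ) + 1 / ((n / s : ℕ) : ℝ) ≤ v)
    (hu : |∫ z, φ z ∂((Measure.pi fun _ => P).prod Q)| + t ≤ u) :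
    ((Measure.pi fun _ : Fin n => P).prod (Measure.pi fun _ : Fin B =>
          (uniformOn (Set.univ : Set (Subsample n s))).prod Q))
      {w | u < |forestAvg φ w|} ≤
      2 * ENNReal.ofReal (Real.exp (-(t ^ 2 / (2 * M ^ 2 * v)))) := by
  have h1 := forest_average_tail (n := n) (B := B) (P := P) (Q := Q) hφ hM hM0 ht hB hs hsn hv
  have h2 := forest_average_tail (n := n) (B := B) (P := P) (Q := Q) (φ := fun z => -φ z)
    hφ.neg (fun z => by rw [abs_neg]; exact hM z) hM0 ht hB hs hsn hv
  rw [two_mul]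
  refine (measure_mono ?_).trans ((measure_union_le _ _).trans (add_le_add h1 h2))
  intro w hw
  rw [Set.mem_ofPred_eq] at hw
  rcases lt_abs.1 hw with h | h
  · left
    rw [Set.mem_ofPred_eq]
    have := le_abs_self (∫ z, φ z ∂((Measure.pi fun _ => P).prod Q))
    rw [forestAvg] at h
    linarith
  · right
    rw [Set.mem_ofPred_eq]
    have := neg_abs_le (∫ z, φ z ∂((Measure.pi fun _ => P).prod Q))
    rw [integral_neg, Finset.sum_neg_distrib, mul_neg]
    rw [forestAvg] at h
    linarith

end Forest

/-! ### Numerical bounds for the tail exponents -/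

section Numeric

variable {s n B : ℕ}

/-- `⌊n/s⌋ ≥ n / (2s)` whenever `s ≤ n`. This crude form is used for gradients and distances, whose
tail constants are free. -/
lemma inv_add_inv_floor_le (hs : 0 < s) (hsn : s ≤ n) (hB : (n / s : ℝ) ≤ B) :
    1 / (B : ℝ) + 1 / ((n / s : ℕ) : ℝ) ≤ 3 * (s / n) := by
  have hs0 : (0 : ℝ) < s := by exact_mod_cast hs
  have hn0 : (0 : ℝ) < n := by exact_mod_cast hs.trans_le hsn
  have hK : 1 ≤ n / s := (Nat.one_le_div_iff hs).2 hsn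
  have hK1 : (1 : ℝ) ≤ ((n / s : ℕ) : ℝ) := by exact_mod_cast hK
  have h1 : 1 / (B : ℝ) ≤ s / n := by
    rw [← one_div_div (n : ℝ) s]
    exact one_div_le_one_div_of_le (by positivity) hB
  have h2 : (n : ℝ) < s * (((n / s : ℕ) : ℝ) + 1) := by
    exact_mod_cast Nat.lt_mul_div_succ n hs
  have h3 : 1 / ((n / s : ℕ) : ℝ) ≤ 2 * (s / n) := by
    rw [mul_div_assoc', div_le_div_iff₀ (by linarith) hn0]
    nlinarith
  linarith

/-- A nearly sharp constant, needed for the matrix entries, where the threshold is fixed by the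
constant 32 of the theorem: `1/100 + 81/80 < 41/40`. -/
lemma inv_add_inv_floor_le_of_large (hs : 0 < s) (hsn : s ≤ n) (hB : 100 * (n / s : ℝ) ≤ B)
    (hns : 700 * (s : ℝ) ≤ n) :
    1 / (B : ℝ) + 1 / ((n / s : ℕ) : ℝ) ≤ 41 / 40 * (s / n) := by
  have hs0 : (0 : ℝ) < s := by exact_mod_cast hs
  have hn0 : (0 : ℝ) < n := by exact_mod_cast hs.trans_le hsn
  have hK : 1 ≤ n / s := (Nat.one_le_div_iff hs).2 hsn
  have hK1 : (1 : ℝ) ≤ ((n / s : ℕ) : ℝ) := by exact_mod_cast hK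
  have h1 : 1 / (B : ℝ) ≤ 1 / 100 * (s / n) := by
    refine (one_div_le_one_div_of_le (by positivity) hB).trans (le_of_eq ?_)
    field_simp
  have h2 : (n : ℝ) < s * (((n / s : ℕ) : ℝ) + 1) := by
    exact_mod_cast Nat.lt_mul_div_succ n hs
  have h3 : 1 / ((n / s : ℕ) : ℝ) ≤ 81 / 80 * (s / n) := by
    rw [mul_div_assoc', div_le_div_iff₀ (by linarith) hn0]
    nlinarith
  have : 0 < (s : ℝ) / n := by positivity
  linarith

lemma exp_neg_mul_log_le {δ m q : ℝ} (hδ : 0 < δ) (hm : δ ≤ m) (e : ℕ) (hq : e ≤ q) :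
    Real.exp (-(q * Real.log (m / δ))) ≤ (δ / m) ^ e := by
  have hm0 : 0 < m := hδ.trans_le hm
  have hlog : 0 ≤ Real.log (m / δ) := Real.log_nonneg ((one_le_div hδ).2 hm)
  have h1 : (δ / m) ^ e = Real.exp (-(e * Real.log (m / δ))) := by
    rw [← Real.log_pow, Real.exp_neg, Real.exp_log (by positivity), ← inv_pow, inv_div]
  rw [h1]
  exact Real.exp_le_exp.2 (neg_le_neg (by gcongr))

/-- There are `m` gradient events, one distance event and `m²` matrix events. As `δ / m ≤ 1/2`, each
group has probability at most `δ / 4`. -/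
lemma union_bound_le {δ m : ℝ} (hδ0 : 0 < δ) (hδ1 : δ ≤ 1) (hm : 2 * δ ≤ m) (hm1 : 1 ≤ m) :
    m * (2 * (δ / m) ^ 4) + 2 * (δ / m) ^ 4 + m * (m * (2 * (δ / m) ^ 5)) ≤ δ := by
  have hm0 : 0 < m := by linarith
  set y := δ / m with hy
  have hy0 : 0 < y := by positivity
  have hy1 : y ≤ 1 / 2 := by rw [hy, div_le_iff₀ hm0]; linarith
  have hyδ : y ≤ δ := div_le_self hδ0.le hm1
  have hmy : m * y = δ := by rw [hy]; field_simp
  have hy3 : y ^ 3 ≤ 1 / 8 := by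
    calc y ^ 3 ≤ (1 / 2) ^ 3 := by gcongr
      _ = 1 / 8 := by norm_num
  have hy30 : 0 ≤ y ^ 3 := by positivity
  have h1 : m * (2 * y ^ 4) + 2 * y ^ 4 + m * (m * (2 * y ^ 5)) =
      2 * (m * y) * y ^ 3 + 2 * y * y ^ 3 + 2 * (m * y) * (m * y) * y ^ 3 := by ring
  rw [h1, hmy]
  have h2 : 2 * δ * y ^ 3 ≤ 2 * δ * (1 / 8) := by gcongr
  have h3 : 2 * y * y ^ 3 ≤ 2 * δ * (1 / 8) := by gcongr
  have h4 : 2 * δ * δ * y ^ 3 ≤ 2 * δ * 1 * (1 / 8) := by gcongr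
  linarith

end Numeric

/-! ### From small forest averages to the error bound -/

section Error

variable {d m n : ℕ} {O : Type*} [MeasurableSpace O] {κ : Kernel (Feat d) O} [IsMarkovKernel κ]
  {V : Set (EuclideanSpace ℝ (Fin m))} {ℓ : Obs d O → EuclideanSpace ℝ (Fin m) → ℝ}
  {H : Obs d O → Matrix (Fin m) (Fin m) ℝ} {ν₀ : Feat d → EuclideanSpace ℝ (Fin m)} {k : ℕ}
  {γ L Lν : ℝ}

/-- The centered gradient of the loss at `ν₀ x`. -/
noncomputable def gradDev (κ : Kernel (Feat d) O) (ℓ : Obs d O → EuclideanSpace ℝ (Fin m) → ℝ)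
    (ν₀ : Feat d → EuclideanSpace ℝ (Fin m)) (x : Feat d) (j : Fin m) : Obs d O → ℝ :=
  onCube fun z => gradient (ℓ z) (ν₀ x) j - (∫ o, gradient (ℓ (x, o)) (ν₀ x) ∂(κ x)) j

/-- The conditionally centered entries of the curvature matrix. -/
noncomputable def matrixDev (κ : Kernel (Feat d) O) (H : Obs d O → Matrix (Fin m) (Fin m) ℝ)
    (b c : Fin m) : Obs d O → ℝ :=
  onCube fun z => H z b c - ∫ o, H (z.1, o) b c ∂(κ z.1)

lemma NuisanceAssumptions.error_le (hN : NuisanceAssumptions κ V ℓ H ν₀ k γ L Lν) {x : Feat d}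
    (hx : x ∈ cube d) {Z : Fin n → Obs d O} (hZ : ∀ i, (Z i).1 ∈ cube d) {a : Fin n → ℝ}
    (ha : ∀ i, 0 ≤ a i) (hsum : ∑ i, a i = 1) {lam ε thr : ℝ} (hlam : 0 < lam) (hε : 0 ≤ ε)
    (hγ : 32 * k * ε < γ) (hthr : 0 < thr) (hthr' : |Lν| * thr ≤ lam / 4)
    (hgrad : ∀ j, |∑ i, a i * gradDev κ ℓ ν₀ x j (Z i)| ≤ lam / 20)
    (hD : |∑ i, a i * cubeDist x (Z i).1| ≤ thr / 20)
    (hH : ε < 1 / 32 → ∀ b c, |∑ i, a i * matrixDev κ H b c (Z i)| ≤ 13 / 2 * ε)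
    {ν : EuclideanSpace ℝ (Fin m)} (hν : ν ∈ V)
    (hmin : IsMinOn (fun y => ∑ i, a i * ℓ (Z i) y + lam * l1 y) V ν) :
    l1 (ν - ν₀ x) ≤ 2 * lam * k / (γ - 32 * k * ε) := by
  obtain ⟨hνV, hνmin⟩ := hN.minimizer x hx
  refine lasso_error_bound Finset.univ hN.convex (g := fun i => ℓ (Z i)) (a := a)
    (D := fun i => cubeDist x (Z i).1) (H := fun i => H (Z i))
    (M := fun i => Matrix.of fun b c => ∫ o, H ((Z i).1, o) b c ∂(κ (Z i).1))
    (S := fun i => supp (ν₀ (Z i).1)) (gbar := ∫ o, gradient (ℓ (x, o)) (ν₀ x) ∂(κ x))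
    (thr := thr) (fun i _ => ha i) hsum hνV hν (fun i _ => hN.smooth_loss _ (hZ i))
    (fun i _ => hN.hessian _ (hZ i))
    (fun i _ => quad_nonneg_of_posSemidef (hN.posSemidef_matrix _ (hZ i))) (hN.sparse x hx)
    ?_ (fun j => ?_) (fun i _ => cubeDist_nonneg _ _) hthr ((le_abs_self _).trans hD)
    (fun i _ => hN.quad_integral_nonneg (hZ i))
    (fun i _ => hN.restricted_eigenvalue _ (hZ i)) (fun i _ hi => ?_) (fun hne => ?_) hlam hε hγ
    hmin
  · exact inner_integral_gradient_nonneg hN.convex (fun o => hN.smooth_loss (x, o) hx)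
      (fun o y hy v => (quad_nonneg_of_posSemidef (hN.posSemidef_matrix (x, o) hx) v).trans
        (hN.hessian (x, o) hx y hy v)) (hN.integrable_loss x hx)
      (hN.integrable_gradient x hx _ hνV) hνV hν hνmin
  · have h := hgrad j
    simp only [gradDev, onCube_of_mem (hZ _)] at h
    exact h
  · have hi' : ‖(Z i).1 - x‖ ≤ thr := by simpa [cubeDist, hZ i] using hi
    have h := hN.sum_off_support_le hx (hZ i) (u := lam / 4)
      ((mul_le_mul_of_nonneg_left hi' (abs_nonneg _)).trans hthr')
    linarith
  · have hγ1 := hN.eigenvalue_le_one hx hne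
    have hk : (1 : ℝ) ≤ k := by exact_mod_cast hne.card_pos.trans_le (hN.sparse x hx)
    -- `32 * k * ε < γ ≤ 1` with `k ≥ 1`. The matrix entries thus need control only for small `ε`,
    -- that is, for large `n / s`.
    have hε' : ε < 1 / 32 := by nlinarith
    refine ⟨hγ1, fun b c => ?_⟩
    have h := hH hε' b c
    simp only [matrixDev, onCube_of_mem (hZ _)] at h
    exact h

end Error

/-! ### Probability of the bad event -/

section Tail

variable {d m n s B : ℕ} {O Ξ : Type*} [MeasurableSpace O] [MeasurableSpace Ξ]
  {f : Feat d → ℝ} {κ : Kernel (Feat d) O} [IsMarkovKernel κ]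
  [IsProbabilityMeasure (featureLaw f)] {Q : Measure Ξ} [IsProbabilityMeasure Q]
  {V : Set (EuclideanSpace ℝ (Fin m))} {ℓ : Obs d O → EuclideanSpace ℝ (Fin m) → ℝ}
  {H : Obs d O → Matrix (Fin m) (Fin m) ℝ} {ν₀ : Feat d → EuclideanSpace ℝ (Fin m)} {k : ℕ}
  {γ L Lν : ℝ} {T : TreeLearner d s O Ξ}

/-- Deviations of the forest average of a function with small conditional means. -/
lemma forestAvg_blockAvg_tail {x : Feat d} (hx : x ∈ cube d) {h : Obs d O → ℝ} {M c a v t u : ℝ}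
    (hh : Measurable h) (hM0 : 0 < M) (hM : ∀ z, |h z| ≤ M)
    (hmean : ∀ y, |∫ o, h (y, o) ∂(κ y)| ≤ c * cubeDist x y) (hc : 0 ≤ c)
    (ha : ∫ p, blockAvg T x (fun z => cubeDist x z.1) p
        ∂((Measure.pi fun _ : Fin (s / 2) ⊕ Fin (s - s / 2) => obsLaw f κ).prod Q) ≤ a)
    (ht : 0 ≤ t) (hB : 0 < B) (hs : 0 < s) (hsn : s ≤ n)
    (hv : 1 / (B : ℝ) + 1 / ((n / s : ℕ) : ℝ) ≤ v) (hu : c * a + t ≤ u) :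
    forestLaw n s B f κ Q {w | u < |forestAvg (blockAvg T x h) w|} ≤
      2 * ENNReal.ofReal (Real.exp (-(t ^ 2 / (2 * M ^ 2 * v)))) := by
  refine forestAvg_tail_abs (measurable_blockAvg T x hh) (abs_blockAvg_le_const T x hM0.le hM) hM0
    ht hB hs hsn hv (le_trans ?_ hu)
  gcongr
  refine (abs_integral_blockAvg_le T x hM0.le hh hM (measurable_cubeDist x)
    (M' := d) (fun y => ?_) (by positivity) hmean).trans (by gcongr; exact ha)
  rw [abs_of_nonneg (cubeDist_nonneg x y)]
  exact cubeDist_le hx y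

/-- The event on which one of the forest averages deviates too much. -/
def badEvent (n B : ℕ) (T : TreeLearner d s O Ξ) (κ : Kernel (Feat d) O)
    (ℓ : Obs d O → EuclideanSpace ℝ (Fin m) → ℝ) (H : Obs d O → Matrix (Fin m) (Fin m) ℝ)
    (ν₀ : Feat d → EuclideanSpace ℝ (Fin m)) (x : Feat d) (ε lam thr : ℝ) :
    Set ((Fin n → Obs d O) × (Fin B → Subsample n s × Ξ)) :=
  (⋃ j, {w | lam / 20 < |forestAvg (blockAvg T x (gradDev κ ℓ ν₀ x j)) w|}) ∪
    {w | thr / 20 < |forestAvg (blockAvg T x fun z => cubeDist x z.1) w|} ∪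
    ⋃ b, ⋃ c, {w | ε < 1 / 32 ∧
      13 / 2 * ε < |forestAvg (blockAvg T x (matrixDev κ H b c)) w|}

lemma NuisanceAssumptions.badEvent_tail (hN : NuisanceAssumptions κ V ℓ H ν₀ k γ L Lν)
    {x : Feat d} (hx : x ∈ cube d) (hd : 1 ≤ d) {G a δ lam thr : ℝ}
    (hG : ∀ z : Obs d O, z.1 ∈ cube d → ∀ j, |gradient (ℓ z) (ν₀ x) j| ≤ G)
    (ha : ∫ p, blockAvg T x (fun z => cubeDist x z.1) p
        ∂((Measure.pi fun _ : Fin (s / 2) ⊕ Fin (s - s / 2) => obsLaw f κ).prod Q) ≤ a)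
    (hs : 0 < s) (hsn : s ≤ n) (hB : 100 * (n / s : ℝ) ≤ B)
    (hδ0 : 0 < δ) (hδ1 : δ < 1) (hm : 2 * δ ≤ m)
    (hlam : |L| * a + 5 * (2 * |G| + 1) * √(s * Real.log (m / δ) / n) ≤ lam / 20)
    (hthr : a + 5 * d * √(s * Real.log (m / δ) / n) ≤ thr / 20) :
    forestLaw n s B f κ Q
      (badEvent n B T κ ℓ H ν₀ x √(s * Real.log (m / δ) / n) lam thr) ≤ ENNReal.ofReal δ := by
  have hs0 : (0 : ℝ) < s := by exact_mod_cast hs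
  have hn0 : (0 : ℝ) < n := by exact_mod_cast hs.trans_le hsn
  have hd0 : (0 : ℝ) < d := by exact_mod_cast hd
  have hm0 : (0 : ℝ) < m := by linarith
  have hm1 : (1 : ℝ) ≤ m := by
    have : 0 < m := by exact_mod_cast hm0
    exact_mod_cast this
  have hBr : (0 : ℝ) < B := lt_of_lt_of_le (by positivity) hB
  have hB0 : 0 < B := by exact_mod_cast hBr
  have hml : (2 : ℝ) ≤ m / δ := by rw [le_div_iff₀ hδ0]; exact hm
  -- The hypothesis `2 * δ ≤ m` gives `log (m / δ) ≥ log 2`.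
  have hlog : (69 / 100 : ℝ) ≤ Real.log (m / δ) := by
    have h1 := Real.log_le_log (by norm_num) hml
    linarith [Real.log_two_gt_d9]
  set ε := √(s * Real.log (m / δ) / n) with hε
  have hε0 : 0 ≤ ε := Real.sqrt_nonneg _
  have hεsq : ε ^ 2 = s * Real.log (m / δ) / n :=
    Real.sq_sqrt (div_nonneg (mul_nonneg hs0.le (by linarith)) hn0.le)
  have hv3 := inv_add_inv_floor_le hs hsn (le_trans (by
    have : (0 : ℝ) ≤ n / s := by positivity
    linarith) hB : (n / s : ℝ) ≤ B)
  -- With deviation `5 M ε` and proxy `3 s / n` the exponent is `(25/6) log (m / δ)`, enough for a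
  -- fourth power.
  have hexp : ∀ M : ℝ, 0 < M →
      Real.exp (-((5 * M * ε) ^ 2 / (2 * M ^ 2 * (3 * (s / n))))) ≤ (δ / m) ^ 4 := fun M hM => by
    have h1 : (5 * M * ε) ^ 2 / (2 * M ^ 2 * (3 * ((s : ℝ) / n))) =
        25 / 6 * Real.log (m / δ) := by
      rw [mul_pow, hεsq]; field_simp; ring
    rw [h1]
    exact exp_neg_mul_log_le hδ0 (by linarith) 4 (by norm_num)
  have hgrad : ∀ j, forestLaw n s B f κ Q
      {w | lam / 20 < |forestAvg (blockAvg T x (gradDev κ ℓ ν₀ x j)) w|} ≤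
      ENNReal.ofReal (2 * (δ / m) ^ 4) := fun j => by
    have hM : (0 : ℝ) < 2 * |G| + 1 := by positivity
    refine (forestAvg_blockAvg_tail hx (hN.measurable_gradient_sub hx j _) hM
      (abs_onCube_le hM.le (hN.abs_gradient_sub_le hx hG j))
      (hN.abs_integral_gradient_le hx j) (abs_nonneg L) ha (by positivity) hB0 hs hsn hv3
      hlam).trans ?_
    rw [ENNReal.ofReal_mul zero_le_two, ENNReal.ofReal_ofNat]
    gcongr
    exact hexp _ hM
  have hdist : forestLaw n s B f κ Q
      {w | thr / 20 < |forestAvg (blockAvg T x fun z => cubeDist x z.1) w|} ≤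
      ENNReal.ofReal (2 * (δ / m) ^ 4) := by
    refine (forestAvg_blockAvg_tail hx (h := fun z => cubeDist x z.1) (c := 1)
      ((measurable_cubeDist x).comp measurable_fst) hd0
      (fun z => by rw [abs_of_nonneg (cubeDist_nonneg _ _)]; exact cubeDist_le hx _)
      (fun y => by simp [abs_of_nonneg (cubeDist_nonneg x y)]) zero_le_one ha
      (t := 5 * d * ε) (by positivity) hB0 hs hsn hv3 (by linarith)).trans ?_
    rw [ENNReal.ofReal_mul zero_le_two, ENNReal.ofReal_ofNat]
    gcongr
    exact hexp _ hd0
  have hmat : ∀ b c, forestLaw n s B f κ Q {w | ε < 1 / 32 ∧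
      13 / 2 * ε < |forestAvg (blockAvg T x (matrixDev κ H b c)) w|} ≤
      ENNReal.ofReal (2 * (δ / m) ^ 5) := fun b c => by
    by_cases hε1 : ε < 1 / 32
    -- `ε < 1/32` reads `s log (m / δ) / n < 1/1024`, and `0.69 * 1024 > 700`. The sharper proxy
    -- then gives the exponent `845/164 > 5`.
    · have hns : 700 * (s : ℝ) ≤ n := by
        have h1 : ε ^ 2 < (1 / 32) ^ 2 := by gcongr
        rw [hεsq, div_lt_iff₀ hn0] at h1
        nlinarith
      have hv := inv_add_inv_floor_le_of_large hs hsn hB hns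
      simp only [hε1, true_and]
      refine (forestAvg_blockAvg_tail hx (hN.measurable_matrix_sub b c) two_pos
        (abs_onCube_le zero_le_two (hN.abs_matrix_sub_le b c)) (c := 0)
        (fun y => by rw [hN.integral_matrix_sub b c y]; simp) le_rfl ha (t := 13 / 2 * ε)
        (by positivity) hB0 hs hsn hv (by linarith)).trans ?_
      rw [ENNReal.ofReal_mul zero_le_two, ENNReal.ofReal_ofNat]
      gcongr
      have h1 : (13 / 2 * ε) ^ 2 / (2 * 2 ^ 2 * (41 / 40 * ((s : ℝ) / n))) =
          845 / 164 * Real.log (m / δ) := by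
        rw [mul_pow, hεsq]; field_simp; ring
      rw [h1]
      exact exp_neg_mul_log_le hδ0 (by linarith) 5 (by norm_num)
    · have h0 : {w : (Fin n → Obs d O) × (Fin B → Subsample n s × Ξ) | ε < 1 / 32 ∧
          13 / 2 * ε < |forestAvg (blockAvg T x (matrixDev κ H b c)) w|} = ∅ :=
        Set.eq_empty_of_forall_notMem fun w hw => hε1 hw.1
      rw [h0, measure_empty]
      exact zero_le
  have hp4 : 0 ≤ 2 * (δ / m) ^ 4 := by positivity
  have hp5 : 0 ≤ 2 * (δ / m) ^ 5 := by positivity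
  calc forestLaw n s B f κ Q (badEvent n B T κ ℓ H ν₀ x ε lam thr)
      ≤ (∑ _j : Fin m, ENNReal.ofReal (2 * (δ / m) ^ 4)) + ENNReal.ofReal (2 * (δ / m) ^ 4) +
          ∑ _b : Fin m, ∑ _c : Fin m, ENNReal.ofReal (2 * (δ / m) ^ 5) := by
        refine (measure_union_le _ _).trans (add_le_add ((measure_union_le _ _).trans
          (add_le_add ?_ hdist)) ?_)
        · exact (measure_iUnion_fintype_le _ _).trans (Finset.sum_le_sum fun j _ => hgrad j)
        · exact (measure_iUnion_fintype_le _ _).trans (Finset.sum_le_sum fun b _ =>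
            (measure_iUnion_fintype_le _ _).trans (Finset.sum_le_sum fun c _ => hmat b c))
    _ = ENNReal.ofReal (m * (2 * (δ / m) ^ 4) + 2 * (δ / m) ^ 4 +
          m * (m * (2 * (δ / m) ^ 5))) := by
        rw [ENNReal.ofReal_add (by positivity) (by positivity),
          ENNReal.ofReal_add (by positivity) hp4, ENNReal.ofReal_mul hm0.le,
          ENNReal.ofReal_mul hm0.le (q := m * (2 * (δ / m) ^ 5)), ENNReal.ofReal_mul hm0.le,
          ENNReal.ofReal_natCast]
        simp
    _ ≤ _ := ENNReal.ofReal_le_ofReal (union_bound_le hδ0 hδ1.le hm hm1)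

/-- With no data general position is vacuous, yet a regular tree needs a leaf containing at least
one point. -/
lemma TreeLearner.IsForestRegular.pos {Q : Measure Ξ} [IsProbabilityMeasure Q] {ρ π : ℝ} {r : ℕ}
    (hT : T.IsForestRegular Q ρ π r) (hr : 1 ≤ r) : 0 < s := by
  rcases Nat.eq_zero_or_pos s with rfl | h
  · have hreg := hT.regular (fun i => i.elim0) (fun i => i.elim0)
      ⟨fun i => by rcases i with i | i <;> exact i.elim0,
        fun j i => by rcases i with i | i <;> exact i.elim0⟩
    obtain ⟨ξ, hξ⟩ := hreg.exists
    obtain ⟨i, -, -⟩ := exists_mem_leafCell_of_isRegular hr hξ (0 : Feat d)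
    exact i.elim0
  · exact h

/-- Outside the bad event and a null set every minimizer satisfies the bound. -/
lemma NuisanceAssumptions.error_tail (hN : NuisanceAssumptions κ V ℓ H ν₀ k γ L Lν)
    {x : Feat d} (hx : x ∈ cube d) (hd : 1 ≤ d) {ρ π : ℝ} {r : ℕ}
    (hT : T.IsForestRegular Q ρ π r) (hr : 1 ≤ r) {G a δ lam thr : ℝ}
    (hG : ∀ z : Obs d O, z.1 ∈ cube d → ∀ j, |gradient (ℓ z) (ν₀ x) j| ≤ G)
    (ha : ∫ p, blockAvg T x (fun z => cubeDist x z.1) p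
        ∂((Measure.pi fun _ : Fin (s / 2) ⊕ Fin (s - s / 2) => obsLaw f κ).prod Q) ≤ a)
    (hsn : s ≤ n) (hB : 100 * (n / s : ℝ) ≤ B)
    (hδ0 : 0 < δ) (hδ1 : δ < 1) (hm : 2 * δ ≤ m)
    (hγ : 32 * k * √(s * Real.log (m / δ) / n) < γ) (hlam0 : 0 < lam)
    (hlam : |L| * a + 5 * (2 * |G| + 1) * √(s * Real.log (m / δ) / n) ≤ lam / 20)
    (hthr0 : 0 < thr) (hthr' : |Lν| * thr ≤ lam / 4)
    (hthr : a + 5 * d * √(s * Real.log (m / δ) / n) ≤ thr / 20) :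
    forestLaw n s B f κ Q
        {w | ¬ ∀ ν, IsForestLasso T ℓ V lam x w.1 w.2 ν →
          l1 (ν - ν₀ x) ≤ 2 * lam * k / (γ - 32 * k * √(s * Real.log (m / δ) / n))}
      ≤ ENNReal.ofReal δ := by
  have hs : 0 < s := hT.pos hr
  have hs0 : (0 : ℝ) < s := by exact_mod_cast hs
  have hn0 : (0 : ℝ) < n := by exact_mod_cast hs.trans_le hsn
  have hBr : (0 : ℝ) < B := lt_of_lt_of_le (by positivity) hB
  have hB0 : 0 < B := by exact_mod_cast hBr
  have hnull := ae_forest_of_ae_block (n := n) (B := B)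
    (ae_blockLeaf_nonempty (f := f) (κ := κ) hT hr x) hsn
  have : Nonempty (Subsample n s) := nonempty_subsample hsn
  have : IsProbabilityMeasure (uniformOn (Set.univ : Set (Subsample n s))) :=
    isProbabilityMeasure_uniformOn Set.finite_univ Set.univ_nonempty
  have hcube : ∀ᵐ w ∂forestLaw n s B f κ Q, ∀ i, (w.1 i).1 ∈ cube d :=
    Measure.quasiMeasurePreserving_fst.ae ae_pi_mem_cube
  refine le_trans ?_ (hN.badEvent_tail hx hd hG ha hs hsn hB hδ0 hδ1 hm hlam hthr)
  -- The violation event need not be measurable; it is covered, up to a null set, by the bad event.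
  refine measure_mono_ae ?_
  filter_upwards [hnull, hcube] with w h1 h2
  rintro (h3 : ¬ _)
  by_contra hbad
  refine h3 fun ν hν => ?_
  have hbad' : w ∉ badEvent n B T κ ℓ H ν₀ x √(s * Real.log (m / δ) / n) lam thr := hbad
  simp only [badEvent, Set.mem_union, Set.mem_iUnion, Set.mem_ofPred_eq, not_or, not_exists,
    not_and, not_lt] at hbad'
  obtain ⟨⟨hg, hdist⟩, hmat⟩ := hbad'
  have hsum : ∀ h : Obs d O → ℝ, ∑ i, forestWeight T w.1 w.2 x i * h (w.1 i) =
      forestAvg (blockAvg T x h) w := fun h => sum_forestWeight_mul T x w.1 w.2 h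
  refine hN.error_le hx h2 (forestWeight_nonneg T x w.1 w.2)
    (sum_forestWeight T x hB0 w.1 w.2 h1) hlam0 (Real.sqrt_nonneg _) hγ hthr0 hthr'
    (fun j => ?_) ?_ (fun hε b c => ?_) hν.1 hν.2
  · rw [hsum]; exact hg j
  · rw [hsum fun z => cubeDist x z.1]; exact hdist
  · rw [hsum]; exact hmat b c hε

end Tail

end ForestLasso

/-! ### Choice of the constant and conclusion -/

theorem theorem5p1 (d : ℕ) (hd : 1 ≤ d)
    (ρ π : ℝ) (hρ₀ : 0 < ρ) (hρ : ρ ≤ 1 / 5) (hπ₀ : 0 < π) (hπ : π ≤ 1) (r : ℕ) (hr : 1 ≤ r)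
    (c₀ c₁ : ℝ) (hc₀ : 0 < c₀) (ω : ℝ → ℝ) (hω : Tendsto ω (𝓝[>] 0) (𝓝 0)) (L Lν G : ℝ) :
    ∃ C : ℝ, 0 < C ∧
      ∀ (O Ξ : Type*) [MeasurableSpace O] [MeasurableSpace Ξ]
        -- the distribution of the data and the target point
        (f : ForestLasso.Feat d → ℝ) (κ : Kernel (ForestLasso.Feat d) O) (x : ForestLasso.Feat d)
        -- the sample size, the subsample size, the number of trees, the learner and its seed
        (n s B : ℕ) (T : ForestLasso.TreeLearner d s O Ξ) (Q : Measure Ξ)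
        -- the parametric family, the loss and the nuisance parameter
        (m : ℕ) (V : Set (EuclideanSpace ℝ (Fin m)))
        (ℓ : ForestLasso.Obs d O → EuclideanSpace ℝ (Fin m) → ℝ)
        (H : ForestLasso.Obs d O → Matrix (Fin m) (Fin m) ℝ)
        (ν₀ : ForestLasso.Feat d → EuclideanSpace ℝ (Fin m))
        (k : ℕ) (γ δ lam : ℝ),
        Measurable f → (∀ y ∈ ForestLasso.cube d, c₀ ≤ f y ∧ f y ≤ c₁) →
        IsProbabilityMeasure (ForestLasso.featureLaw f) → IsMarkovKernel κ →
        x ∈ ForestLasso.cube d → (∀ y ∈ ForestLasso.cube d, |f y - f x| ≤ ω ‖y - x‖) →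
        s ≤ n → IsProbabilityMeasure Q → T.IsForestRegular Q ρ π r → C * (n / s) ≤ B →
        ForestLasso.NuisanceAssumptions κ V ℓ H ν₀ k γ L Lν →
        (∀ z : ForestLasso.Obs d O, z.1 ∈ ForestLasso.cube d →
          ∀ j, |gradient (ℓ z) (ν₀ x) j| ≤ G) →
        0 < δ → δ < 1 → 2 * δ ≤ m →
        32 * k * √(s * Real.log (m / δ) / n) < γ →
        C * ((s : ℝ) ^ (-(1 / (2 * ForestLasso.alpha ρ π * d))) + √(s * Real.log (m / δ) / n))
          ≤ lam →
        -- the probability that some minimizer violates the bound is at most `δ`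
        ForestLasso.forestLaw n s B f κ Q
            {w | ¬ ∀ ν, ForestLasso.IsForestLasso T ℓ V lam x w.1 w.2 ν →
              ForestLasso.l1 (ν - ν₀ x) ≤
                2 * lam * k / (γ - 32 * k * √(s * Real.log (m / δ) / n))}
          ≤ ENNReal.ofReal δ := by
  -- If `c₁ < c₀` no density satisfies the bounds at `x`, and any constant works.
  by_cases hc : c₀ ≤ c₁
  swap
  · refine ⟨1, one_pos, ?_⟩
    intro O Ξ _ _ f κ x n s B T Q m V ℓ H ν₀ k γ δ lam _ hf _ _ hx
    exact absurd ((hf x hx).1.trans (hf x hx).2) hc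
  obtain ⟨A, hA0, hA⟩ := ForestLasso.exists_shrinkage d hd hρ₀ hρ hπ₀ hπ r hc₀ hc hω
  -- The three summands serve the number of trees, the gradient threshold `lam / 20`, and the
  -- distance threshold `thr / 20 = lam / (80 (|Lν| + 1))`.
  set C : ℝ := 100 + 20 * (|L| * A + 5 * (2 * |G| + 1)) + 80 * (|Lν| + 1) * (A + 5 * d) with hC
  have hC1 : 100 ≤ C := by
    have : 0 ≤ 20 * (|L| * A + 5 * (2 * |G| + 1)) + 80 * (|Lν| + 1) * (A + 5 * d) := by positivity
    linarith
  have hC2 : 20 * (|L| * A + 5 * (2 * |G| + 1)) ≤ C := by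
    have : 0 ≤ 80 * (|Lν| + 1) * (A + 5 * d) := by positivity
    linarith
  have hC3 : 80 * (|Lν| + 1) * (A + 5 * d) ≤ C := by
    have : 0 ≤ 20 * (|L| * A + 5 * (2 * |G| + 1)) := by positivity
    linarith
  refine ⟨C, by linarith, ?_⟩
  intro O Ξ _ _ f κ x n s B T Q m V ℓ H ν₀ k γ δ lam _ hf _ _ hx hfx hsn _ hT hB hN hG hδ0 hδ1 hm
    hγ hlam
  have hs : 0 < s := hT.pos hr
  have hs0 : (0 : ℝ) < s := by exact_mod_cast hs
  have hns : (0 : ℝ) ≤ n / s := by positivity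
  have hmean := hA O Ξ f κ x s T Q hs hf hx hfx hT
  set R : ℝ := (s : ℝ) ^ (-(1 / (2 * ForestLasso.alpha ρ π * d)))
  set ε : ℝ := √(s * Real.log (m / δ) / n)
  have hR : 0 < R := Real.rpow_pos_of_pos hs0 _
  have hε : 0 ≤ ε := Real.sqrt_nonneg _
  have hlam0 : 0 < lam := lt_of_lt_of_le (mul_pos (by linarith) (by linarith)) hlam
  have hLν : 0 < |Lν| + 1 := by positivity
  -- Within distance `thr` of `x` the nuisance parameter moves by at most `lam / 4`; the `+ 1`
  -- avoids dividing by zero.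
  refine hN.error_tail hx hd hT hr hG hmean hsn (le_trans (by gcongr) hB) hδ0 hδ1 hm hγ hlam0 ?_
    (thr := lam / (4 * (|Lν| + 1))) (by positivity) ?_ ?_
  · have h1 := mul_le_mul_of_nonneg_right hC2 (by linarith : 0 ≤ R + ε)
    have h2 : 0 ≤ |L| * A * ε := by positivity
    have h3 : 0 ≤ 5 * (2 * |G| + 1) * R := by positivity
    nlinarith
  · rw [mul_div_assoc', div_le_div_iff₀ (by positivity) (by norm_num)]
    nlinarith [abs_nonneg Lν]
  · have h1 := mul_le_mul_of_nonneg_right hC3 (by linarith : 0 ≤ R + ε)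
    have h2 : 0 ≤ A * ε := by positivity
    have h3 : 0 ≤ 5 * d * R := by positivity
    rw [div_div, le_div_iff₀ (by positivity)]
    calc (A * R + 5 * d * ε) * (4 * (|Lν| + 1) * 20)
        ≤ ((A + 5 * d) * (R + ε)) * (4 * (|Lν| + 1) * 20) := by gcongr; nlinarith
      _ = 80 * (|Lν| + 1) * (A + 5 * d) * (R + ε) := by ring
      _ ≤ lam := h1.trans hlam
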